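/- \textbf{Theorem.} Let $Q$ be an acyclic quiver (no oriented cycles) of extended Dynkin type, i.e. its underlying unoriented graph is one of $\widetilde A_n$ ($n\ge 1$; $\widetilde A_1$ is two vertices joined by two edges), $\widetilde D_n$ ($n\ge 4$), $\widetilde E_6$, $\widetilde E_7$, $\widetilde E_8$. Then there exist a finite-dimensional indecomposable complex representation $X$ of $Q$ which lies in a homogeneous tube, and a dimension vector $\underline e\in\mathbb N Q_0$, such that the quiver Grassmannian $\mathrm{Gr}_{\underline e}(X)$ is singular as a variety. Here a homogeneous tube is a component of the Auslander--Reiten quiver of $Q$ that is a tube of rank one, i.e. of the form $\mathbb Z A_\infty/\langle\tau\rangle$: it consists of representations $T_0,T_1,T_2,\dots$ such that there are almost split sequences $0\to T_0\to T_1\to T_0\to 0$ and $0\to T_{n+1}\to T_n\oplus T_{n+2}\to T_{n+1}\to 0$ for all $n\ge 0$. Moreover, $\mathrm{Gr}_{\underline e}(X)$ is the set of subrepresentations $U$ of $X$ with $\underline{\dim}\,U=\underline e$, with its structure of a (reduced) closed subvariety of the product $\prod_{p\in Q_0}\mathrm{Gr}(e_p,X_p)$ of ordinary Grassmannians; it is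 singular as a variety if its local ring at some point is not a regular local ring. -/

import Mathlib

open CategoryTheory CategoryTheory.Limits

universe u v

/-! ### Quivers of extended Dynkin type -/

/-- The extended Dynkin (simply laced affine) diagrams. -/
inductive ExtDynkin : Type
  | A (n : ℕ) (hn : 1 ≤ n)
  | D (n : ℕ) (hn : 4 ≤ n)
  | E6
  | E7
  | E8

/-- The number of vertices of an extended Dynkin diagram; the vertices are numbered from `0`. -/
def ExtDynkin.numVertices : ExtDynkin → ℕ
  | .A n _ => n + 1
  | .D n _ => n + 1
  | .E6 => 7
  | .E7 => 8
  | .E8 => 9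

/-- The edges of an extended Dynkin diagram, each edge being listed once:
a cycle with `n + 1` vertices (two vertices joined by a double edge if `n = 1`) for type `A`;
a path `2, …, n - 2` with two further leaves at each of its end points for type `D`;
the stars with three arms having `2, 2, 2`, respectively `3, 3, 1`, respectively `2, 5, 1`
vertices besides the centre for types `E6`, `E7`, `E8`. -/
def ExtDynkin.edges : ExtDynkin → List (ℕ × ℕ)
  | .A n _ => (List.range (n + 1)).map fun i => (i, (i + 1) % (n + 1))
  | .D n _ => [(0, 2), (1, 2)] ++ ((List.range (n - 3)).map fun i => (i + 2, i + 3)) ++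
      [(n - 2, n)]
  | .E6 => [(0, 1), (1, 2), (2, 3), (3, 4), (2, 5), (5, 6)]
  | .E7 => [(0, 1), (1, 2), (2, 3), (3, 4), (4, 5), (5, 6), (3, 7)]
  | .E8 => [(0, 1), (1, 2), (2, 3), (3, 4), (4, 5), (5, 6), (6, 7), (2, 8)]

/-- The number of edges between the vertices `i` and `j`. -/
def ExtDynkin.mult (T : ExtDynkin) (i j : ℕ) : ℕ :=
  T.edges.count (i, j) + T.edges.count (j, i)

/-- A quiver is of extended Dynkin type if its underlying unoriented graph is (isomorphic to)
an extended Dynkin diagram. (There are no loops in these diagrams, so for `i = j` the condition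
says that there is no arrow `i ⟶ i`.) -/
def IsExtendedDynkin (V : Type u) [Quiver.{v} V] : Prop :=
  ∃ (T : ExtDynkin) (σ : V ≃ Fin T.numVertices),
    ∀ i j : V, Nonempty (((i ⟶ j) ⊕ (j ⟶ i)) ≃ Fin (T.mult (σ i) (σ j)))

/-- A quiver is acyclic if it has no oriented cycles. -/
def IsAcyclicQuiver (V : Type u) [Quiver.{v} V] : Prop :=
  ∀ (i : V) (p : Quiver.Path i i), p.length = 0

/-! ### Representations and homogeneous tubes -/

/-- The category `Rep(Q)` of finite-dimensional complex representations of a quiver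
(with finitely many vertices), as functors from its path category to the category of
finite-dimensional complex vector spaces. -/
abbrev QuiverRep (V : Type u) [Quiver.{v} V] := Paths V ⥤ FGModuleCat.{0} ℂ

/-- An almost split sequence (Auslander–Reiten sequence) `0 ⟶ A ⟶ B ⟶ C ⟶ 0`: a short exact
sequence that is not split, with indecomposable end terms, such that every morphism to `C` that is
not a split epimorphism factors through `B ⟶ C`, and every morphism from `A` that is not a split
monomorphism factors through `A ⟶ B`. -/
structure IsAlmostSplit {C : Type*} [Category C] [Abelian C] (S : ShortComplex C) : Prop where
  shortExact : S.ShortExact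
  not_split : IsEmpty S.Splitting
  indecomposable_left : Indecomposable S.X₁
  indecomposable_right : Indecomposable S.X₃
  lift : ∀ (M : C) (h : M ⟶ S.X₃), ¬ IsSplitEpi h → ∃ k : M ⟶ S.X₂, k ≫ S.g = h
  desc : ∀ (M : C) (h : S.X₁ ⟶ M), ¬ IsSplitMono h → ∃ k : S.X₂ ⟶ M, S.f ≫ k = h

/-- There is an almost split sequence `0 ⟶ A ⟶ B ⟶ C ⟶ 0`; thus `A` is the Auslander–Reiten
translate `τ C`. -/
def HasAlmostSplitSequence {C : Type*} [Category C] [Abelian C] (A B D : C) : Prop :=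
  ∃ (f : A ⟶ B) (g : B ⟶ D) (w : f ≫ g = 0), IsAlmostSplit (ShortComplex.mk f g w)

/-- The representations `T 0, T 1, T 2, …` form a homogeneous tube, i.e. a component of the
Auslander–Reiten quiver that is a tube `ℤA_∞ / ⟨τ⟩` of rank one, where `T n` has quasi-length
`n + 1`. Such a component is given by its meshes: `τ (T n) = T n` for all `n`, and the
almost split sequences are
`0 ⟶ T 0 ⟶ T 1 ⟶ T 0 ⟶ 0` and `0 ⟶ T (n+1) ⟶ T n ⊞ T (n+2) ⟶ T (n+1) ⟶ 0`. -/
def IsHomogeneousTube {V : Type u} [Quiver.{v} V] (T : ℕ → QuiverRep V) : Prop :=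
  HasAlmostSplitSequence (T 0) (T 1) (T 0) ∧
    ∀ n : ℕ, HasAlmostSplitSequence (T (n + 1)) (T n ⊞ T (n + 2)) (T (n + 1))

/-- The representation `X` lies in a homogeneous tube. -/
def LiesInHomogeneousTube {V : Type u} [Quiver.{v} V] (X : QuiverRep V) : Prop :=
  ∃ T : ℕ → QuiverRep V, IsHomogeneousTube T ∧ ∃ n : ℕ, Nonempty (X ≅ T n)

/-! ### Quiver Grassmannians as varieties -/

section QuiverGrassmannian

variable {V : Type u} [Quiver.{v} V]

/-- The vector space of a representation at a vertex. -/
abbrev QuiverRep.space (X : QuiverRep V) (p : V) : Type := X.obj ((Paths.of V).obj p)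

/-- The linear map of a representation along an arrow. -/
abbrev QuiverRep.linMap (X : QuiverRep V) {p q : V} (a : p ⟶ q) : X.space p →ₗ[ℂ] X.space q :=
  (X.map ((Paths.of V).map a)).hom.hom

/-- A family of subspaces is a subrepresentation if it is stable under all arrows. -/
def QuiverRep.IsSubrep (X : QuiverRep V) (U : ∀ p, Submodule ℂ (X.space p)) : Prop :=
  ∀ (p q : V) (a : p ⟶ q), ∀ x ∈ U p, X.linMap a x ∈ U q

/-- The points of the quiver Grassmannian `Gr_e(X)`: the `e`-dimensional subrepresentations. -/
structure QuiverGrassmannian (X : QuiverRep V) (e : V → ℕ) where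
  space : ∀ p, Submodule ℂ (X.space p)
  isSubrep : X.IsSubrep space
  finrank_eq : ∀ p, Module.finrank ℂ (space p) = e p

namespace QuiverGrassmannian

variable {X : QuiverRep V} {e : V → ℕ}

/-- The affine space `∏ₚ Hom(Uₚ, Wₚ)`. If `W` is a complement of `U`, it is the standard affine
chart centred at `U` of the product `∏ₚ Gr(eₚ, Xₚ)` of the usual Grassmannians: its points
correspond to the families of complements of `W`, by sending `f` to the family of its graphs. -/
abbrev ChartSpace (U : QuiverGrassmannian X e) (W : ∀ p, Submodule ℂ (X.space p)) : Type u :=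
  ∀ p, U.space p →ₗ[ℂ] W p

/-- The graphs `{x + f x | x ∈ Uₚ}` of a point `f` of the affine chart. -/
def graph (U : QuiverGrassmannian X e) (W : ∀ p, Submodule ℂ (X.space p))
    (f : U.ChartSpace W) (p : V) : Submodule ℂ (X.space p) :=
  LinearMap.range ((U.space p).subtype + (W p).subtype ∘ₗ f p)

/-- The intersection of `Gr_e(X)` with the affine chart centred at `U`, a closed algebraic subset
of the affine space `∏ₚ Hom(Uₚ, Wₚ)`. -/
def chart (U : QuiverGrassmannian X e) (W : ∀ p, Submodule ℂ (X.space p)) :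
    Set (U.ChartSpace W) :=
  {f | X.IsSubrep (U.graph W f)}

/-- The point `U` corresponds to the origin of its chart. -/
theorem zero_mem_chart (U : QuiverGrassmannian X e) (W : ∀ p, Submodule ℂ (X.space p)) :
    (0 : U.ChartSpace W) ∈ U.chart W := by
  have h : U.graph W 0 = U.space := by
    funext p
    simp [graph]
  change X.IsSubrep (U.graph W 0)
  rw [h]
  exact U.isSubrep

/-- The coordinate ring of the affine variety `U.chart W`: the ring of all functions on it that
are restrictions of polynomial functions on the ambient affine space. -/
def coordinateRing (U : QuiverGrassmannian X e) (W : ∀ p, Submodule ℂ (X.space p)) :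
    Subalgebra ℂ (U.chart W → ℂ) :=
  Algebra.adjoin ℂ
    (Set.range fun (l : Module.Dual ℂ (U.ChartSpace W)) (z : U.chart W) => l z.1)

/-- Evaluation of regular functions at the point `U`. -/
def evalCenter (U : QuiverGrassmannian X e) (W : ∀ p, Submodule ℂ (X.space p)) :
    U.coordinateRing W →+* ℂ :=
  (Pi.evalRingHom (fun _ : U.chart W => ℂ) ⟨0, U.zero_mem_chart W⟩).comp
    (U.coordinateRing W).val.toRingHom

instance (U : QuiverGrassmannian X e) (W : ∀ p, Submodule ℂ (X.space p)) :
    (RingHom.ker (U.evalCenter W)).IsPrime :=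
  RingHom.ker_isPrime _

/-- The local ring at `U` of the variety `Gr_e(X)` (computed in the affine chart centred at `U`
given by a complement `W`): the localization of the coordinate ring of the chart at the maximal
ideal of the functions vanishing at `U`. -/
abbrev localRing (U : QuiverGrassmannian X e) (W : ∀ p, Submodule ℂ (X.space p)) : Type u :=
  Localization.AtPrime (RingHom.ker (U.evalCenter W))

end QuiverGrassmannian

/-- The quiver Grassmannian `Gr_e(X)` is singular as a variety: at some point `U`, its
local ring (which up to isomorphism does not depend on the complement `W`) is not regular. -/
def IsSingularQuiverGrassmannian (X : QuiverRep V) (e : V → ℕ) : Prop :=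
  ∃ (U : QuiverGrassmannian X e) (W : ∀ p, Submodule ℂ (X.space p)),
    (∀ p, IsCompl (U.space p) (W p)) ∧ ¬ IsRegularLocalRing (U.localRing W)

end QuiverGrassmannian

/-!
The quiver Grassmannians in question are those of the representations of quasi-length three in a
homogeneous tube, which is constructed by hand from a brick.

*The tube.* Let `ξ` be a brick of `Q` whose dimension vector is the radical vector of the Euler
form, and let `η` be a cocycle. The truncations `T_k` of the family `ξ + ε η` have the spaces of
sequences of length `k` as their spaces, `ε` being the shift. If `ξ` extends to a module over the
preprojective algebra by maps `ζ` in the opposite directions, then the traces `tr (ω k ζ)` pair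
`Ext¹(M, ξ)` with `Hom(ξ, M)`. When `ζ` is nondegenerate and the dimension vector is radical, a count
of dimensions shows that the pairing is perfect (`GraphRep.mem_range_coboundary_of_pairLeft`), which
is the Auslander–Reiten formula with `τ ξ ≅ ξ`. Since `ξ` is a brick, `ζ` continues along the family
(`GraphRep.exists_isPreprojectiveSeries`), so that the same holds for all `T_k`. If moreover
`End(T_k) = ℂ[ε]/(ε ^ k)`, the pairing yields the lifting and extension properties of almost split
sequences (`GraphRep.exists_lift`, `GraphRep.exists_desc`), and the `T_k` form a homogeneous tube
(`IsHomogeneousFamily.isHomogeneousTube`).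

*The singularity.* If the dimension at a sink or a source `o` is one, then `ξ` is an extension of two
bricks, one of them supported at `o`, and `η` can be chosen to be a second cocycle at the arrows at
`o` (`GraphRep.IsHomogeneousBrick.exists_isBrickExtension`). The family is then the image of a family
of regular Kronecker representations, which determines its endomorphisms. In `T_3` take the
subrepresentation given by the sequences with one, respectively two, nonzero terms on the
supports of the two bricks. The standard chart around it consists of families of scalars `x`, `y`,
`a`, `b` with `y = a + b x` and `a x + b y = 0`. Its dimension is at most two, but its tangent space at the
origin has dimension three, since it contains three independent lines
(`QuiverGrassmannian.not_isRegularLocalRing`).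

*The brick.* Such a `ξ` is the restriction to `Q` of a simple module over the preprojective algebra
whose restriction to each orientation is a brick. These modules are given as systems of subspaces of
one vector space, with an inclusion and an operator for each edge (`IsSubspaceSystem`): lines for
the cycles, planes with four lines for type `D`, and for type `E` the ranges of the powers of three
nilpotent operators with sum zero (`IsStarTriple`). For the double edge the brick is written down
directly (`exists_singular_of_kronecker`). In types `D` and `E` the vertex `o` is a leaf, and for
cycles it is a sink.
-/

/-! ### Trace duality for representations of a graph -/

section LinearDuality

variable {A A' B B' : Type*} [AddCommGroup A] [Module ℂ A] [FiniteDimensional ℂ A]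
  [AddCommGroup B] [Module ℂ B] [FiniteDimensional ℂ B]
  [AddCommGroup A'] [Module ℂ A'] [FiniteDimensional ℂ A']
  [AddCommGroup B'] [Module ℂ B'] [FiniteDimensional ℂ B']

theorem LinearMap.finrank_annihilator_range (d : A →ₗ[ℂ] B) :
    Module.finrank ℂ (LinearMap.range d).dualAnnihilator + Module.finrank ℂ A =
      Module.finrank ℂ B + Module.finrank ℂ (LinearMap.ker d) := by
  have h1 := Subspace.finrank_add_finrank_dualAnnihilator_eq (LinearMap.range d)
  have h2 := LinearMap.finrank_range_add_finrank_ker d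
  omega

/-- If the functionals `β k` are linearly independent and vanish on the range of `d`, and if there
are as many of them as the dimensions permit, then they cut out the range of `d`. -/
theorem LinearMap.mem_range_of_annihilated {K : Type*} [AddCommGroup K] [Module ℂ K]
    [FiniteDimensional ℂ K] (d : A →ₗ[ℂ] B)
    (β : K →ₗ[ℂ] Module.Dual ℂ B) (hβ : Function.Injective β) (hβd : ∀ k x, β k (d x) = 0)
    (hdim : Module.finrank ℂ B + Module.finrank ℂ (LinearMap.ker d) ≤
      Module.finrank ℂ K + Module.finrank ℂ A)
    (b : B) (hb : ∀ k, β k b = 0) : b ∈ LinearMap.range d := by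
  have hle : LinearMap.range β ≤ (LinearMap.range d).dualAnnihilator := by
    rintro _ ⟨k, rfl⟩
    rw [Submodule.mem_dualAnnihilator]
    rintro _ ⟨x, rfl⟩
    exact hβd k x
  have h1 := LinearMap.finrank_range_of_inj hβ
  have h2 := d.finrank_annihilator_range
  have heq : LinearMap.range β = (LinearMap.range d).dualAnnihilator :=
    Submodule.eq_of_le_of_finrank_le hle (by omega)
  rw [← Subspace.dualAnnihilator_dualCoannihilator_eq (W := LinearMap.range d), ← heq,
    Submodule.mem_dualCoannihilator]
  rintro _ ⟨k, rfl⟩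
  exact hb k

theorem LinearMap.finrank_le_of_annihilates {K : Type*} [AddCommGroup K] [Module ℂ K]
    [FiniteDimensional ℂ K] (d : A →ₗ[ℂ] B)
    (β : K →ₗ[ℂ] Module.Dual ℂ B) (hβ : Function.Injective β) (hβd : ∀ k x, β k (d x) = 0) :
    Module.finrank ℂ K + Module.finrank ℂ A ≤
      Module.finrank ℂ B + Module.finrank ℂ (LinearMap.ker d) := by
  have hle : LinearMap.range β ≤ (LinearMap.range d).dualAnnihilator := by
    rintro _ ⟨k, rfl⟩
    rw [Submodule.mem_dualAnnihilator]
    rintro _ ⟨x, rfl⟩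
    exact hβd k x
  have h1 := LinearMap.finrank_range_of_inj hβ
  have h2 := d.finrank_annihilator_range
  have h3 := Submodule.finrank_mono hle
  omega

omit [FiniteDimensional ℂ A] in
/-- The trace pairing between `Hom(A, B)` and `Hom(B, A)` is non-degenerate. -/
theorem LinearMap.eq_zero_of_trace_comp_eq_zero (f : A →ₗ[ℂ] B)
    (h : ∀ g : B →ₗ[ℂ] A, LinearMap.trace ℂ B (f ∘ₗ g) = 0) : f = 0 := by
  ext x
  rw [LinearMap.zero_apply, ← Module.forall_dual_apply_eq_zero_iff ℂ]
  intro φ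
  have h1 := h (φ.smulRight x)
  have h2 : f ∘ₗ φ.smulRight x = φ.smulRight (f x) := by
    ext y
    simp
  rwa [h2, LinearMap.trace_smulRight] at h1

end LinearDuality

namespace GraphRep

section Cochains

variable {V E : Type*} (s t : E → V)

/-- Families of linear maps between the spaces at the vertices. -/
abbrev C0 (M N : V → Type*) [∀ p, AddCommGroup (M p)] [∀ p, Module ℂ (M p)]
    [∀ p, AddCommGroup (N p)] [∀ p, Module ℂ (N p)] :=
  ∀ p, M p →ₗ[ℂ] N p

/-- Families of linear maps along the edges, from the spaces of `M` to those of `N`. -/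
abbrev C1 (M N : V → Type*) [∀ p, AddCommGroup (M p)] [∀ p, Module ℂ (M p)]
    [∀ p, AddCommGroup (N p)] [∀ p, Module ℂ (N p)] :=
  ∀ e, M (s e) →ₗ[ℂ] N (t e)

variable {s t}
variable {M N T : V → Type*} [∀ p, AddCommGroup (M p)] [∀ p, Module ℂ (M p)]
  [∀ p, AddCommGroup (N p)] [∀ p, Module ℂ (N p)]
  [∀ p, AddCommGroup (T p)] [∀ p, Module ℂ (T p)]

/-- The standard two-term complex of a pair of representations `M`, `N`: its kernel is
`Hom(M, N)` and its cokernel is `Ext¹(M, N)`. -/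
def coboundary (m : C1 s t M M) (n : C1 s t N N) : C0 M N →ₗ[ℂ] C1 s t M N where
  toFun c e := c (t e) ∘ₗ m e - n e ∘ₗ c (s e)
  map_add' c c' := by
    funext e
    simp only [Pi.add_apply, LinearMap.add_comp, LinearMap.comp_add]
    abel
  map_smul' r c := by
    funext e
    simp only [Pi.smul_apply, LinearMap.smul_comp, LinearMap.comp_smul, RingHom.id_apply, smul_sub]

theorem mem_ker_coboundary {m : C1 s t M M} {n : C1 s t N N} {c : C0 M N} :
    c ∈ LinearMap.ker (coboundary m n) ↔ ∀ e, c (t e) ∘ₗ m e = n e ∘ₗ c (s e) := by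
  rw [LinearMap.mem_ker, funext_iff]
  exact forall_congr' fun e => sub_eq_zero

variable [Fintype E]

/-- The relation of the preprojective algebra for the pair `(T, ζ)`, in its trace form: `ζ`
annihilates the image of the coboundary, i.e. defines a linear functional on `Ext¹(T, T)`. -/
def IsPreprojective (T : V → Type*) [∀ p, AddCommGroup (T p)] [∀ p, Module ℂ (T p)]
    (τ : C1 s t T T) (ζ : C1 t s T T) : Prop :=
  ∀ c : C0 T T, ∑ e, LinearMap.trace ℂ (T (t e)) (coboundary τ τ c e ∘ₗ ζ e) = 0

/-- The functional `ω ↦ ∑ tr(ω k ζ)` on `C¹(M, T)` given by `k : T ⟶ M`. -/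
noncomputable def pairLeft (ζ : C1 t s T T) : C0 T M →ₗ[ℂ] Module.Dual ℂ (C1 s t M T) :=
  LinearMap.mk₂ ℂ (fun k ω => ∑ e, LinearMap.trace ℂ (T (t e)) (ω e ∘ₗ k (s e) ∘ₗ ζ e))
    (by intros; simp [LinearMap.add_comp, LinearMap.comp_add, Finset.sum_add_distrib])
    (by intros; simp [LinearMap.smul_comp, LinearMap.comp_smul, Finset.mul_sum])
    (by intros; simp [LinearMap.add_comp, Finset.sum_add_distrib])
    (by intros; simp [LinearMap.smul_comp, Finset.mul_sum])

/-- The functional `ω ↦ ∑ tr(ζ h ω)` on `C¹(T, M)` given by `h : M ⟶ T`. -/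
noncomputable def pairRight (ζ : C1 t s T T) : C0 M T →ₗ[ℂ] Module.Dual ℂ (C1 s t T M) :=
  LinearMap.mk₂ ℂ (fun h ω => ∑ e, LinearMap.trace ℂ (T (s e)) (ζ e ∘ₗ h (t e) ∘ₗ ω e))
    (by intros; simp [LinearMap.add_comp, LinearMap.comp_add, Finset.sum_add_distrib])
    (by intros; simp [LinearMap.smul_comp, LinearMap.comp_smul, Finset.mul_sum])
    (by intros; simp [LinearMap.comp_add, Finset.sum_add_distrib])
    (by intros; simp [LinearMap.comp_smul, Finset.mul_sum])

theorem pairLeft_apply (ζ : C1 t s T T) (k : C0 T M) (ω : C1 s t M T) :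
    pairLeft ζ k ω = ∑ e, LinearMap.trace ℂ (T (t e)) (ω e ∘ₗ k (s e) ∘ₗ ζ e) := rfl

theorem pairRight_apply (ζ : C1 t s T T) (h : C0 M T) (ω : C1 s t T M) :
    pairRight ζ h ω = ∑ e, LinearMap.trace ℂ (T (s e)) (ζ e ∘ₗ h (t e) ∘ₗ ω e) := rfl

variable [∀ p, FiniteDimensional ℂ (M p)] [∀ p, FiniteDimensional ℂ (T p)]

theorem comp_eq_zero_of_pairLeft_eq_zero {ζ : C1 t s T T} {k : C0 T M} (h : pairLeft ζ k = 0)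
    (e : E) : k (s e) ∘ₗ ζ e = 0 := by
  classical
  refine LinearMap.eq_zero_of_trace_comp_eq_zero _ fun g => ?_
  have h1 := DFunLike.congr_fun h (Pi.single (M := fun e => M (s e) →ₗ[ℂ] T (t e)) e g)
  rw [pairLeft_apply, Finset.sum_eq_single e] at h1
  · rw [LinearMap.trace_comp_comm']
    simpa using h1
  · intro e' _ he'
    simp [Pi.single_eq_of_ne he']
  · simp

omit [∀ p, FiniteDimensional ℂ (M p)] in
theorem comp_eq_zero_of_pairRight_eq_zero {ζ : C1 t s T T} {h : C0 M T} (h0 : pairRight ζ h = 0)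
    (e : E) : ζ e ∘ₗ h (t e) = 0 := by
  classical
  refine LinearMap.eq_zero_of_trace_comp_eq_zero _ fun g => ?_
  have h1 := DFunLike.congr_fun h0 (Pi.single (M := fun e => T (s e) →ₗ[ℂ] M (t e)) e g)
  rw [pairRight_apply, Finset.sum_eq_single e] at h1
  · simpa [LinearMap.comp_assoc] using h1
  · intro e' _ he'
    simp [Pi.single_eq_of_ne he']
  · simp

omit [∀ p, FiniteDimensional ℂ (M p)] [∀ p, FiniteDimensional ℂ (T p)] in
theorem pairLeft_coboundary {τ : C1 s t T T} {ζ : C1 t s T T} (hζ : IsPreprojective T τ ζ)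
    {m : C1 s t M M} {k : C0 T M} (hk : k ∈ LinearMap.ker (coboundary τ m)) (c : C0 M T) :
    pairLeft ζ k (coboundary m τ c) = 0 := by
  rw [mem_ker_coboundary] at hk
  rw [pairLeft_apply, ← hζ fun p => c p ∘ₗ k p]
  refine Finset.sum_congr rfl fun e _ => ?_
  congr 1
  simp only [coboundary, LinearMap.coe_mk, AddHom.coe_mk, LinearMap.sub_comp,
    LinearMap.comp_assoc]
  rw [← LinearMap.comp_assoc (ζ e) (k (s e)) (m e), ← hk e, LinearMap.comp_assoc]

omit [∀ p, FiniteDimensional ℂ (M p)] in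
theorem pairRight_coboundary {τ : C1 s t T T} {ζ : C1 t s T T} (hζ : IsPreprojective T τ ζ)
    {m : C1 s t M M} {h : C0 M T} (hh : h ∈ LinearMap.ker (coboundary m τ)) (c : C0 T M) :
    pairRight ζ h (coboundary τ m c) = 0 := by
  rw [mem_ker_coboundary] at hh
  rw [pairRight_apply, ← hζ fun p => h p ∘ₗ c p]
  refine Finset.sum_congr rfl fun e _ => ?_
  rw [LinearMap.trace_comp_comm']
  congr 1
  simp only [coboundary, LinearMap.coe_mk, AddHom.coe_mk, LinearMap.comp_sub, LinearMap.sub_comp,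
    LinearMap.comp_assoc]
  rw [← LinearMap.comp_assoc _ (m e) (h (t e)), hh e, LinearMap.comp_assoc]

/-- The sub- and quotient-representations of `T` on which `ζ` vanishes are zero. Together with
`IsPreprojective` and a condition on dimensions this makes `ζ` an isomorphism from `T` to its
Auslander–Reiten translate. -/
structure IsNondegenerate (τ : C1 s t T T) (ζ : C1 t s T T) : Prop where
  eq_bot : ∀ N : ∀ p, Submodule ℂ (T p), (∀ e, N (s e) ≤ (N (t e)).comap (τ e)) →
    (∀ e, N (t e) ≤ LinearMap.ker (ζ e)) → ∀ p, N p = ⊥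
  eq_top : ∀ N : ∀ p, Submodule ℂ (T p), (∀ e, N (s e) ≤ (N (t e)).comap (τ e)) →
    (∀ e, LinearMap.range (ζ e) ≤ N (s e)) → ∀ p, N p = ⊤

/-- A dimension vector `d` lies in the radical of the (symmetrized) Euler form of the graph. -/
def IsRadicalVector [Fintype V] (s t : E → V) (d : V → ℕ) : Prop :=
  ∀ m : V → ℕ, ∑ e, (m (s e) * d (t e) + d (s e) * m (t e)) = 2 * ∑ p, m p * d p

theorem pairLeft_injective {τ : C1 s t T T} {ζ : C1 t s T T} (hn : IsNondegenerate τ ζ)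
    {m : C1 s t M M} : Function.Injective
      ((pairLeft (M := M) ζ).domRestrict (LinearMap.ker (coboundary τ m))) := by
  rw [injective_iff_map_eq_zero]
  rintro ⟨k, hk⟩ h0
  rw [mem_ker_coboundary] at hk
  have h1 := hn.eq_top (fun p => LinearMap.ker (k p)) (fun e x hx => by
    have := LinearMap.congr_fun (hk e) x
    simp only [LinearMap.comp_apply, LinearMap.mem_ker, Submodule.mem_comap] at this hx ⊢
    rw [this, hx, map_zero]) (fun e => by
    rw [LinearMap.range_le_ker_iff]
    exact comp_eq_zero_of_pairLeft_eq_zero h0 e)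
  ext p : 2
  exact LinearMap.ker_eq_top.1 (h1 p)

omit [∀ p, FiniteDimensional ℂ (M p)] in
theorem pairRight_injective {τ : C1 s t T T} {ζ : C1 t s T T} (hn : IsNondegenerate τ ζ)
    {m : C1 s t M M} : Function.Injective
      ((pairRight (M := M) ζ).domRestrict (LinearMap.ker (coboundary m τ))) := by
  rw [injective_iff_map_eq_zero]
  rintro ⟨h, hh⟩ h0
  rw [mem_ker_coboundary] at hh
  have h1 := hn.eq_bot (fun p => LinearMap.range (h p)) (fun e => by
    rintro _ ⟨x, rfl⟩
    exact ⟨m e x, LinearMap.congr_fun (hh e) x⟩) (fun e => by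
    rw [LinearMap.range_le_ker_iff]
    exact comp_eq_zero_of_pairRight_eq_zero h0 e)
  ext p : 2
  exact LinearMap.range_eq_bot.1 (h1 p)

variable [Fintype V]

theorem finrank_C0 : Module.finrank ℂ (C0 M T) =
    ∑ p, Module.finrank ℂ (M p) * Module.finrank ℂ (T p) := by
  rw [Module.finrank_pi_fintype]
  exact Finset.sum_congr rfl fun p _ => Module.finrank_linearMap _ _ _ _

omit [Fintype V] in
theorem finrank_C1 : Module.finrank ℂ (C1 s t M T) =
    ∑ e, Module.finrank ℂ (M (s e)) * Module.finrank ℂ (T (t e)) := by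
  rw [Module.finrank_pi_fintype]
  exact Finset.sum_congr rfl fun p _ => Module.finrank_linearMap _ _ _ _

theorem finrank_C0_add_finrank_C0 (hd : IsRadicalVector s t fun p => Module.finrank ℂ (T p)) :
    Module.finrank ℂ (C0 M T) + Module.finrank ℂ (C0 T M) =
      Module.finrank ℂ (C1 s t M T) + Module.finrank ℂ (C1 s t T M) := by
  have h := hd fun p => Module.finrank ℂ (M p)
  dsimp only at h
  rw [finrank_C0, finrank_C0, finrank_C1, finrank_C1, ← Finset.sum_add_distrib (s := .univ (α := E)),
    h, two_mul]
  simp only [mul_comm]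

section Duality

variable {τ : C1 s t T T} {ζ : C1 t s T T} (hζ : IsPreprojective T τ ζ)
  (hn : IsNondegenerate τ ζ) (hd : IsRadicalVector s t fun p => Module.finrank ℂ (T p))
  (m : C1 s t M M)

include hζ hn hd

/-- `dim Hom(T, M) = ⟨T, M⟩ + dim Hom(M, T)`: the Auslander–Reiten formula for a
representation `T` that is isomorphic to its translate. -/
theorem finrank_hom_eq : Module.finrank ℂ (LinearMap.ker (coboundary τ m)) +
    Module.finrank ℂ (C1 s t T M) = Module.finrank ℂ (C0 T M) +
      Module.finrank ℂ (LinearMap.ker (coboundary m τ)) := by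
  have h1 := LinearMap.finrank_le_of_annihilates (coboundary m τ)
    ((pairLeft (M := M) ζ).domRestrict (LinearMap.ker (coboundary τ m)))
    (pairLeft_injective hn) (fun k c => pairLeft_coboundary hζ k.2 c)
  have h2 := LinearMap.finrank_le_of_annihilates (coboundary τ m)
    ((pairRight (M := M) ζ).domRestrict (LinearMap.ker (coboundary m τ)))
    (pairRight_injective hn) (fun k c => pairRight_coboundary hζ k.2 c)
  have h3 := finrank_C0_add_finrank_C0 (M := M) hd
  omega

/-- A class in `Ext¹(M, T)` vanishes if it pairs to zero with `Hom(T, M)`. -/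
theorem mem_range_coboundary_of_pairLeft (ω : C1 s t M T)
    (hω : ∀ k ∈ LinearMap.ker (coboundary τ m), pairLeft ζ k ω = 0) :
    ω ∈ LinearMap.range (coboundary m τ) := by
  refine LinearMap.mem_range_of_annihilated (coboundary m τ)
    ((pairLeft (M := M) ζ).domRestrict (LinearMap.ker (coboundary τ m)))
    (pairLeft_injective hn) (fun k c => pairLeft_coboundary hζ k.2 c) ?_ ω (fun k => hω k.1 k.2)
  have h1 := finrank_hom_eq hζ hn hd m
  have h3 := finrank_C0_add_finrank_C0 (M := M) hd
  omega

/-- A class in `Ext¹(T, M)` vanishes if it pairs to zero with `Hom(M, T)`. -/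
theorem mem_range_coboundary_of_pairRight (ω : C1 s t T M)
    (hω : ∀ h ∈ LinearMap.ker (coboundary m τ), pairRight ζ h ω = 0) :
    ω ∈ LinearMap.range (coboundary τ m) := by
  refine LinearMap.mem_range_of_annihilated (coboundary τ m)
    ((pairRight (M := M) ζ).domRestrict (LinearMap.ker (coboundary m τ)))
    (pairRight_injective hn) (fun k c => pairRight_coboundary hζ k.2 c) ?_ ω
    (fun k => hω k.1 k.2)
  have h1 := finrank_hom_eq hζ hn hd m
  omega

end Duality

end Cochains

end GraphRep

/-! ### Truncated sequences and ladder maps -/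

namespace Ladder

variable {D D' D'' : Type*} [AddCommGroup D] [Module ℂ D] [AddCommGroup D'] [Module ℂ D']
  [AddCommGroup D''] [Module ℂ D'']

/-- The `n`-th term of a sequence of length `k`, with the convention that the terms beyond the
length of the sequence are `0`. -/
def coord (k n : ℕ) : (Fin k → D) →ₗ[ℂ] D :=
  if h : n < k then LinearMap.proj ⟨n, h⟩ else 0

/-- The linear map into the sequences of length `k` with given components. -/
def build (k : ℕ) (φ : ℕ → D' →ₗ[ℂ] D) : D' →ₗ[ℂ] (Fin k → D) :=
  LinearMap.pi fun i => φ i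

theorem coord_of_le {k n : ℕ} (h : k ≤ n) : (coord k n : (Fin k → D) →ₗ[ℂ] D) = 0 :=
  dif_neg (by omega)

theorem coord_apply_of_le {k n : ℕ} (h : k ≤ n) (f : Fin k → D) : coord k n f = 0 := by
  rw [coord_of_le h, LinearMap.zero_apply]

theorem coord_build {k n : ℕ} (φ : ℕ → D' →ₗ[ℂ] D) (x : D') :
    coord k n (build k φ x) = if n < k then φ n x else 0 := by
  unfold coord build
  split_ifs <;> simp

theorem coord_fin {k : ℕ} (i : Fin k) (f : Fin k → D) : coord k i f = f i := by
  simp [coord]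

theorem ext_coord {k : ℕ} {f g : Fin k → D} (h : ∀ n, coord k n f = coord k n g) : f = g := by
  funext i
  rw [← coord_fin i f, ← coord_fin i g, h]

/-- The map placing a vector in position `m`. -/
def inj (k m : ℕ) : D →ₗ[ℂ] (Fin k → D) := build k fun n => if n = m then LinearMap.id else 0

theorem coord_inj {k m n : ℕ} (x : D) :
    coord k n (inj k m x) = if n = m ∧ m < k then x else 0 := by
  rw [inj, coord_build]
  by_cases h : n = m
  · subst h; simp
  · simp [h]

/-- Multiplication of sequences by `ξ + ε η`, where `ε` is the shift. -/
def map (k : ℕ) (ξ η : D →ₗ[ℂ] D') : (Fin k → D) →ₗ[ℂ] (Fin k → D') :=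
  build k fun n => ξ ∘ₗ coord k n + η ∘ₗ coord k (n + 1)

@[simp] theorem coord_map {k n : ℕ} (ξ η : D →ₗ[ℂ] D') (f : Fin k → D) :
    coord k n (map k ξ η f) = ξ (coord k n f) + η (coord k (n + 1) f) := by
  rw [map, coord_build]
  split_ifs with h
  · rfl
  · rw [coord_apply_of_le (by omega), coord_apply_of_le (by omega), map_zero, map_zero, add_zero]

/-- Extension of a sequence by zero. -/
def ι (k : ℕ) : (Fin k → D) →ₗ[ℂ] (Fin (k + 1) → D) := build _ fun n => coord k n

@[simp] theorem coord_ι {k n : ℕ} (f : Fin k → D) : coord (k + 1) n (ι k f) = coord k n f := by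
  rw [ι, coord_build]
  split_ifs with h
  · rfl
  · rw [coord_apply_of_le (by omega)]

/-- Omission of the first term of a sequence. -/
def π (k : ℕ) : (Fin (k + 1) → D) →ₗ[ℂ] (Fin k → D) := build _ fun n => coord (k + 1) (n + 1)

@[simp] theorem coord_π {k n : ℕ} (f : Fin (k + 1) → D) :
    coord k n (π k f) = coord (k + 1) (n + 1) f := by
  rw [π, coord_build]
  split_ifs with h
  · rfl
  · rw [coord_apply_of_le (by omega)]

/-- The shift `ε` of sequences. -/
def shift (k : ℕ) : (Fin k → D) →ₗ[ℂ] (Fin k → D) := build _ fun n => coord k (n + 1)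

@[simp] theorem coord_shift {k n : ℕ} (f : Fin k → D) :
    coord k n (shift k f) = coord k (n + 1) f := by
  rw [shift, coord_build]
  split_ifs with h
  · rfl
  · rw [coord_apply_of_le (by omega)]

/-- Insertion of a zero in front of a sequence, a section of `π`. -/
def cons (k : ℕ) : (Fin k → D) →ₗ[ℂ] (Fin (k + 1) → D) :=
  build _ fun | 0 => 0 | n + 1 => coord k n

@[simp] theorem coord_cons_zero {k : ℕ} (f : Fin k → D) : coord (k + 1) 0 (cons k f) = 0 := by
  rw [cons, coord_build]
  simp

@[simp] theorem coord_cons_succ {k n : ℕ} (f : Fin k → D) :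
    coord (k + 1) (n + 1) (cons k f) = coord k n f := by
  rw [cons, coord_build]
  split_ifs with h
  · rfl
  · rw [coord_apply_of_le (by omega)]

/-- Omission of the last term of a sequence, a retraction of `ι`. -/
def trunc (k : ℕ) : (Fin (k + 1) → D) →ₗ[ℂ] (Fin k → D) := build _ fun n => coord (k + 1) n

theorem coord_trunc {k n : ℕ} (f : Fin (k + 1) → D) :
    coord k n (trunc k f) = if n < k then coord (k + 1) n f else 0 := by
  rw [trunc, coord_build]

/-- Multiplication of sequences by a power series `∑ εʲ ζⱼ`. -/
def series (k : ℕ) (ζ : ℕ → D →ₗ[ℂ] D') : (Fin k → D) →ₗ[ℂ] (Fin k → D') :=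
  build k fun n => ∑ j ∈ Finset.range k, ζ j ∘ₗ coord k (n + j)

theorem coord_series {k n : ℕ} (ζ : ℕ → D →ₗ[ℂ] D') (f : Fin k → D) :
    coord k n (series k ζ f) = ∑ j ∈ Finset.range k, ζ j (coord k (n + j) f) := by
  rw [series, coord_build]
  split_ifs with h
  · simp
  · rw [Finset.sum_eq_zero]
    intro j _
    rw [coord_apply_of_le (by omega), map_zero]

theorem coord_series_inj {k n m : ℕ} (hm : m < k) (ζ : ℕ → D →ₗ[ℂ] D') (x : D) :
    coord k n (series k ζ (inj k m x)) = if n ≤ m then ζ (m - n) x else 0 := by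
  rw [coord_series]
  split_ifs with h
  · rw [Finset.sum_eq_single (m - n)]
    · rw [coord_inj, if_pos (by omega)]
    · intro j _ hj
      rw [coord_inj, if_neg (by omega), map_zero]
    · intro hj
      rw [Finset.mem_range] at hj
      omega
  · rw [Finset.sum_eq_zero]
    intro j _
    rw [coord_inj, if_neg (by omega), map_zero]

theorem sum_inj_coord {k : ℕ} (f : Fin k → D) :
    ∑ i ∈ Finset.range k, inj k i (coord k i f) = f := by
  refine ext_coord fun n => ?_
  rw [map_sum]
  by_cases h : n < k
  · rw [Finset.sum_eq_single n]
    · rw [coord_inj, if_pos ⟨rfl, h⟩]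
    · intro j _ hj
      rw [coord_inj, if_neg (by tauto)]
    · simp [h]
  · rw [coord_apply_of_le (by omega), Finset.sum_eq_zero]
    intro j _
    rw [coord_apply_of_le (by omega)]

end Ladder

namespace GraphRep
open Ladder

variable {V E : Type*} {s t : E → V} [Fintype E]
variable {D : V → Type*} [∀ p, AddCommGroup (D p)] [∀ p, Module ℂ (D p)]
  [∀ p, FiniteDimensional ℂ (D p)]

/-- The structure maps of `T_k`, the `k`-th truncation of the family `ξ + ε η`. -/
def truncRep (k : ℕ) (ξ η : C1 s t D D) :
    C1 s t (fun p => Fin k → D p) (fun p => Fin k → D p) :=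
  fun e => Ladder.map k (ξ e) (η e)

/-- `ζ = ∑ εʲ ζⱼ` solves the preprojective relation for the family `ξ + ε η`. -/
structure IsPreprojectiveSeries (ξ η : C1 s t D D) (ζ : ℕ → C1 t s D D) : Prop where
  zero : IsPreprojective D ξ (ζ 0)
  succ : ∀ (j : ℕ) (c : C0 D D),
    ∑ e, LinearMap.trace ℂ (D (t e)) (coboundary ξ ξ c e ∘ₗ ζ (j + 1) e) +
      ∑ e, LinearMap.trace ℂ (D (t e)) (coboundary η η c e ∘ₗ ζ j e) = 0

omit [Fintype E] in
theorem trace_coboundary_comp (τ : C1 s t D D) (ζ : C1 t s D D) (c : C0 D D) (e : E) :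
    LinearMap.trace ℂ (D (t e)) (coboundary τ τ c e ∘ₗ ζ e) =
      LinearMap.trace ℂ (D (t e)) (c (t e) ∘ₗ τ e ∘ₗ ζ e) -
        LinearMap.trace ℂ (D (s e)) (c (s e) ∘ₗ ζ e ∘ₗ τ e) := by
  simp only [coboundary, LinearMap.coe_mk, AddHom.coe_mk, LinearMap.sub_comp, map_sub,
    LinearMap.comp_assoc]
  congr 1
  rw [LinearMap.trace_comp_comm', LinearMap.comp_assoc]

theorem isPreprojective_truncRep {ξ η : C1 s t D D} {ζ : ℕ → C1 t s D D}
    (hζ : IsPreprojectiveSeries ξ η ζ) (k : ℕ) :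
    IsPreprojective (fun p => Fin k → D p) (truncRep k ξ η)
      (fun e => series k fun j => ζ j e) := by
  -- By linearity it suffices to treat families concentrated in a single matrix entry `(i, j)`.
  have key : ∀ i < k, ∀ j < k, ∀ γ : C0 D D,
      ∑ e, LinearMap.trace ℂ (Fin k → D (t e)) (coboundary (truncRep k ξ η) (truncRep k ξ η)
        (fun p => inj k i ∘ₗ γ p ∘ₗ coord k j) e ∘ₗ series k fun j => ζ j e) = 0 := by
    intro i hi j hj γ
    have h1 : ∀ e, LinearMap.trace ℂ (Fin k → D (t e))
        (coboundary (truncRep k ξ η) (truncRep k ξ η)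
          (fun p => inj k i ∘ₗ γ p ∘ₗ coord k j) e ∘ₗ series k fun j => ζ j e) =
        LinearMap.trace ℂ (D (t e)) (γ (t e) ∘ₗ coord k j ∘ₗ truncRep k ξ η e ∘ₗ
          (series k fun j => ζ j e) ∘ₗ inj k i) -
        LinearMap.trace ℂ (D (s e)) (γ (s e) ∘ₗ coord k j ∘ₗ
          (series k fun j => ζ j e) ∘ₗ truncRep k ξ η e ∘ₗ inj k i) := by
      intro e
      refine (trace_coboundary_comp (D := fun p => Fin k → D p) (truncRep k ξ η)
        (fun e => series k fun j => ζ j e) (fun p => inj k i ∘ₗ γ p ∘ₗ coord k j) e).trans ?_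
      congr 1 <;> simp only [LinearMap.comp_assoc] <;> rw [LinearMap.trace_comp_comm'] <;>
        simp only [LinearMap.comp_assoc]
    simp only [h1]
    have h2 : ∀ e, coord k j ∘ₗ truncRep k ξ η e ∘ₗ (series k fun j => ζ j e) ∘ₗ inj k i =
        (if j ≤ i then ξ e ∘ₗ ζ (i - j) e else 0) +
          (if j + 1 ≤ i then η e ∘ₗ ζ (i - (j + 1)) e else 0) := by
      intro e
      ext x
      simp only [LinearMap.comp_apply, truncRep, coord_map, coord_series_inj hi,
        LinearMap.add_apply]
      split_ifs <;> simp
    have h3 : ∀ e, coord k j ∘ₗ (series k fun j => ζ j e) ∘ₗ truncRep k ξ η e ∘ₗ inj k i =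
        (if j ≤ i then ζ (i - j) e ∘ₗ ξ e else 0) +
          (if j + 1 ≤ i then ζ (i - (j + 1)) e ∘ₗ η e else 0) := by
      intro e
      ext x
      have h4 : truncRep k ξ η e (inj k i x) =
          inj k i (ξ e x) + if 1 ≤ i then inj k (i - 1) (η e x) else 0 := by
        refine ext_coord fun n => ?_
        rw [truncRep, coord_map, map_add, coord_inj, coord_inj, coord_inj]
        congr 1
        · split_ifs <;> simp
        · by_cases h : 1 ≤ i
          · rw [if_pos h, coord_inj]
            by_cases h' : n + 1 = i
            · rw [if_pos ⟨h', hi⟩, if_pos (by omega)]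
            · rw [if_neg (by tauto), if_neg (by omega), map_zero]
          · rw [if_neg h, if_neg (by omega), map_zero, map_zero]
      simp only [LinearMap.comp_apply, h4, map_add, coord_series_inj hi, LinearMap.add_apply]
      congr 1
      · split_ifs <;> simp
      · by_cases h : 1 ≤ i
        · rw [if_pos h, coord_series_inj (by omega)]
          by_cases h' : j + 1 ≤ i
          · rw [if_pos (by omega), if_pos h', LinearMap.comp_apply]
            congr 2
            omega
          · rw [if_neg (by omega), if_neg h', LinearMap.zero_apply]
        · rw [if_neg h, map_zero, map_zero, if_neg (by omega), LinearMap.zero_apply]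
    simp only [h2, h3]
    rcases lt_trichotomy j i with h | rfl | h
    · obtain ⟨m, rfl⟩ : ∃ m, i = j + 1 + m := ⟨i - (j + 1), by omega⟩
      have h5 := hζ.succ m γ
      simp only [trace_coboundary_comp] at h5
      have h6 : j + 1 + m - j = m + 1 := by omega
      simp only [if_pos h.le, if_pos (Nat.succ_le_of_lt h), h6, Nat.add_sub_cancel_left,
        LinearMap.comp_add, map_add]
      rw [← h5, ← Finset.sum_add_distrib]
      exact Finset.sum_congr rfl fun e _ => by ring
    · have h5 := hζ.zero γ
      simp only [trace_coboundary_comp] at h5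
      simpa using h5
    · simp [show ¬ j ≤ i by omega, show ¬ j + 1 ≤ i by omega]
  intro c
  have hc : c = ∑ i ∈ Finset.range k, ∑ j ∈ Finset.range k,
      fun p => inj k i ∘ₗ (coord k i ∘ₗ c p ∘ₗ inj k j) ∘ₗ coord k j := by
    funext p
    refine LinearMap.ext fun f => ?_
    simp only [Finset.sum_apply, LinearMap.sum_apply, LinearMap.comp_apply]
    conv_lhs => rw [← sum_inj_coord (c p f)]
    refine Finset.sum_congr rfl fun i _ => ?_
    rw [← map_sum, ← map_sum, ← map_sum, sum_inj_coord]
  have hlin : ∀ c' : C0 (fun p => Fin k → D p) (fun p => Fin k → D p),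
      ∑ e, LinearMap.trace ℂ (Fin k → D (t e)) (coboundary (truncRep k ξ η) (truncRep k ξ η)
        c' e ∘ₗ series k fun j => ζ j e) =
      pairLeft (s := s) (t := t) (M := fun p => Fin k → D p) (T := fun p => Fin k → D p)
        (fun e => series k fun j => ζ j e) (fun _ => LinearMap.id)
        (coboundary (truncRep k ξ η) (truncRep k ξ η) c') := fun _ => rfl
  rw [hlin, hc, map_sum, map_sum]
  refine Finset.sum_eq_zero fun i hi => ?_
  rw [map_sum, map_sum]
  refine Finset.sum_eq_zero fun j hj => ?_
  rw [← hlin]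
  exact key i (Finset.mem_range.1 hi) j (Finset.mem_range.1 hj) _

omit [Fintype E] [∀ p, FiniteDimensional ℂ (D p)] in
theorem isNondegenerate_truncRep {ξ η : C1 s t D D} {ζ : ℕ → C1 t s D D}
    (hn : IsNondegenerate ξ (ζ 0)) (k : ℕ) :
    IsNondegenerate (T := fun p => Fin k → D p) (truncRep k ξ η)
      (fun e => series k fun j => ζ j e) where
  eq_bot N hN hNζ := by
    -- The terms of the elements of `N` vanish, by descending induction on their position.
    have key : ∀ i, ∀ n, k ≤ n + i → ∀ p, ∀ f ∈ N p, coord k n f = 0 := by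
      intro i
      induction i with
      | zero => exact fun n hn p f _ => coord_apply_of_le (by omega) f
      | succ i ih =>
        intro n hn' p f hf
        have h0 := hn.eq_bot (fun p => (N p).map (coord k n)) (fun e => by
            rintro _ ⟨f, hf, rfl⟩
            refine ⟨_, hN e hf, ?_⟩
            rw [truncRep, coord_map, ih (n + 1) (by omega) _ f hf, map_zero, add_zero])
          (fun e => by
            rintro _ ⟨f, hf, rfl⟩
            have h1 : series k (fun j => ζ j e) f = 0 := hNζ e hf
            have h2 := congrArg (coord k n) h1
            rw [coord_series, map_zero] at h2
            rw [LinearMap.mem_ker]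
            rcases Nat.eq_zero_or_pos k with rfl | hk
            · rw [coord_apply_of_le (Nat.zero_le _), map_zero]
            · rw [Finset.sum_eq_single 0] at h2
              · simpa using h2
              · intro j _ hj
                rw [ih (n + j) (by omega) _ f hf, map_zero]
              · simp [hk.ne']) p
        have h1 : coord k n f ∈ (N p).map (coord k n) := ⟨f, hf, rfl⟩
        rwa [h0, Submodule.mem_bot] at h1
    intro p
    rw [Submodule.eq_bot_iff]
    intro f hf
    refine ext_coord fun n => ?_
    rw [key k n (by omega) p f hf, map_zero]
  eq_top N hN hNζ := by
    have key : ∀ n, ∀ p, ∀ x : D p, inj k n x ∈ N p := by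
      intro n
      induction n using Nat.strong_induction_on with
      | _ n ih =>
        by_cases hnk : n < k
        swap
        · intro p x
          have : inj k n x = 0 := by
            refine ext_coord fun m => ?_
            rw [coord_inj, if_neg (by omega), map_zero]
          rw [this]
          exact zero_mem _
        have h0 := hn.eq_top (fun p => (N p).comap (inj k n)) (fun e x hx => by
            have h1 := hN e hx
            simp only [Submodule.mem_comap] at h1 ⊢
            have h2 : inj k n (ξ e x) = truncRep k ξ η e (inj k n x) -
                if 1 ≤ n then inj k (n - 1) (η e x) else 0 := by
              refine ext_coord fun m => ?_
              rw [truncRep, map_sub, coord_map, coord_inj, coord_inj, coord_inj]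
              by_cases h : 1 ≤ n
              · rw [if_pos h, coord_inj]
                by_cases h' : m + 1 = n
                · rw [if_neg (by omega), if_neg (by omega), if_pos (by omega), if_pos (by omega)]
                  simp
                · rw [if_neg (c := m + 1 = n ∧ n < k) (by omega),
                    if_neg (c := m = n - 1 ∧ n - 1 < k) (by omega)]
                  split_ifs <;> simp
              · rw [if_neg h, if_neg (c := m + 1 = n ∧ n < k) (by omega)]
                split_ifs <;> simp
            rw [h2]
            refine Submodule.sub_mem _ h1 ?_
            split_ifs with h
            · exact ih (n - 1) (by omega) _ _
            · exact zero_mem _)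
          (fun e => by
            rintro _ ⟨x, rfl⟩
            have h1 : series k (fun j => ζ j e) (inj k n x) ∈ N (s e) := hNζ e ⟨_, rfl⟩
            rw [Submodule.mem_comap]
            rw [← sum_inj_coord (series k (fun j => ζ j e) (inj k n x)),
              ← Finset.sum_erase_add _ _ (Finset.mem_range.2 hnk)] at h1
            rw [coord_series_inj hnk, if_pos le_rfl, Nat.sub_self] at h1
            refine (Submodule.add_mem_iff_right _ (Submodule.sum_mem _ fun i hi => ?_)).1 h1
            rw [coord_series_inj hnk]
            split_ifs with h
            · exact ih i (lt_of_le_of_ne h (Finset.ne_of_mem_erase hi)) _ _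
            · rw [map_zero]
              exact zero_mem _)
        intro p x
        have h1 : x ∈ (N p).comap (inj k n) := by
          rw [h0 p]
          trivial
        exact h1
    intro p
    rw [Submodule.eq_top_iff']
    intro f
    rw [← sum_inj_coord f]
    exact Submodule.sum_mem _ fun i _ => key i p _

theorem isRadicalVector_truncRep [Fintype V] (k : ℕ)
    (hd : IsRadicalVector s t fun p => Module.finrank ℂ (D p)) :
    IsRadicalVector s t fun p => Module.finrank ℂ (Fin k → D p) := by
  intro m
  have h := hd m
  dsimp only at h
  have h1 : ∀ p, Module.finrank ℂ (Fin k → D p) = k * Module.finrank ℂ (D p) := by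
    intro p
    rw [Module.finrank_pi_fintype, Finset.sum_const, Finset.card_univ, Fintype.card_fin,
      smul_eq_mul]
  simp only [h1]
  calc _ = k * ∑ e, (m (s e) * Module.finrank ℂ (D (t e)) +
        Module.finrank ℂ (D (s e)) * m (t e)) := by
        rw [Finset.mul_sum]
        exact Finset.sum_congr rfl fun e _ => by ring
    _ = _ := by
        rw [h, Finset.mul_sum, Finset.mul_sum, Finset.mul_sum]
        exact Finset.sum_congr rfl fun e _ => by ring

end GraphRep

/-! ### Lifting and extension of morphisms -/

namespace GraphRep

open Ladder

section Series

variable {V E : Type*} {s t : E → V} [Fintype E] [Fintype V]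
variable {D : V → Type*} [∀ p, AddCommGroup (D p)] [∀ p, Module ℂ (D p)]
  [∀ p, FiniteDimensional ℂ (D p)]

omit [Fintype V] in
/-- All functionals on `C¹` are given by the trace pairing. -/
theorem exists_eq_pairLeft_id (z : Module.Dual ℂ (C1 s t D D)) :
    ∃ ζ : C1 t s D D, ∀ ω : C1 s t D D,
      ∑ e, LinearMap.trace ℂ (D (t e)) (ω e ∘ₗ ζ e) = z ω := by
  let θ : C1 t s D D →ₗ[ℂ] Module.Dual ℂ (C1 s t D D) :=
    LinearMap.mk₂ ℂ (fun ζ ω => ∑ e, LinearMap.trace ℂ (D (t e)) (ω e ∘ₗ ζ e))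
      (by intros; simp [LinearMap.comp_add, Finset.sum_add_distrib])
      (by intros; simp [LinearMap.comp_smul, Finset.mul_sum])
      (by intros; simp [LinearMap.add_comp, Finset.sum_add_distrib])
      (by intros; simp [LinearMap.smul_comp, Finset.mul_sum])
  have hinj : Function.Injective θ := by
    rw [injective_iff_map_eq_zero]
    intro ζ hζ
    funext e
    have h1 := comp_eq_zero_of_pairLeft_eq_zero (s := s) (t := t) (M := D) (T := D) (ζ := ζ)
      (k := fun _ => LinearMap.id) hζ e
    exact h1
  have hdim : Module.finrank ℂ (C1 t s D D) = Module.finrank ℂ (Module.Dual ℂ (C1 s t D D)) := by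
    rw [Subspace.dual_finrank_eq, finrank_C1, finrank_C1]
    exact Finset.sum_congr rfl fun e _ => mul_comm _ _
  obtain ⟨ζ, hζ⟩ := (LinearMap.injective_iff_surjective_of_finrank_eq_finrank hdim).1 hinj z
  exact ⟨ζ, fun ω => DFunLike.congr_fun hζ ω⟩

omit [Fintype V] in
/-- If the representation `ξ` is a brick, a solution of the preprojective relation for `ξ` can be
continued along any line `ξ + ε η`: the obstruction is a functional on `End(ξ) = ℂ` that vanishes at
the identity. -/
theorem exists_isPreprojectiveSeries {ξ : C1 s t D D} (η : C1 s t D D)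
    (hbrick : ∀ c ∈ LinearMap.ker (coboundary ξ ξ), ∃ r : ℂ, ∀ p, c p = r • LinearMap.id)
    {ζ₀ : C1 t s D D} (hζ₀ : IsPreprojective D ξ ζ₀) :
    ∃ ζ : ℕ → C1 t s D D, ζ 0 = ζ₀ ∧ IsPreprojectiveSeries ξ η ζ := by
  have step : ∀ ζ' : C1 t s D D, ∃ ζ'' : C1 t s D D, ∀ c : C0 D D,
      ∑ e, LinearMap.trace ℂ (D (t e)) (coboundary ξ ξ c e ∘ₗ ζ'' e) +
        ∑ e, LinearMap.trace ℂ (D (t e)) (coboundary η η c e ∘ₗ ζ' e) = 0 := by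
    intro ζ'
    let l : Module.Dual ℂ (C0 D D) :=
      pairLeft (s := s) (t := t) (M := D) (T := D) ζ' (fun _ => LinearMap.id) ∘ₗ coboundary η η
    have hl : l ∈ LinearMap.range (coboundary ξ ξ).dualMap := by
      rw [LinearMap.range_dualMap_eq_dualAnnihilator_ker, Submodule.mem_dualAnnihilator]
      intro c hc
      obtain ⟨r, hr⟩ := hbrick c hc
      have h1 : coboundary η η c = 0 := by
        funext e
        simp [coboundary, hr, LinearMap.smul_comp, LinearMap.comp_smul]
      simp only [l, LinearMap.comp_apply, h1, map_zero]
    obtain ⟨z, hz⟩ := hl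
    obtain ⟨ζ'', h2⟩ := exists_eq_pairLeft_id (-z)
    refine ⟨ζ'', fun c => ?_⟩
    have h3 := DFunLike.congr_fun hz c
    rw [LinearMap.dualMap_apply] at h3
    rw [h2, LinearMap.neg_apply, h3]
    exact neg_add_cancel _
  choose F hF using step
  refine ⟨fun j => F^[j] ζ₀, rfl, ⟨hζ₀, fun j c => ?_⟩⟩
  rw [Function.iterate_succ_apply']
  exact hF _ c

end Series

section AlmostSplit

variable {V E : Type*} {s t : E → V} [Fintype E] [Fintype V]
variable {D : V → Type*} [∀ p, AddCommGroup (D p)] [∀ p, Module ℂ (D p)]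
  [∀ p, FiniteDimensional ℂ (D p)]
variable {M N : V → Type*} [∀ p, AddCommGroup (M p)] [∀ p, Module ℂ (M p)]
  [∀ p, AddCommGroup (N p)] [∀ p, Module ℂ (N p)]

/-- A family of linear maps is a morphism of representations. -/
def IsHom (m : C1 s t M M) (n : C1 s t N N) (c : C0 M N) : Prop :=
  ∀ e, c (t e) ∘ₗ m e = n e ∘ₗ c (s e)

variable {ξ η : C1 s t D D} {ζ : ℕ → C1 t s D D}
variable [∀ p, FiniteDimensional ℂ (M p)]

/-- The lifting property of the sequence `0 ⟶ T_{n+1} ⟶ T_n ⊕ T_{n+2} ⟶ T_{n+1} ⟶ 0`, for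
morphisms `h` whose composites with morphisms from `T_{n+1}` are all divisible by `ε`. -/
theorem exists_lift (hζ : IsPreprojectiveSeries ξ η ζ) (hn : IsNondegenerate ξ (ζ 0))
    (hd : IsRadicalVector s t fun p => Module.finrank ℂ (D p)) (n : ℕ) (m : C1 s t M M)
    (h : C0 M fun p => Fin (n + 1) → D p) (hh : IsHom m (truncRep (n + 1) ξ η) h)
    (hr : ∀ k : C0 (fun p => Fin (n + 1) → D p) M, IsHom (truncRep (n + 1) ξ η) m k →
      ∃ r : C0 (fun p => Fin (n + 1) → D p) (fun p => Fin (n + 1) → D p),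
        IsHom (truncRep (n + 1) ξ η) (truncRep (n + 1) ξ η) r ∧
          ∀ p, h p ∘ₗ k p = shift (n + 1) ∘ₗ r p) :
    ∃ (a : C0 M fun p => Fin n → D p) (b : C0 M fun p => Fin (n + 2) → D p),
      IsHom m (truncRep n ξ η) a ∧ IsHom m (truncRep (n + 2) ξ η) b ∧
        ∀ p, ι n ∘ₗ a p - π (n + 1) ∘ₗ b p = h p := by
  have hζk := isPreprojective_truncRep hζ (n + 1)
  -- The class of the extension is the cocycle `f ↦ (η f₀, 0, …, 0)`.
  let ω₀ : C1 s t (fun p => Fin (n + 1) → D p) (fun p => Fin (n + 1) → D p) :=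
    fun e => inj (n + 1) 0 ∘ₗ η e ∘ₗ coord (n + 1) 0
  have hmem : (fun e => ω₀ e ∘ₗ h (s e)) ∈
      LinearMap.range (coboundary m (truncRep (n + 1) ξ η)) := by
    refine mem_range_coboundary_of_pairLeft (T := fun p => Fin (n + 1) → D p) hζk
      (isNondegenerate_truncRep hn (n + 1)) (isRadicalVector_truncRep (n + 1) hd) m _ ?_
    intro k hk
    obtain ⟨r, hr1, hr2⟩ := hr k (mem_ker_coboundary.1 hk)
    rw [pairLeft_apply, ← hζk fun p => inj (n + 1) 0 ∘ₗ coord (n + 1) 0 ∘ₗ r p - r p]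
    -- The composite with `h k = ε r` is the coboundary of the truncation of `r` to its terms of
    -- positive index, up to sign.
    refine Finset.sum_congr rfl fun e _ => ?_
    rw [← LinearMap.comp_assoc]
    congr 2
    have h1 : (ω₀ e ∘ₗ h (s e)) ∘ₗ k (s e) = ω₀ e ∘ₗ shift (n + 1) ∘ₗ r (s e) := by
      rw [LinearMap.comp_assoc, hr2]
    rw [h1]
    refine LinearMap.ext fun f => ext_coord fun i => ?_
    have h2 := LinearMap.congr_fun (hr1 e) f
    simp only [LinearMap.comp_apply] at h2
    simp only [ω₀, coboundary, LinearMap.coe_mk, AddHom.coe_mk, LinearMap.sub_apply,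
      LinearMap.comp_apply, h2, map_sub, coord_shift]
    simp only [coord_inj, truncRep, coord_map]
    rcases i with _ | i <;> simp
  obtain ⟨c, hc⟩ := hmem
  have hc' : ∀ e x, c (t e) (m e x) =
      truncRep (n + 1) ξ η e (c (s e) x) + ω₀ e (h (s e) x) := by
    intro e x
    have h1 := LinearMap.congr_fun (congrFun hc e) x
    simp only [coboundary, LinearMap.coe_mk, AddHom.coe_mk, LinearMap.sub_apply,
      LinearMap.comp_apply] at h1
    rw [← h1]
    abel
  have hh' : ∀ e x, h (t e) (m e x) = truncRep (n + 1) ξ η e (h (s e) x) := fun e x =>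
    LinearMap.congr_fun (hh e) x
  -- A coboundary `c` of the obstruction provides the correction that turns the obvious linear
  -- section into a morphism.
  refine ⟨fun p => -(π n ∘ₗ c p), fun p => -(cons (n + 1) ∘ₗ h p + ι (n + 1) ∘ₗ c p), ?_, ?_, ?_⟩
  · intro e
    refine LinearMap.ext fun x => ext_coord fun i => ?_
    simp only [LinearMap.comp_apply, LinearMap.neg_apply, map_neg, coord_π, hc', map_add,
      truncRep, coord_map, ω₀, coord_inj]
    simp
  · intro e
    refine LinearMap.ext fun x => ext_coord fun i => ?_
    simp only [LinearMap.comp_apply, LinearMap.neg_apply, LinearMap.add_apply, map_neg, coord_ι,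
      hc', hh', map_add, truncRep, coord_map, ω₀, coord_inj]
    rcases i with _ | i <;> simp <;> abel
  · intro p
    refine LinearMap.ext fun x => ext_coord fun i => ?_
    simp

/-- The extension property of the sequence `0 ⟶ T_{n+1} ⟶ T_n ⊕ T_{n+2} ⟶ T_{n+1} ⟶ 0`, for
morphisms `h` whose composites with morphisms to `T_{n+1}` are all divisible by `ε`. -/
theorem exists_desc (hζ : IsPreprojectiveSeries ξ η ζ) (hn : IsNondegenerate ξ (ζ 0))
    (hd : IsRadicalVector s t fun p => Module.finrank ℂ (D p)) (n : ℕ) (m : C1 s t M M)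
    (h : C0 (fun p => Fin (n + 1) → D p) M) (hh : IsHom (truncRep (n + 1) ξ η) m h)
    (hr : ∀ k : C0 M (fun p => Fin (n + 1) → D p), IsHom m (truncRep (n + 1) ξ η) k →
      ∃ r : C0 (fun p => Fin (n + 1) → D p) (fun p => Fin (n + 1) → D p),
        IsHom (truncRep (n + 1) ξ η) (truncRep (n + 1) ξ η) r ∧
          ∀ p, k p ∘ₗ h p = r p ∘ₗ shift (n + 1)) :
    ∃ (a : C0 (fun p => Fin n → D p) M) (b : C0 (fun p => Fin (n + 2) → D p) M),
      IsHom (truncRep n ξ η) m a ∧ IsHom (truncRep (n + 2) ξ η) m b ∧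
        ∀ p, a p ∘ₗ π n + b p ∘ₗ ι (n + 1) = h p := by
  have hζk := isPreprojective_truncRep hζ (n + 1)
  -- The class of the extension is the cocycle `f ↦ (0, …, 0, η fₙ)`.
  let ω₀ : C1 s t (fun p => Fin (n + 1) → D p) (fun p => Fin (n + 1) → D p) :=
    fun e => inj (n + 1) n ∘ₗ η e ∘ₗ coord (n + 1) n
  have hmem : (fun e => h (t e) ∘ₗ ω₀ e) ∈
      LinearMap.range (coboundary (truncRep (n + 1) ξ η) m) := by
    refine mem_range_coboundary_of_pairRight (T := fun p => Fin (n + 1) → D p) hζk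
      (isNondegenerate_truncRep hn (n + 1)) (isRadicalVector_truncRep (n + 1) hd) m _ ?_
    intro k hk
    obtain ⟨r, hr1, hr2⟩ := hr k (mem_ker_coboundary.1 hk)
    rw [pairRight_apply, ← hζk fun p => r p ∘ₗ (LinearMap.id - inj (n + 1) n ∘ₗ coord (n + 1) n)]
    refine Finset.sum_congr rfl fun e _ => ?_
    rw [LinearMap.trace_comp_comm']
    congr 2
    have h1 : k (t e) ∘ₗ h (t e) ∘ₗ ω₀ e = r (t e) ∘ₗ shift (n + 1) ∘ₗ ω₀ e := by
      rw [← LinearMap.comp_assoc, hr2, LinearMap.comp_assoc]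
    have h3 : shift (n + 1) ∘ₗ ω₀ e =
        (LinearMap.id - inj (n + 1) n ∘ₗ coord (n + 1) n) ∘ₗ truncRep (n + 1) ξ η e -
          truncRep (n + 1) ξ η e ∘ₗ (LinearMap.id - inj (n + 1) n ∘ₗ coord (n + 1) n) := by
      refine LinearMap.ext fun f => ext_coord fun i => ?_
      simp only [ω₀, LinearMap.sub_apply, LinearMap.comp_apply, map_sub, coord_inj, coord_shift,
        truncRep, coord_map, LinearMap.id_apply, coord_apply_of_le le_rfl, map_zero, add_zero]
      by_cases h4 : i = n
      · subst h4
        simp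
      · by_cases h5 : i + 1 = n
        · subst h5
          simp
        · simp [h4, h5]
    rw [h1, h3, LinearMap.comp_sub]
    simp only [coboundary, LinearMap.coe_mk, AddHom.coe_mk, ← LinearMap.comp_assoc]
    rw [← hr1 e]
  obtain ⟨c, hc⟩ := hmem
  have hc' : ∀ e x, c (t e) (truncRep (n + 1) ξ η e x) =
      m e (c (s e) x) + h (t e) (ω₀ e x) := by
    intro e x
    have h1 := LinearMap.congr_fun (congrFun hc e) x
    simp only [coboundary, LinearMap.coe_mk, AddHom.coe_mk, LinearMap.sub_apply,
      LinearMap.comp_apply] at h1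
    rw [← h1]
    abel
  have hh' : ∀ e x, h (t e) (truncRep (n + 1) ξ η e x) = m e (h (s e) x) := fun e x =>
    LinearMap.congr_fun (hh e) x
  have hω : ∀ e (f : Fin (n + 2) → D (s e)), trunc (n + 1) (truncRep (n + 2) ξ η e f) =
      truncRep (n + 1) ξ η e (trunc (n + 1) f) + ω₀ e (π (n + 1) f) := by
    intro e f
    refine ext_coord fun i => ?_
    simp only [ω₀, coord_trunc, truncRep, coord_map, map_add, LinearMap.comp_apply, coord_inj,
      coord_π]
    rcases lt_trichotomy i n with h4 | rfl | h4
    · simp [h4, h4.ne, show i < n + 1 by omega]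
    · simp
    · simp [show ¬ i < n + 1 by omega, show ¬ i < n by omega, h4.ne']
  refine ⟨fun p => c p ∘ₗ ι n, fun p => h p ∘ₗ trunc (n + 1) - c p ∘ₗ π (n + 1), ?_, ?_, ?_⟩
  · intro e
    refine LinearMap.ext fun x => ?_
    have h1 : ι n (truncRep n ξ η e x) = truncRep (n + 1) ξ η e (ι n x) :=
      ext_coord fun i => by simp [truncRep]
    have h2 : ω₀ e (ι n x) = 0 := by
      simp [ω₀, coord_apply_of_le le_rfl]
    simp only [LinearMap.comp_apply]
    rw [h1, hc', h2, map_zero, add_zero]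
  · intro e
    refine LinearMap.ext fun x => ?_
    have h1 : π (n + 1) (truncRep (n + 2) ξ η e x) = truncRep (n + 1) ξ η e (π (n + 1) x) :=
      ext_coord fun i => by simp [truncRep]
    simp only [LinearMap.comp_apply, LinearMap.sub_apply, map_sub]
    rw [h1, hc', hω, map_add, hh']
    abel
  · intro p
    refine LinearMap.ext fun x => ?_
    have h1 : ι n (π n x) = π (n + 1) (ι (n + 1) x) := ext_coord fun i => by simp
    have h2 : trunc (n + 1) (ι (n + 1) x) = x := by
      refine ext_coord fun i => ?_
      rw [coord_trunc, coord_ι]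
      split_ifs with h3
      · rfl
      · rw [coord_apply_of_le (by omega)]
    simp [h1, h2]

end AlmostSplit
end GraphRep

/-! ### Endomorphisms of the truncations -/

namespace GraphRep
open Ladder

variable {V E : Type*} {s t : E → V}
variable {D : V → Type*} [∀ p, AddCommGroup (D p)] [∀ p, Module ℂ (D p)]

/-- The representation `ξ` is an extension of a brick supported on `S` by a brick supported on the
complement of `S`, and `η` is an extension cocycle, linearly independent of the one of `ξ`. The
family `ξ + ε η` is then the image of the family of Kronecker representations `(1, ε)` under the
embedding given by the two bricks. -/
structure IsBrickExtension (ξ η : C1 s t D D) (S : Set V) : Prop where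
  mem_of_mem : ∀ e, t e ∈ S → s e ∈ S
  eq_zero_left : ∀ e, t e ∈ S → η e = 0
  eq_zero_right : ∀ e, s e ∉ S → η e = 0
  brick_left : ∀ c : C0 D D, (∀ e, t e ∈ S → c (t e) ∘ₗ ξ e = ξ e ∘ₗ c (s e)) →
    ∃ r : ℂ, ∀ p ∈ S, c p = r • LinearMap.id
  brick_right : ∀ c : C0 D D, (∀ e, s e ∉ S → c (t e) ∘ₗ ξ e = ξ e ∘ₗ c (s e)) →
    ∃ r : ℂ, ∀ p ∉ S, c p = r • LinearMap.id
  indep : ∀ α β : ℂ, (∀ e, s e ∈ S → t e ∉ S → α • ξ e + β • η e = 0) → α = 0 ∧ β = 0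

namespace IsBrickExtension

variable {ξ η : C1 s t D D} {S : Set V} (hS : IsBrickExtension ξ η S)
include hS

theorem exists_crossing : ∃ e, s e ∈ S ∧ t e ∉ S ∧ ξ e ≠ 0 := by
  by_contra! h
  have := (hS.indep 1 0 fun e h1 h2 => by rw [h e h1 h2]; simp).1
  exact one_ne_zero this

theorem exists_left : ∃ p ∈ S, ∃ x : D p, x ≠ 0 := by
  obtain ⟨e, h1, -, h3⟩ := hS.exists_crossing
  obtain ⟨x, hx⟩ := DFunLike.ne_iff.1 h3
  exact ⟨s e, h1, x, by rintro rfl; exact hx (by simp)⟩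

theorem exists_right : ∃ p ∉ S, ∃ x : D p, x ≠ 0 := by
  obtain ⟨e, -, h2, h3⟩ := hS.exists_crossing
  obtain ⟨x, hx⟩ := DFunLike.ne_iff.1 h3
  exact ⟨t e, h2, ξ e x, hx⟩

/-- The endomorphisms of `T_k` are the polynomials in `ε`. -/
theorem exists_eq_series {k : ℕ} {r : C0 (fun p => Fin k → D p) (fun p => Fin k → D p)}
    (hr : IsHom (truncRep k ξ η) (truncRep k ξ η) r) :
    ∃ c : ℕ → ℂ, ∀ p, r p = series k fun j => c j • LinearMap.id := by
  have hmap : ∀ e, ∀ j < k, ∀ x, truncRep k ξ η e (inj k j x) =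
      inj k j (ξ e x) + if 1 ≤ j then inj k (j - 1) (η e x) else 0 := by
    intro e j hj x
    refine ext_coord fun n => ?_
    rw [truncRep, coord_map, map_add, coord_inj, coord_inj, coord_inj]
    congr 1
    · split_ifs <;> simp
    · by_cases h : 1 ≤ j
      · rw [if_pos h, coord_inj]
        by_cases h' : n + 1 = j
        · rw [if_pos ⟨h', hj⟩, if_pos (by omega)]
        · rw [if_neg (by tauto), if_neg (by omega), map_zero]
      · rw [if_neg h, if_neg (by omega), map_zero, map_zero]
  have hr' : ∀ e i, ∀ j < k, ∀ x, coord k i (r (t e) (inj k j (ξ e x))) +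
      (if 1 ≤ j then coord k i (r (t e) (inj k (j - 1) (η e x))) else 0) =
      ξ e (coord k i (r (s e) (inj k j x))) + η e (coord k (i + 1) (r (s e) (inj k j x))) := by
    intro e i j hj x
    have h1 := congrArg (coord k i) (LinearMap.congr_fun (hr e) (inj k j x))
    simp only [LinearMap.comp_apply, hmap e j hj, map_add] at h1
    rw [truncRep, coord_map] at h1
    rw [← h1]
    congr 1
    split_ifs <;> simp
  -- The matrix entries of `r` are endomorphisms of the two bricks, hence scalars.
  have hex : ∀ i j, j < k → ∃ a b : ℂ, (∀ p ∈ S, ∀ x, coord k i (r p (inj k j x)) = a • x) ∧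
      ∀ p ∉ S, ∀ x, coord k i (r p (inj k j x)) = b • x := by
    intro i j hj
    obtain ⟨a, ha⟩ := hS.brick_left (fun p => coord k i ∘ₗ r p ∘ₗ inj k j) fun e he => by
      refine LinearMap.ext fun x => ?_
      have h1 := hr' e i j hj x
      simp only [hS.eq_zero_left e he, LinearMap.zero_apply, map_zero, ite_self, add_zero] at h1
      exact h1
    obtain ⟨b, hb⟩ := hS.brick_right (fun p => coord k i ∘ₗ r p ∘ₗ inj k j) fun e he => by
      refine LinearMap.ext fun x => ?_
      have h1 := hr' e i j hj x
      simp only [hS.eq_zero_right e he, LinearMap.zero_apply, map_zero, ite_self, add_zero] at h1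
      exact h1
    exact ⟨a, b, fun p hp x => LinearMap.congr_fun (ha p hp) x,
      fun p hp x => LinearMap.congr_fun (hb p hp) x⟩
  choose! a b ha hb using hex
  -- The arrows from `S` to its complement force the matrix of `r` to be a Toeplitz matrix.
  have hab : ∀ i j, j < k → a i j = b i j ∧ a (i + 1) j = if 1 ≤ j then b i (j - 1) else 0 := by
    intro i j hj
    have h1 := hS.indep (a i j - b i j) (a (i + 1) j - if 1 ≤ j then b i (j - 1) else 0)
      fun e h2 h3 => by
        refine LinearMap.ext fun x => ?_
        have h4 := hr' e i j hj x
        rw [ha _ _ hj _ h2, ha _ _ hj _ h2, hb _ _ hj _ h3, map_smul, map_smul] at h4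
        by_cases h5 : 1 ≤ j
        · rw [if_pos h5, hb _ _ (by omega) _ h3] at h4
          rw [if_pos h5, LinearMap.add_apply, LinearMap.smul_apply, LinearMap.smul_apply,
            sub_smul, sub_smul, LinearMap.zero_apply, sub_add_sub_comm, h4, sub_self]
        · rw [if_neg h5] at h4
          rw [if_neg h5, LinearMap.add_apply, LinearMap.smul_apply, LinearMap.smul_apply,
            sub_smul, sub_zero, LinearMap.zero_apply, sub_add_eq_add_sub, ← h4]
          simp
    exact ⟨sub_eq_zero.1 h1.1, sub_eq_zero.1 h1.2⟩
  have hT : ∀ j, j < k → ∀ i, a i j = if i ≤ j then a 0 (j - i) else 0 := by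
    intro j
    induction j with
    | zero =>
      intro hj i
      rcases i with _ | i
      · simp
      · rw [(hab i 0 hj).2]
        simp
    | succ j ih =>
      intro hj i
      rcases i with _ | i
      · simp
      · rw [(hab i (j + 1) hj).2, if_pos (by omega), Nat.add_sub_cancel, ← (hab i j (by omega)).1,
          ih (by omega)]
        simp
  refine ⟨a 0, fun p => LinearMap.ext fun f => ext_coord fun i => ?_⟩
  have hall : ∀ i j, j < k → ∀ x : D p, coord k i (r p (inj k j x)) = a i j • x := by
    intro i j hj x
    by_cases hp : p ∈ S
    · exact ha i j hj p hp x
    · rw [(hab i j hj).1]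
      exact hb i j hj p hp x
  conv_lhs => rw [← sum_inj_coord f]
  conv_rhs => rw [← sum_inj_coord f]
  simp only [map_sum]
  refine Finset.sum_congr rfl fun j hj => ?_
  have hj' := Finset.mem_range.1 hj
  rw [hall i j hj', hT j hj', coord_series_inj hj']
  split_ifs <;> simp

end IsBrickExtension

theorem isHom_series (ξ η : C1 s t D D) (k : ℕ) (c : ℕ → ℂ) :
    IsHom (truncRep k ξ η) (truncRep k ξ η) fun _ => series k fun j => c j • LinearMap.id := by
  intro e
  refine LinearMap.ext fun f => ext_coord fun i => ?_
  simp only [LinearMap.comp_apply, truncRep, coord_series, coord_map, LinearMap.smul_apply,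
    LinearMap.id_apply, map_sum, ← Finset.sum_add_distrib, map_smul, smul_add]
  exact Finset.sum_congr rfl fun j _ => by rw [add_right_comm]

theorem series_eq_shift_comp {W : Type*} [AddCommGroup W] [Module ℂ W] (k : ℕ) {c : ℕ → ℂ}
    (hc : c 0 = 0) : (series k fun j => c j • LinearMap.id : (Fin k → W) →ₗ[ℂ] _) =
      shift k ∘ₗ series k fun j => c (j + 1) • LinearMap.id := by
  refine LinearMap.ext fun f => ext_coord fun i => ?_
  simp only [LinearMap.comp_apply, coord_shift, coord_series, LinearMap.smul_apply,
    LinearMap.id_apply]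
  rcases k with _ | k
  · simp
  · rw [Finset.sum_range_succ', Finset.sum_range_succ, hc, zero_smul, add_zero]
    rw [coord_apply_of_le (n := i + 1 + k) (by omega), smul_zero, add_zero]
    exact Finset.sum_congr rfl fun j _ => by rw [add_right_comm, add_assoc]

theorem series_eq_comp_shift {W : Type*} [AddCommGroup W] [Module ℂ W] (k : ℕ) {c : ℕ → ℂ}
    (hc : c 0 = 0) : (series k fun j => c j • LinearMap.id : (Fin k → W) →ₗ[ℂ] _) =
      (series k fun j => c (j + 1) • LinearMap.id) ∘ₗ shift k := by
  rw [series_eq_shift_comp k hc]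
  refine LinearMap.ext fun f => ext_coord fun i => ?_
  simp only [LinearMap.comp_apply, coord_shift, coord_series, LinearMap.smul_apply,
    LinearMap.id_apply]
  exact Finset.sum_congr rfl fun j _ => by rw [add_right_comm]

theorem series_bijective {W : Type*} [AddCommGroup W] [Module ℂ W] [FiniteDimensional ℂ W] (k : ℕ)
    {c : ℕ → ℂ} (hc : c 0 ≠ 0) :
    Function.Bijective (series k fun j => c j • LinearMap.id : (Fin k → W) →ₗ[ℂ] _) := by
  have hinj : Function.Injective
      (series k fun j => c j • LinearMap.id : (Fin k → W) →ₗ[ℂ] _) := by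
    rw [injective_iff_map_eq_zero]
    intro f hf
    have key : ∀ i, ∀ n, k ≤ n + i → coord k n f = 0 := by
      intro i
      induction i with
      | zero => exact fun n hn => coord_apply_of_le (by omega) f
      | succ i ih =>
        intro n hn
        by_cases hnk : n < k
        · have h2 := congrArg (coord k n) hf
          rw [coord_series, map_zero, Finset.sum_eq_single 0] at h2
          · simpa [hc] using h2
          · intro j _ hj
            rw [ih (n + j) (by omega), map_zero]
          · simp; omega
        · exact coord_apply_of_le (by omega) f
    exact ext_coord fun n => by rw [key k n (by omega), map_zero]
  exact ⟨hinj, LinearMap.injective_iff_surjective.1 hinj⟩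

end GraphRep

/-! ### Quiver representations as families of linear maps -/

section Translation

open GraphRep

variable {V : Type u} [Quiver.{v} V]

/-- The arrows of a quiver, with their end points. -/
abbrev QuiverArrow (V : Type u) [Quiver.{v} V] := Σ p q : V, (p ⟶ q)

/-- The source of an arrow. -/
abbrev arrowSource (e : QuiverArrow V) : V := e.1

/-- The target of an arrow. -/
abbrev arrowTarget (e : QuiverArrow V) : V := e.2.1

namespace QuiverRep

/-- The linear maps of a representation along all arrows. -/
abbrev maps (X : QuiverRep V) : C1 arrowSource arrowTarget X.space X.space :=
  fun e => X.linMap e.2.2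

/-- The representation with given spaces and given linear maps along the arrows. -/
noncomputable def mk (D : V → Type) [∀ p, AddCommGroup (D p)] [∀ p, Module ℂ (D p)]
    [∀ p, FiniteDimensional ℂ (D p)] (τ : C1 arrowSource arrowTarget D D) : QuiverRep V :=
  Paths.lift
    { obj := fun p => FGModuleCat.of ℂ (D p)
      map := fun {p q} a => FGModuleCat.ofHom (τ ⟨p, q, a⟩) }

section

variable (D : V → Type) [∀ p, AddCommGroup (D p)] [∀ p, Module ℂ (D p)]
    [∀ p, FiniteDimensional ℂ (D p)] (τ : C1 arrowSource arrowTarget D D)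

theorem mk_maps : (mk D τ).maps = τ := by
  funext ⟨p, q, a⟩
  have h := Paths.lift_toPath
    { obj := fun p => FGModuleCat.of ℂ (D p)
      map := fun {p q} a => FGModuleCat.ofHom (τ ⟨p, q, a⟩) } a
  exact congrArg (fun f => f.hom.hom) h

end

/-- The linear maps at the vertices of a morphism of representations. -/
abbrev vertexMaps {X Y : QuiverRep V} (f : X ⟶ Y) : C0 X.space Y.space :=
  fun p => (f.app ((Paths.of V).obj p)).hom.hom

theorem isHom_vertexMaps {X Y : QuiverRep V} (f : X ⟶ Y) :
    IsHom X.maps Y.maps (vertexMaps f) := by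
  intro e
  have h := f.naturality ((Paths.of V).map e.2.2)
  exact congrArg (fun f => f.hom.hom) h

theorem naturality_of_arrows {X Y : QuiverRep V} (γ : ∀ p : Paths V, X.obj p ⟶ Y.obj p)
    (h : ∀ (p q : V) (a : p ⟶ q), X.map ((Paths.of V).map a) ≫ γ ((Paths.of V).obj q) =
      γ ((Paths.of V).obj p) ≫ Y.map ((Paths.of V).map a)) {p q : Paths V} (f : p ⟶ q) :
    X.map f ≫ γ q = γ p ≫ Y.map f := by
  refine Paths.induction (P := fun {p q} f => X.map f ≫ γ q = γ p ≫ Y.map f) ?_ ?_ f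
  · intro p
    rw [X.map_id, Y.map_id, Category.id_comp, Category.comp_id]
  · intro p q r f a hf
    rw [X.map_comp, Y.map_comp, Category.assoc, h, ← Category.assoc, hf, Category.assoc]

/-- The morphism of representations with given linear maps at the vertices. -/
noncomputable def homMk {X Y : QuiverRep V} (c : C0 X.space Y.space) (hc : IsHom X.maps Y.maps c) :
    X ⟶ Y where
  app p := FGModuleCat.ofHom (c p)
  naturality _ _ f := naturality_of_arrows (fun p => FGModuleCat.ofHom (c p))
    (fun p q a => FGModuleCat.hom_ext (hc ⟨p, q, a⟩)) f

theorem hom_ext {X Y : QuiverRep V} {f g : X ⟶ Y} (h : ∀ p, vertexMaps f p = vertexMaps g p) :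
    f = g := by
  ext p : 2
  exact FGModuleCat.hom_ext (h p)

theorem isIso_of_bijective {X Y : QuiverRep V} (f : X ⟶ Y)
    (h : ∀ p, Function.Bijective (vertexMaps f p)) : IsIso f := by
  have : ∀ p, IsIso (f.app p) := fun p => by
    rw [ConcreteCategory.isIso_iff_bijective]
    exact h p
  exact NatIso.isIso_of_isIso_app f

theorem mono_of_injective {X Y : QuiverRep V} (f : X ⟶ Y)
    (h : ∀ p, Function.Injective (vertexMaps f p)) : Mono f := by
  have : ∀ p, Mono (f.app p) := fun p => ConcreteCategory.mono_of_injective _ (h p)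
  exact NatTrans.mono_of_mono_app f

theorem epi_of_surjective {X Y : QuiverRep V} (f : X ⟶ Y)
    (h : ∀ p, Function.Surjective (vertexMaps f p)) : Epi f := by
  have : ∀ p, Epi (f.app p) := fun p => ConcreteCategory.epi_of_surjective _ (h p)
  exact NatTrans.epi_of_epi_app f

end QuiverRep

end Translation

/-! ### The homogeneous tube -/

section Tube

open GraphRep Ladder

/-- A criterion for almost split sequences in terms of elements: `f` is a kernel of the epimorphism
`g`, which does not split, and both ends have local endomorphism rings. -/
theorem isAlmostSplit_of_kernel {C : Type*} [Category C] [Abelian C] {A B D : C} (f : A ⟶ B)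
    (g : B ⟶ D) (w : f ≫ g = 0) [Mono f] [Epi g]
    (hker : ∀ {M : C} (m : M ⟶ B), m ≫ g = 0 → ∃ l : M ⟶ A, l ≫ f = m)
    (hsplit : ¬ IsSplitEpi g) (hA : Indecomposable A) (hD : Indecomposable D)
    (lift : ∀ (M : C) (h : M ⟶ D), ¬ IsSplitEpi h → ∃ k : M ⟶ B, k ≫ g = h)
    (desc : ∀ (M : C) (h : A ⟶ M), ¬ IsSplitMono h → ∃ k : B ⟶ M, f ≫ k = h) :
    IsAlmostSplit (ShortComplex.mk f g w) where
  shortExact :=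
    { exact := ShortComplex.exact_of_f_is_kernel _ (KernelFork.IsLimit.ofι' f w fun m hm =>
        ⟨(hker m hm).choose, (hker m hm).choose_spec⟩)
      mono_f := ‹Mono f›
      epi_g := ‹Epi g› }
  not_split := ⟨fun σ => hsplit ⟨⟨⟨σ.s, σ.s_g⟩⟩⟩⟩
  indecomposable_left := hA
  indecomposable_right := hD
  lift := lift
  desc := desc

theorem indecomposable_of_isIso_or_isIso {C : Type*} [Category C] [Abelian C] {X : C}
    (h0 : ¬ IsZero X) (h : ∀ r : X ⟶ X, IsIso r ∨ IsIso (𝟙 X - r)) : Indecomposable X := by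
  refine ⟨h0, fun Y Z φ => ?_⟩
  rcases h (φ.hom ≫ biprod.fst ≫ biprod.inl ≫ φ.inv) with hr | hr
  · right
    have h1 : biprod.snd (X := Y) (Y := Z) = 0 := by
      rw [← cancel_epi φ.hom, ← cancel_epi (φ.hom ≫ biprod.fst ≫ biprod.inl ≫ φ.inv)]
      simp
    rw [IsZero.iff_id_eq_zero, ← biprod.inr_snd (X := Y) (Y := Z), h1, comp_zero]
  · left
    have h1 : biprod.fst (X := Y) (Y := Z) = 0 := by
      rw [← cancel_epi φ.hom,
        ← cancel_epi (𝟙 X - φ.hom ≫ biprod.fst ≫ biprod.inl ≫ φ.inv)]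
      simp
    rw [IsZero.iff_id_eq_zero, ← biprod.inl_fst (X := Y) (Y := Z), h1, comp_zero]

theorem comp_desc_neg {C : Type*} [Category C] [Abelian C] {M A B D : C} (m : M ⟶ A ⊞ B)
    (a : A ⟶ D) (b : B ⟶ D) :
    m ≫ biprod.desc a (-b) = (m ≫ biprod.fst) ≫ a - (m ≫ biprod.snd) ≫ b := by
  rw [biprod.desc_eq]
  simp [sub_eq_add_neg]

variable {V : Type u} [Quiver.{v} V]

namespace QuiverRep

variable {D : V → Type} [∀ p, AddCommGroup (D p)] [∀ p, Module ℂ (D p)]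
  [∀ p, FiniteDimensional ℂ (D p)] {τ : C1 arrowSource arrowTarget D D}
  {D' : V → Type} [∀ p, AddCommGroup (D' p)] [∀ p, Module ℂ (D' p)]
  [∀ p, FiniteDimensional ℂ (D' p)] {τ' : C1 arrowSource arrowTarget D' D'}
  {M : QuiverRep V}

/-- A morphism to the representation `mk D τ`. -/
noncomputable def homTo (c : C0 M.space D) (hc : IsHom M.maps τ c) : M ⟶ mk D τ :=
  homMk (Y := mk D τ) c (by rw [mk_maps]; exact hc)

/-- A morphism from the representation `mk D τ`. -/
noncomputable def homFrom (c : C0 D M.space) (hc : IsHom τ M.maps c) : mk D τ ⟶ M :=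
  homMk (X := mk D τ) c (by rw [mk_maps]; exact hc)

/-- A morphism between representations of the form `mk D τ`. -/
noncomputable def homBetween (c : C0 D D') (hc : IsHom τ τ' c) : mk D τ ⟶ mk D' τ' :=
  homMk (X := mk D τ) (Y := mk D' τ') c (by rw [mk_maps, mk_maps]; exact hc)

/-- The linear maps of a morphism to the representation `mk D τ`. -/
noncomputable def mapsTo (f : M ⟶ mk D τ) : C0 M.space D := vertexMaps f

/-- The linear maps of a morphism from the representation `mk D τ`. -/
noncomputable def mapsFrom (f : mk D τ ⟶ M) : C0 D M.space := vertexMaps f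

/-- The linear maps of a morphism between representations of the form `mk D τ`. -/
noncomputable def mapsBetween (f : mk D τ ⟶ mk D' τ') : C0 D D' := vertexMaps f

theorem isHom_mapsTo (f : M ⟶ mk D τ) : IsHom M.maps τ (mapsTo f) := by
  have h := isHom_vertexMaps f
  rwa [mk_maps] at h

theorem isHom_mapsFrom (f : mk D τ ⟶ M) : IsHom τ M.maps (mapsFrom f) := by
  have h := isHom_vertexMaps f
  rwa [mk_maps] at h

theorem isHom_mapsBetween (f : mk D τ ⟶ mk D' τ') : IsHom τ τ' (mapsBetween f) := by
  have h := isHom_vertexMaps f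
  rwa [mk_maps, mk_maps] at h

theorem hom_ext_to {f g : M ⟶ mk D τ} (h : ∀ p x, mapsTo f p x = mapsTo g p x) : f = g :=
  QuiverRep.hom_ext fun p => LinearMap.ext (h p)

theorem hom_ext_from {f g : mk D τ ⟶ M} (h : ∀ p x, mapsFrom f p x = mapsFrom g p x) : f = g :=
  QuiverRep.hom_ext fun p => LinearMap.ext (h p)

theorem hom_ext_between {f g : mk D τ ⟶ mk D' τ'}
    (h : ∀ p x, mapsBetween f p x = mapsBetween g p x) : f = g :=
  QuiverRep.hom_ext fun p => LinearMap.ext (h p)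

@[simp] theorem mapsTo_homTo (c : C0 M.space D) (hc : IsHom M.maps τ c) :
    mapsTo (homTo c hc) = c := rfl

@[simp] theorem mapsFrom_homFrom (c : C0 D M.space) (hc : IsHom τ M.maps c) :
    mapsFrom (homFrom c hc) = c := rfl

@[simp] theorem mapsBetween_homBetween (c : C0 D D') (hc : IsHom τ τ' c) :
    mapsBetween (homBetween c hc) = c := rfl

@[simp] theorem mapsTo_comp (f : M ⟶ mk D τ) (g : mk D τ ⟶ mk D' τ') (p : V) (x : M.space p) :
    mapsTo (f ≫ g) p x = mapsBetween g p (mapsTo f p x) := rfl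

@[simp] theorem mapsBetween_id (p : V) (x : D p) : mapsBetween (𝟙 (mk D τ)) p x = x := rfl

@[simp] theorem mapsBetween_zero (p : V) (x : D p) :
    mapsBetween (0 : mk D τ ⟶ mk D' τ') p x = 0 := rfl

@[simp] theorem mapsTo_zero (p : V) (x : M.space p) : mapsTo (0 : M ⟶ mk D τ) p x = 0 := rfl

@[simp] theorem mapsTo_neg (f : M ⟶ mk D τ) (p : V) (x : M.space p) :
    mapsTo (-f) p x = -mapsTo f p x := rfl

@[simp] theorem mapsBetween_neg (f : mk D τ ⟶ mk D' τ') (p : V) (x : D p) :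
    mapsBetween (-f) p x = -mapsBetween f p x := rfl

@[simp] theorem mapsBetween_sub (f g : mk D τ ⟶ mk D' τ') (p : V) (x : D p) :
    mapsBetween (f - g) p x = mapsBetween f p x - mapsBetween g p x := rfl

@[simp] theorem mapsBetween_comp {D'' : V → Type} [∀ p, AddCommGroup (D'' p)]
    [∀ p, Module ℂ (D'' p)] [∀ p, FiniteDimensional ℂ (D'' p)]
    {τ'' : C1 arrowSource arrowTarget D'' D''} (f : mk D τ ⟶ mk D' τ')
    (g : mk D' τ' ⟶ mk D'' τ'') (p : V) (x : D p) :
    mapsBetween (f ≫ g) p x = mapsBetween g p (mapsBetween f p x) := rfl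

theorem mono_of_mapsBetween_injective (f : mk D τ ⟶ mk D' τ')
    (h : ∀ p, Function.Injective (mapsBetween f p)) : Mono f :=
  mono_of_injective f h

theorem epi_of_mapsBetween_surjective (f : mk D τ ⟶ mk D' τ')
    (h : ∀ p, Function.Surjective (mapsBetween f p)) : Epi f :=
  epi_of_surjective f h

end QuiverRep

open QuiverRep

variable {D : V → Type} [∀ p, AddCommGroup (D p)] [∀ p, Module ℂ (D p)]
  [∀ p, FiniteDimensional ℂ (D p)]

/-- The data from which a homogeneous tube is built: a family `ξ + ε η` of representations whose
dimension vector is radical, which is isomorphic to its Auslander–Reiten translate by means of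
`ζ`, and which comes from an embedding of the Kronecker representations. -/
structure IsHomogeneousFamily [Fintype V] [Fintype (QuiverArrow V)]
    (ξ η : C1 arrowSource arrowTarget D D)
    (ζ : ℕ → C1 arrowTarget arrowSource D D) (S : Set V) : Prop where
  preprojective : IsPreprojectiveSeries ξ η ζ
  nondegenerate : IsNondegenerate ξ (ζ 0)
  radical : IsRadicalVector (V := V) arrowSource arrowTarget fun p => Module.finrank ℂ (D p)
  extension : IsBrickExtension ξ η S

/-- The representations of the tube: `tubeRep ξ η n` is the truncation `T_{n+1}`. -/
noncomputable abbrev tubeRep (ξ η : C1 arrowSource arrowTarget D D) (n : ℕ) : QuiverRep V :=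
  mk (fun p => Fin (n + 1) → D p) (truncRep (n + 1) ξ η)

/-- The irreducible monomorphisms `T_{n+1} ⟶ T_{n+2}` of the tube. -/
noncomputable def tubeι (ξ η : C1 arrowSource arrowTarget D D) (n : ℕ) :
    tubeRep ξ η n ⟶ tubeRep ξ η (n + 1) :=
  homBetween (fun _ => ι (n + 1)) fun e => LinearMap.ext fun f => ext_coord fun i => by
    simp [truncRep]

/-- The irreducible epimorphisms `T_{n+2} ⟶ T_{n+1}` of the tube. -/
noncomputable def tubeπ (ξ η : C1 arrowSource arrowTarget D D) (n : ℕ) :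
    tubeRep ξ η (n + 1) ⟶ tubeRep ξ η n :=
  homBetween (fun _ => π (n + 1)) fun e => LinearMap.ext fun f => ext_coord fun i => by
    simp [truncRep]

@[simp] theorem mapsBetween_tubeι (ξ η : C1 arrowSource arrowTarget D D) (n : ℕ) (p : V)
    (f : Fin (n + 1) → D p) : mapsBetween (tubeι ξ η n) p f = ι (n + 1) f := rfl

@[simp] theorem mapsBetween_tubeπ (ξ η : C1 arrowSource arrowTarget D D) (n : ℕ) (p : V)
    (f : Fin (n + 2) → D p) : mapsBetween (tubeπ ξ η n) p f = π (n + 1) f := rfl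

instance (ξ η : C1 arrowSource arrowTarget D D) (n : ℕ) : Mono (tubeι ξ η n) :=
  mono_of_mapsBetween_injective _ fun p f g hfg => ext_coord fun i => by
    rw [mapsBetween_tubeι, mapsBetween_tubeι] at hfg
    rw [← coord_ι f, hfg, coord_ι]

instance (ξ η : C1 arrowSource arrowTarget D D) (n : ℕ) : Epi (tubeπ ξ η n) :=
  epi_of_mapsBetween_surjective _ fun p f => ⟨cons (n + 1) f, ext_coord fun i => by
    rw [mapsBetween_tubeπ, coord_π, coord_cons_succ]⟩

theorem tubeι_comp_tubeπ (ξ η : C1 arrowSource arrowTarget D D) (n : ℕ) :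
    tubeι ξ η (n + 1) ≫ tubeπ ξ η (n + 1) = tubeπ ξ η n ≫ tubeι ξ η n :=
  hom_ext_between fun p f => ext_coord fun i => by simp

namespace IsHomogeneousFamily

variable {ξ η : C1 arrowSource arrowTarget D D} {ζ : ℕ → C1 arrowTarget arrowSource D D}
  {S : Set V} [Fintype V] [Fintype (QuiverArrow V)] (hF : IsHomogeneousFamily ξ η ζ S)
include hF

theorem exists_series {n : ℕ} (r : tubeRep ξ η n ⟶ tubeRep ξ η n) :
    ∃ c : ℕ → ℂ, (∀ p, mapsBetween r p = series (n + 1) fun j => c j • LinearMap.id) ∧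
      (c 0 ≠ 0 → IsIso r) := by
  obtain ⟨c, hc⟩ := hF.extension.exists_eq_series (isHom_mapsBetween r)
  refine ⟨c, hc, fun h0 => isIso_of_bijective r fun p => ?_⟩
  change Function.Bijective (mapsBetween r p)
  rw [hc]
  exact series_bijective _ h0

theorem not_isZero (n : ℕ) : ¬ IsZero (tubeRep ξ η n) := by
  intro h
  obtain ⟨p, -, x, hx⟩ := hF.extension.exists_left
  rw [IsZero.iff_id_eq_zero] at h
  have h1 := congrArg (coord (n + 1) 0)
    (LinearMap.congr_fun (congrFun (congrArg mapsBetween h) p) (inj (n + 1) 0 x))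
  rw [mapsBetween_id, mapsBetween_zero, coord_inj, map_zero, if_pos (by omega)] at h1
  exact hx h1

theorem indecomposable (n : ℕ) : Indecomposable (tubeRep ξ η n) := by
  refine indecomposable_of_isIso_or_isIso (hF.not_isZero n) fun r => ?_
  obtain ⟨c, hc, hc0⟩ := hF.exists_series r
  obtain ⟨c', hc', hc0'⟩ := hF.exists_series (𝟙 _ - r)
  by_cases h : c 0 = 0
  · right
    refine hc0' fun h' => ?_
    -- The constant terms of the series of `r` and of `1 - r` add up to `1`.
    obtain ⟨p, -, x, hx⟩ := hF.extension.exists_left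
    have h1 := congrArg (coord (n + 1) 0) (LinearMap.congr_fun (hc' p) (inj (n + 1) 0 x))
    rw [mapsBetween_sub, hc, map_sub, coord_series_inj (by omega),
      coord_series_inj (by omega), mapsBetween_id, coord_inj] at h1
    simp [h, h'] at h1
    exact hx h1
  · exact Or.inl (hc0 h)

/-- If `M ⟶ T_{n+1}` is not a split epimorphism, its composites with morphisms `T_{n+1} ⟶ M` are
divisible by `ε`. -/
theorem divisible_of_not_isSplitEpi {n : ℕ} {M : QuiverRep V} {h : M ⟶ tubeRep ξ η n}
    (hh : ¬ IsSplitEpi h) (k : C0 (fun p => Fin (n + 1) → D p) M.space)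
    (hk : IsHom (truncRep (n + 1) ξ η) M.maps k) :
    ∃ r : C0 (fun p => Fin (n + 1) → D p) (fun p => Fin (n + 1) → D p),
      IsHom (truncRep (n + 1) ξ η) (truncRep (n + 1) ξ η) r ∧
        ∀ p, mapsTo h p ∘ₗ k p = shift (n + 1) ∘ₗ r p := by
  obtain ⟨c, hc, hc0⟩ := hF.exists_series (homFrom k hk ≫ h)
  have h0 : c 0 = 0 := by
    by_contra h0
    have := hc0 h0
    exact hh ⟨⟨⟨inv (homFrom k hk ≫ h) ≫ homFrom k hk, by simp⟩⟩⟩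
  exact ⟨_, isHom_series ξ η (n + 1) fun j => c (j + 1), fun p =>
    (hc p).trans (series_eq_shift_comp (n + 1) h0)⟩

/-- If `T_{n+1} ⟶ M` is not a split monomorphism, its composites with morphisms `M ⟶ T_{n+1}` are
divisible by `ε`. -/
theorem divisible_of_not_isSplitMono {n : ℕ} {M : QuiverRep V} {h : tubeRep ξ η n ⟶ M}
    (hh : ¬ IsSplitMono h) (k : C0 M.space (fun p => Fin (n + 1) → D p))
    (hk : IsHom M.maps (truncRep (n + 1) ξ η) k) :
    ∃ r : C0 (fun p => Fin (n + 1) → D p) (fun p => Fin (n + 1) → D p),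
      IsHom (truncRep (n + 1) ξ η) (truncRep (n + 1) ξ η) r ∧
        ∀ p, k p ∘ₗ mapsFrom h p = r p ∘ₗ shift (n + 1) := by
  obtain ⟨c, hc, hc0⟩ := hF.exists_series (h ≫ homTo k hk)
  have h0 : c 0 = 0 := by
    by_contra h0
    have := hc0 h0
    exact hh ⟨⟨⟨homTo k hk ≫ inv (h ≫ homTo k hk), by
      rw [← Category.assoc, IsIso.hom_inv_id]⟩⟩⟩
  exact ⟨_, isHom_series ξ η (n + 1) fun j => c (j + 1), fun p =>
    (hc p).trans (series_eq_comp_shift (n + 1) h0)⟩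

/-- A section of `T_n ⊕ T_{n+2} ⟶ T_{n+1}` would make the epimorphism `T_{n+2} ⟶ T_{n+1}`
injective. -/
theorem not_section (n : ℕ) (a : C0 (fun p => Fin (n + 1) → D p) fun p => Fin n → D p)
    (b : tubeRep ξ η n ⟶ tubeRep ξ η (n + 1))
    (hab : ∀ p x, ι n (a p x) - π (n + 1) (mapsBetween b p x) = x) : False := by
  obtain ⟨c, hc, hc0⟩ := hF.exists_series (tubeπ ξ η n ≫ b)
  obtain ⟨p, -, x, hx⟩ := hF.extension.exists_left
  have hc' : ∀ f, mapsBetween b p (π (n + 1) f) =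
      series (n + 2) (fun j => c j • LinearMap.id) f := LinearMap.congr_fun (hc p)
  by_cases h0 : c 0 = 0
  · have h1 := congrArg (coord (n + 1) n) (hab p (π (n + 1) (inj (n + 2) (n + 1) x)))
    rw [hc', map_sub, coord_ι, coord_π, coord_series_inj (by omega), coord_apply_of_le le_rfl,
      coord_π, coord_inj] at h1
    simp [h0] at h1
    exact hx h1.symm
  · have h1 : inj (n + 2) 0 x = 0 := by
      refine (series_bijective (n + 2) h0).1 ?_
      rw [map_zero, ← hc']
      have : π (n + 1) (inj (n + 2) 0 x) = 0 := ext_coord fun i => by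
        rw [coord_π, coord_inj, if_neg (by omega), map_zero]
      rw [this, map_zero]
    have h2 := congrArg (coord (n + 2) 0) h1
    rw [coord_inj, if_pos (by omega), map_zero] at h2
    exact hx h2

theorem hasAlmostSplitSequence_zero :
    HasAlmostSplitSequence (tubeRep ξ η 0) (tubeRep ξ η 1) (tubeRep ξ η 0) := by
  refine ⟨tubeι ξ η 0, tubeπ ξ η 0, ?_, isAlmostSplit_of_kernel _ _ _ ?_ ?_
    (hF.indecomposable 0) (hF.indecomposable 0) ?_ ?_⟩
  · refine hom_ext_between fun p f => ext_coord fun i => ?_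
    rw [mapsBetween_comp, mapsBetween_tubeι, mapsBetween_tubeπ, coord_π, coord_ι,
      coord_apply_of_le (by omega), mapsBetween_zero, map_zero]
  · intro M m hm
    have hm' : ∀ p x i, coord 2 (i + 1) (mapsTo m p x) = 0 := by
      intro p x i
      have h := congrArg (coord 1 i) (LinearMap.congr_fun (congrFun (congrArg mapsTo hm) p) x)
      rwa [mapsTo_comp, mapsBetween_tubeπ, coord_π, mapsTo_zero, map_zero] at h
    let l : M ⟶ tubeRep ξ η 0 := homTo (fun p => trunc 1 ∘ₗ mapsTo m p) fun e =>
      LinearMap.ext fun x => ext_coord fun i => by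
        have h := LinearMap.congr_fun (isHom_mapsTo m e) x
        simp only [LinearMap.comp_apply] at h
        simp only [LinearMap.comp_apply, coord_trunc, truncRep, coord_map, h, hm']
        rcases i with _ | i <;> simp
    refine ⟨l, hom_ext_to fun p x => ext_coord fun i => ?_⟩
    · have h : mapsTo l p x = trunc 1 (mapsTo m p x) := rfl
      rw [mapsTo_comp, mapsBetween_tubeι, coord_ι, h, coord_trunc]
      rcases i with _ | i
      · simp
      · rw [hm', if_neg (by omega)]
  · rintro ⟨⟨σ⟩⟩
    refine hF.not_section 0 (fun p => 0) (-σ.section_) fun p x => ?_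
    have h := LinearMap.congr_fun (congrFun (congrArg mapsBetween σ.id) p) x
    rw [mapsBetween_neg, LinearMap.zero_apply, map_zero, map_neg, zero_sub, neg_neg]
    exact h
  · intro M h hh
    obtain ⟨a, b, -, hb, hab⟩ := exists_lift hF.preprojective hF.nondegenerate hF.radical 0 M.maps
      (mapsTo h) (isHom_mapsTo h) (hF.divisible_of_not_isSplitEpi hh)
    refine ⟨-homTo b hb, hom_ext_to fun p x => ext_coord fun i => ?_⟩
    have h1 := congrArg (coord 1 i) (LinearMap.congr_fun (hab p) x)
    rw [← h1, LinearMap.sub_apply, map_sub, LinearMap.comp_apply, coord_ι,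
      coord_apply_of_le (Nat.zero_le _), zero_sub, ← map_neg]
    simp
  · intro M h hh
    obtain ⟨a, b, -, hb, hab⟩ := exists_desc hF.preprojective hF.nondegenerate hF.radical 0 M.maps
      (mapsFrom h) (isHom_mapsFrom h) (hF.divisible_of_not_isSplitMono hh)
    refine ⟨homFrom b hb, hom_ext_from fun p x => ?_⟩
    have h2 : π 0 x = 0 := Subsingleton.elim _ _
    rw [← hab p, LinearMap.add_apply, LinearMap.comp_apply, h2, map_zero]
    exact (zero_add (b p (ι 1 x))).symm

theorem hasAlmostSplitSequence_succ (n : ℕ) :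
    HasAlmostSplitSequence (tubeRep ξ η (n + 1)) (tubeRep ξ η n ⊞ tubeRep ξ η (n + 2))
      (tubeRep ξ η (n + 1)) := by
  have hmono : Mono (biprod.lift (tubeπ ξ η n) (tubeι ξ η (n + 1))) :=
    mono_of_mono_fac (biprod.lift_snd _ _)
  have hepi : Epi (biprod.desc (tubeι ξ η n) (-tubeπ ξ η (n + 1))) :=
    epi_of_epi_fac (biprod.inr_desc (tubeι ξ η n) (-tubeπ ξ η (n + 1)))
  refine ⟨biprod.lift (tubeπ ξ η n) (tubeι ξ η (n + 1)),
    biprod.desc (tubeι ξ η n) (-tubeπ ξ η (n + 1)), ?_, isAlmostSplit_of_kernel _ _ _ ?_ ?_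
    (hF.indecomposable _) (hF.indecomposable _) ?_ ?_⟩
  · rw [biprod.lift_desc, Preadditive.comp_neg, tubeι_comp_tubeπ, add_neg_cancel]
  · intro M m hm
    obtain ⟨a, b, rfl⟩ : ∃ a b, m = biprod.lift a b :=
      ⟨m ≫ biprod.fst, m ≫ biprod.snd, biprod.hom_ext _ _ (by simp) (by simp)⟩
    rw [biprod.lift_desc, Preadditive.comp_neg, add_neg_eq_zero] at hm
    have hm' : ∀ p x i, coord (n + 1) i (mapsTo a p x) =
        coord (n + 3) (i + 1) (mapsTo b p x) := by
      intro p x i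
      have h := congrArg (coord (n + 2) i)
        (LinearMap.congr_fun (congrFun (congrArg mapsTo hm) p) x)
      rwa [mapsTo_comp, mapsTo_comp, mapsBetween_tubeι, coord_ι, mapsBetween_tubeπ, coord_π] at h
    have htop : ∀ p x, coord (n + 3) (n + 2) (mapsTo b p x) = 0 := fun p x => by
      rw [← hm' p x (n + 1), coord_apply_of_le le_rfl]
    let l : M ⟶ tubeRep ξ η (n + 1) := homTo (fun p => trunc (n + 2) ∘ₗ mapsTo b p)
      fun e => LinearMap.ext fun x => ext_coord fun i => by
        have h := LinearMap.congr_fun (isHom_mapsTo b e) x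
        simp only [LinearMap.comp_apply] at h
        simp only [LinearMap.comp_apply, coord_trunc, truncRep, coord_map, h]
        rcases lt_trichotomy i (n + 1) with h4 | rfl | h4
        · simp [show i < n + 2 by omega, show i ≤ n by omega]
        · simp [htop]
        · simp [show ¬ i < n + 2 by omega, show ¬ i ≤ n by omega]
    have hl : ∀ p x i, coord (n + 2) i (mapsTo l p x) =
        coord (n + 3) i (mapsTo b p x) := by
      intro p x i
      have h : mapsTo l p x = trunc (n + 2) (mapsTo b p x) := rfl
      rw [h, coord_trunc]
      split_ifs with hi
      · rfl
      · rcases (not_lt.1 hi).eq_or_lt with rfl | hi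
        · rw [htop]
        · rw [coord_apply_of_le (by omega)]
    refine ⟨l, biprod.hom_ext _ _ ?_ ?_⟩
    · rw [Category.assoc, biprod.lift_fst, biprod.lift_fst]
      refine hom_ext_to fun p x => ext_coord fun i => ?_
      rw [mapsTo_comp, mapsBetween_tubeπ, coord_π, hl, hm']
    · rw [Category.assoc, biprod.lift_snd, biprod.lift_snd]
      refine hom_ext_to fun p x => ext_coord fun i => ?_
      rw [mapsTo_comp, mapsBetween_tubeι, coord_ι, hl]
  · rintro ⟨⟨σ⟩⟩
    refine hF.not_section (n + 1) (mapsBetween (σ.section_ ≫ biprod.fst))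
      (σ.section_ ≫ biprod.snd) fun p x => ?_
    have h : (σ.section_ ≫ biprod.fst) ≫ tubeι ξ η n -
        (σ.section_ ≫ biprod.snd) ≫ tubeπ ξ η (n + 1) = 𝟙 _ := by
      refine (comp_desc_neg _ _ _).symm.trans σ.id
    exact LinearMap.congr_fun (congrFun (congrArg mapsBetween h) p) x
  · intro M h hh
    obtain ⟨a, b, ha, hb, hab⟩ := exists_lift hF.preprojective hF.nondegenerate hF.radical (n + 1)
      M.maps (mapsTo h) (isHom_mapsTo h) (hF.divisible_of_not_isSplitEpi hh)
    refine ⟨biprod.lift (homTo a ha) (homTo b hb), ?_⟩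
    rw [biprod.lift_desc, Preadditive.comp_neg, ← sub_eq_add_neg]
    exact QuiverRep.hom_ext fun p => hab p
  · intro M h hh
    obtain ⟨a, b, ha, hb, hab⟩ := exists_desc hF.preprojective hF.nondegenerate hF.radical (n + 1)
      M.maps (mapsFrom h) (isHom_mapsFrom h) (hF.divisible_of_not_isSplitMono hh)
    refine ⟨biprod.desc (homFrom a ha) (homFrom b hb), ?_⟩
    rw [biprod.lift_desc]
    exact QuiverRep.hom_ext fun p => hab p

theorem isHomogeneousTube : IsHomogeneousTube (tubeRep ξ η) :=
  ⟨hF.hasAlmostSplitSequence_zero, hF.hasAlmostSplitSequence_succ⟩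

end IsHomogeneousFamily

end Tube

/-! ### Singular points -/

section LocalRing

variable {R : Type*} [CommRing R]

open IsLocalRing

/-- Derivations at a point bound the number of generators of the maximal ideal of the local ring
from below. -/
theorem card_le_spanFinrank_maximalIdeal {P : Ideal R} [P.IsPrime]
    {ι : Type*} [Fintype ι] [DecidableEq ι] (ev : R →+* ℂ) (hev : ∀ r, r ∈ P ↔ ev r = 0)
    (d : R → ι → ℂ) (hadd : ∀ a b, d (a + b) = d a + d b)
    (hmul : ∀ a b, d (a * b) = ev a • d b + ev b • d a)
    (g : ι → R) (hg : ∀ j, g j ∈ P) (hdg : ∀ j, d (g j) = Pi.single j 1)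
    (hfg : (maximalIdeal (Localization.AtPrime P)).FG) :
    Fintype.card ι ≤ (maximalIdeal (Localization.AtPrime P)).spanFinrank := by
  obtain ⟨s, hcard, hs, hspan⟩ : ∃ s : Set (Localization.AtPrime P),
      s.ncard = (maximalIdeal (Localization.AtPrime P)).spanFinrank ∧ s.Finite ∧
      Submodule.span _ s = maximalIdeal (Localization.AtPrime P) := by
    obtain ⟨s, h1, h2⟩ := Submodule.FG.exists_span_finset_card_eq_spanFinrank hfg
    exact ⟨s, by rw [Set.ncard_coe_finset, h1], s.finite_toSet, h2⟩
  have hsm : ∀ u ∈ s, u ∈ maximalIdeal (Localization.AtPrime P) := fun u hu => by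
    rw [← hspan]; exact Submodule.subset_span hu
  choose f hf using IsLocalization.surj P.primeCompl (S := Localization.AtPrime P)
  have hfP : ∀ u ∈ maximalIdeal (Localization.AtPrime P), (f u).1 ∈ P := fun u hu => by
    rw [← IsLocalization.AtPrime.to_map_mem_maximal_iff (Localization.AtPrime P) P, ← hf]
    exact Ideal.mul_mem_right _ _ hu
  have hd0 : ∀ a b, ev a = 0 → d (a * b) = ev b • d a := fun a b h => by
    rw [hmul, h, zero_smul, zero_add]
  have hne : ∀ t : P.primeCompl, ev t ≠ 0 := fun t h => t.2 ((hev _).2 h)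
  let w : Localization.AtPrime P → ι → ℂ := fun u => d (f u).1
  -- The differential of a numerator of an element of the span of `s` lies in the span of those of
  -- the elements of `s`.
  have key : ∀ x ∈ Submodule.span (Localization.AtPrime P) s,
      ∃ (r : R) (t : P.primeCompl), x * algebraMap R _ t = algebraMap R _ r ∧ ev r = 0 ∧
        d r ∈ Submodule.span ℂ (w '' s) := by
    intro x hx
    induction hx using Submodule.span_induction with
    | mem u hu => exact ⟨_, _, hf u, (hev _).1 (hfP u (hsm u hu)),
        Submodule.subset_span ⟨u, hu, rfl⟩⟩
    | zero =>
      refine ⟨0, 1, by simp, map_zero _, ?_⟩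
      have : d 0 = 0 := by simpa using hadd 0 0
      rw [this]; exact zero_mem _
    | add x y _ _ hx hy =>
      obtain ⟨r, t, h, h0, hr⟩ := hx
      obtain ⟨r', t', h', h0', hr'⟩ := hy
      refine ⟨r * t' + r' * t, t * t', ?_, by simp [h0, h0'], ?_⟩
      · simp only [Submonoid.coe_mul, map_mul, map_add, ← h, ← h']
        ring
      · rw [hadd, hd0 _ _ h0, hd0 _ _ h0']
        exact add_mem (Submodule.smul_mem _ _ hr) (Submodule.smul_mem _ _ hr')
    | smul c x _ hx =>
      obtain ⟨r, t, h, h0, hr⟩ := hx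
      refine ⟨r * (f c).1, (f c).2 * t, ?_, by simp [h0], ?_⟩
      · simp only [Submonoid.coe_mul, map_mul, ← h, ← hf, smul_eq_mul]
        ring
      · rw [hd0 _ _ h0]
        exact Submodule.smul_mem _ _ hr
  have htop : ⊤ ≤ Submodule.span ℂ (w '' s) := by
    rw [← Pi.basisFun ℂ ι |>.span_eq, Submodule.span_le]
    rintro _ ⟨j, rfl⟩
    have hj : algebraMap R (Localization.AtPrime P) (g j) ∈
        Submodule.span (Localization.AtPrime P) s := by
      rw [hspan]
      exact (IsLocalization.AtPrime.to_map_mem_maximal_iff (Localization.AtPrime P) P _).2 (hg j)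
    obtain ⟨r, t, h, h0, hr⟩ := key _ hj
    rw [← map_mul] at h
    obtain ⟨c, hc⟩ := IsLocalization.exists_of_eq (M := P.primeCompl) h
    have h1 := congrArg d hc
    rw [mul_comm, mul_comm (c : R), hd0 _ _ (by simp [(hev _).1 (hg j)]),
      hd0 _ _ ((hev _).1 (hg j)), hd0 _ _ h0, hdg] at h1
    have h2 := smul_right_injective _ (hne c) h1
    simp only [Pi.basisFun_apply, SetLike.mem_coe]
    rw [← inv_smul_smul₀ (hne t) (Pi.single j 1 : ι → ℂ), h2]
    exact Submodule.smul_mem _ _ hr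
  have hfin := hs.image w
  have : Fintype (w '' s) := hfin.fintype
  calc Fintype.card ι = Module.finrank ℂ (Submodule.span ℂ (w '' s)) := by
        rw [top_le_iff.1 htop, finrank_top, Module.finrank_fintype_fun_eq_card]
    _ ≤ (w '' s).ncard := by
        rw [Set.ncard_eq_toFinset_card']
        exact finrank_span_le_card _
    _ ≤ s.ncard := Set.ncard_image_le hs
    _ = _ := hcard

/-- If `x`, `y`, `a`, `b` generate the prime ideal `P` and satisfy `y = a + b x` and
`a x + b y = 0`, then `z = x + b` and `w = a + b ^ 2` satisfy `z w = b ^ 3`, so that `P` is minimal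
over `(z, w)` in the local ring. -/
theorem ringKrullDim_atPrime_le_two {P : Ideal R} [P.IsPrime]
    [IsNoetherianRing (Localization.AtPrime P)] {x y a b : R} (hP : P = Ideal.span {x, y, a, b}) (h1 : y = a + b * x)
    (h2 : a * x + b * y = 0) : ringKrullDim (Localization.AtPrime P) ≤ 2 := by
  let φ := algebraMap R (Localization.AtPrime P)
  have hmax : maximalIdeal (Localization.AtPrime P) = Ideal.map φ P :=
    Localization.AtPrime.map_eq_maximalIdeal.symm
  have hmem : ∀ r ∈ P, φ r ∈ maximalIdeal (Localization.AtPrime P) := fun r hr => by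
    rw [hmax]; exact Ideal.mem_map_of_mem _ hr
  have hx : x ∈ P := by rw [hP]; exact Ideal.subset_span (by simp)
  have ha : a ∈ P := by rw [hP]; exact Ideal.subset_span (by simp)
  have hb : b ∈ P := by rw [hP]; exact Ideal.subset_span (by simp)
  have hmin : maximalIdeal (Localization.AtPrime P) ∈
      (Ideal.span {φ (x + b), φ (a + b ^ 2)}).minimalPrimes := by
    refine ⟨⟨inferInstance, ?_⟩, ?_⟩
    · rw [Ideal.span_le]
      rintro _ (rfl | rfl)
      · exact hmem _ (add_mem hx hb)
      · exact hmem _ (add_mem ha (Ideal.pow_mem_of_mem _ hb 2 two_pos))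
    · rintro q ⟨hq, hle⟩ -
      have hz : φ (x + b) ∈ q := hle (Ideal.subset_span (by simp))
      have hw : φ (a + b ^ 2) ∈ q := hle (Ideal.subset_span (by simp))
      have hb3 : φ b ^ 3 ∈ q := by
        have : φ b ^ 3 = φ (x + b) * φ (a + b ^ 2) := by
          rw [← map_pow, ← map_mul]
          congr 1
          rw [h1] at h2
          linear_combination -h2
        rw [this]
        exact Ideal.mul_mem_right _ _ hz
      have hb' : φ b ∈ q := hq.mem_of_pow_mem _ hb3
      have hx' : φ x ∈ q := by
        have := q.sub_mem hz hb'
        rwa [← map_sub, add_sub_cancel_right] at this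
      have ha' : φ a ∈ q := by
        have := q.sub_mem hw (Ideal.pow_mem_of_mem _ hb' 2 two_pos)
        rwa [← map_pow, ← map_sub, add_sub_cancel_right] at this
      have hy' : φ y ∈ q := by
        rw [h1, map_add, map_mul]
        exact q.add_mem ha' (q.mul_mem_left _ hx')
      rw [hmax, Ideal.map_le_iff_le_comap]
      refine hP.trans_le (Ideal.span_le.2 ?_)
      rintro _ (rfl | rfl | rfl | rfl) <;> assumption
  have hht := Ideal.height_le_card_of_mem_minimalPrimes_span (Set.toFinite _) hmin
  rw [← maximalIdeal_height_eq_ringKrullDim]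
  have h3 : ({φ (x + b), φ (a + b ^ 2)} : Set (Localization.AtPrime P)).ncard ≤ 2 :=
    (Set.ncard_insert_le _ _).trans (by rw [Set.ncard_singleton])
  have h4 : (maximalIdeal (Localization.AtPrime P)).height ≤ 2 := hht.trans (by exact_mod_cast h3)
  exact (WithBot.coe_le_coe.2 h4 :)

end LocalRing

namespace QuiverGrassmannian

variable {V : Type u} [Quiver.{v} V] {X : QuiverRep V} {e : V → ℕ}
  (U : QuiverGrassmannian X e) (W : ∀ p, Submodule ℂ (X.space p))

/-- The restriction of a linear function to the chart. -/
def linearFunction (l : Module.Dual ℂ (U.ChartSpace W)) : U.coordinateRing W :=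
  ⟨fun z => l z.1, Algebra.subset_adjoin ⟨l, rfl⟩⟩

theorem linearFunction_mem_ker (l : Module.Dual ℂ (U.ChartSpace W)) :
    U.linearFunction W l ∈ RingHom.ker (U.evalCenter W) :=
  map_zero l

/-- If all linear functions are combinations of the given ones on the chart, then the given ones
generate the maximal ideal. -/
theorem ker_evalCenter_eq_span {ι : Type*} [Fintype ι] (l : ι → Module.Dual ℂ (U.ChartSpace W))
    (v : ι → U.ChartSpace W) (hl : ∀ f ∈ U.chart W, f = ∑ i, l i f • v i) :
    RingHom.ker (U.evalCenter W) = Ideal.span (Set.range fun i => U.linearFunction W (l i)) := by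
  refine le_antisymm ?_ (Ideal.span_le.2 (by
    rintro _ ⟨i, rfl⟩; exact U.linearFunction_mem_ker W (l i)))
  have key : ∀ (g : U.chart W → ℂ) (hg : g ∈ U.coordinateRing W),
      (⟨g, hg⟩ - algebraMap ℂ _ (g ⟨0, U.zero_mem_chart W⟩) : U.coordinateRing W) ∈
        Ideal.span (Set.range fun i => U.linearFunction W (l i)) := by
    intro g hg
    refine Algebra.adjoin_induction (p := fun g hg =>
      (⟨g, hg⟩ - algebraMap ℂ _ (g ⟨0, U.zero_mem_chart W⟩) : U.coordinateRing W) ∈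
        Ideal.span (Set.range fun i => U.linearFunction W (l i))) ?_ ?_ ?_ ?_ hg
    · rintro _ ⟨m, rfl⟩
      have : (⟨fun z => m z.1, Algebra.subset_adjoin ⟨m, rfl⟩⟩ -
          algebraMap ℂ _ (m 0) : U.coordinateRing W) =
          ∑ i, algebraMap ℂ _ (m (v i)) * U.linearFunction W (l i) := by
        ext z
        have h := congrArg m (hl z.1 z.2)
        rw [map_sum] at h
        simp only [map_smul, smul_eq_mul] at h
        simp only [map_zero, sub_zero, h, AddSubmonoidClass.coe_finsetSum, Finset.sum_apply]
        refine Finset.sum_congr rfl fun i _ => ?_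
        rw [mul_comm]
        rfl
      change (⟨fun z => m z.1, Algebra.subset_adjoin ⟨m, rfl⟩⟩ -
          algebraMap ℂ _ (m 0) : U.coordinateRing W) ∈ _
      rw [this]
      exact Ideal.sum_mem _ fun i _ => Ideal.mul_mem_left _ _ (Ideal.subset_span ⟨i, rfl⟩)
    · intro r
      convert Ideal.zero_mem _
      exact sub_self _
    · intro g h hg hh h1 h2
      have hsum : (⟨g + h, add_mem hg hh⟩ - algebraMap ℂ _ ((g + h) ⟨0, U.zero_mem_chart W⟩) :
          U.coordinateRing W) = (⟨g, hg⟩ - algebraMap ℂ _ (g ⟨0, U.zero_mem_chart W⟩)) +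
            (⟨h, hh⟩ - algebraMap ℂ _ (h ⟨0, U.zero_mem_chart W⟩)) := by
        have : (⟨g + h, add_mem hg hh⟩ : U.coordinateRing W) = ⟨g, hg⟩ + ⟨h, hh⟩ := rfl
        rw [Pi.add_apply, map_add, this]
        ring
      rw [hsum]
      exact Ideal.add_mem _ h1 h2
    · intro g h hg hh h1 h2
      have : (⟨g * h, mul_mem hg hh⟩ - algebraMap ℂ _ ((g * h) ⟨0, U.zero_mem_chart W⟩) :
          U.coordinateRing W) = ⟨h, hh⟩ * (⟨g, hg⟩ - algebraMap ℂ _ (g ⟨0, U.zero_mem_chart W⟩)) +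
          algebraMap ℂ _ (g ⟨0, U.zero_mem_chart W⟩) *
            (⟨h, hh⟩ - algebraMap ℂ _ (h ⟨0, U.zero_mem_chart W⟩)) := by
        rw [Pi.mul_apply, map_mul]
        have : (⟨g * h, mul_mem hg hh⟩ : U.coordinateRing W) = ⟨g, hg⟩ * ⟨h, hh⟩ := rfl
        rw [this]
        ring
      rw [this]
      exact Ideal.add_mem _ (Ideal.mul_mem_left _ _ h1) (Ideal.mul_mem_left _ _ h2)
  intro g hg
  have h := key g.1 g.2
  have h0 : g.1 ⟨0, U.zero_mem_chart W⟩ = 0 := hg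
  rwa [h0, map_zero, sub_zero] at h

/-- The regular functions are polynomial along a line; differentiability suffices to differentiate
them at the centre. -/
theorem differentiable_comp_line {v : U.ChartSpace W} (hv : ∀ t : ℂ, t • v ∈ U.chart W)
    (g : U.coordinateRing W) : Differentiable ℂ fun t : ℂ => g.1 ⟨t • v, hv t⟩ := by
  refine Algebra.adjoin_induction (p := fun g _ => Differentiable ℂ fun t : ℂ => g ⟨t • v, hv t⟩)
    ?_ ?_ ?_ ?_ g.2
  · rintro _ ⟨m, rfl⟩
    simp only [map_smul, smul_eq_mul]
    fun_prop
  · intro r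
    exact differentiable_const r
  · intro g h _ _ hg hh
    exact hg.add hh
  · intro g h _ _ hg hh
    exact hg.mul hh

/-- Linearly independent lines in the chart through its centre bound the number of generators of
the maximal ideal of the local ring. -/
theorem card_le_spanFinrank {ι : Type*} [Fintype ι] [DecidableEq ι]
    (l : ι → Module.Dual ℂ (U.ChartSpace W)) (v : ι → U.ChartSpace W)
    (hv : ∀ i (t : ℂ), t • v i ∈ U.chart W)
    (hl : ∀ j i, l j (v i) = (Pi.single j 1 : ι → ℂ) i)
    (hfg : (IsLocalRing.maximalIdeal (U.localRing W)).FG) :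
    Fintype.card ι ≤ (IsLocalRing.maximalIdeal (U.localRing W)).spanFinrank := by
  refine card_le_spanFinrank_maximalIdeal (P := RingHom.ker (U.evalCenter W))
    (U.evalCenter W) (fun r => Iff.rfl)
    (fun g i => deriv (fun t : ℂ => g.1 ⟨t • v i, hv i t⟩) 0) ?_ ?_
    (fun j => U.linearFunction W (l j)) (fun j => U.linearFunction_mem_ker W _) ?_ hfg
  · exact fun g h => funext fun i => deriv_add (U.differentiable_comp_line W (hv i) g 0)
      (U.differentiable_comp_line W (hv i) h 0)
  · intro g h
    funext i
    have h1 := deriv_mul (U.differentiable_comp_line W (hv i) g 0)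
        (U.differentiable_comp_line W (hv i) h 0)
    have h0 : (⟨(0 : ℂ) • v i, hv i 0⟩ : U.chart W) = ⟨0, U.zero_mem_chart W⟩ :=
      Subtype.ext (zero_smul _ _)
    rw [h0] at h1
    exact h1.trans ((add_comm _ _).trans (congrArg₂ (· + ·) rfl (mul_comm _ _)))
  · intro j
    funext i
    rw [← hl j i]
    have : (fun t : ℂ => (U.linearFunction W (l j)).1 ⟨t • v i, hv i t⟩) = fun t => t * l j (v i) :=
      funext fun t => map_smul (l j) t (v i)
    rw [this]
    simp

/-- A point of a chart is singular if the chart is given by the equations `y = a + b x` and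
`a x + b y = 0` in an affine space with coordinates `x`, `y`, `a`, `b`: the local ring has dimension
at most `2`, but the chart contains three linearly independent lines through the point. -/
theorem not_isRegularLocalRing {x y a b : Module.Dual ℂ (U.ChartSpace W)}
    {vx vy va vb : U.ChartSpace W}
    (hf : ∀ f ∈ U.chart W, f = x f • vx + y f • vy + a f • va + b f • vb ∧
      y f = a f + b f * x f ∧ a f * x f + b f * y f = 0)
    (hx : ∀ t : ℂ, t • vx ∈ U.chart W) (ha : ∀ t : ℂ, t • (va + vy) ∈ U.chart W)
    (hb : ∀ t : ℂ, t • vb ∈ U.chart W)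
    (hdual : x vx = 1 ∧ x (va + vy) = 0 ∧ x vb = 0 ∧ a vx = 0 ∧ a (va + vy) = 1 ∧ a vb = 0 ∧
      b vx = 0 ∧ b (va + vy) = 0 ∧ b vb = 1) :
    ¬ IsRegularLocalRing (U.localRing W) := by
  intro hreg
  have hspan : RingHom.ker (U.evalCenter W) = Ideal.span {U.linearFunction W x,
      U.linearFunction W y, U.linearFunction W a, U.linearFunction W b} := by
    rw [U.ker_evalCenter_eq_span W ![x, y, a, b] ![vx, vy, va, vb] fun f h => by
      simpa [Fin.sum_univ_succ, add_assoc] using (hf f h).1]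
    congr 1
    ext g
    simp [Fin.exists_fin_succ, eq_comm]
  have : IsNoetherianRing (U.localRing W) := hreg.toIsNoetherian
  have hdim := ringKrullDim_atPrime_le_two (P := RingHom.ker (U.evalCenter W)) hspan
    (Subtype.ext (funext fun z => (hf z.1 z.2).2.1)) (Subtype.ext (funext fun z => (hf z.1 z.2).2.2))
  have hrank := hreg.spanFinrank_maximalIdeal
  rw [← hrank] at hdim
  have hcard := U.card_le_spanFinrank W ![x, a, b] ![vx, va + vy, vb]
    (by
      intro i
      fin_cases i
      exacts [hx, ha, hb])
    (by
      obtain ⟨h1, h2, h3, h4, h5, h6, h7, h8, h9⟩ := hdual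
      intro j i
      fin_cases j <;> fin_cases i <;> simpa [-map_add])
    (IsNoetherian.noetherian _)
  rw [Fintype.card_fin] at hcard
  have h3 : (3 : WithBot ℕ∞) ≤ 2 := le_trans (by exact_mod_cast hcard) hdim
  exact absurd h3 (by decide)

end QuiverGrassmannian

/-! ### A singular quiver Grassmannian -/

namespace GraphRep

open Ladder

section Flag

variable {V : Type*} (S : Set V) (D : V → Type*) [∀ p, AddCommGroup (D p)] [∀ p, Module ℂ (D p)]

open scoped Classical in
/-- The number of coordinates at `p` of the subrepresentation at which the quiver Grassmannian of
`T_3` is singular. -/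
noncomputable def level (p : V) : ℕ := if p ∈ S then 1 else 2

/-- The subspace spanned by the first `level S p` coordinates. -/
noncomputable def lowerPart (p : V) : Submodule ℂ (Fin 3 → D p) :=
  ⨅ n, ⨅ _ : level S p ≤ n, LinearMap.ker (coord 3 n)

/-- The subspace spanned by the remaining coordinates. -/
noncomputable def upperPart (p : V) : Submodule ℂ (Fin 3 → D p) :=
  ⨅ n, ⨅ _ : n < level S p, LinearMap.ker (coord 3 n)

variable {S D}

theorem level_of_mem {p : V} (h : p ∈ S) : level S p = 1 := if_pos h

theorem level_of_notMem {p : V} (h : p ∉ S) : level S p = 2 := if_neg h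

theorem mem_lowerPart {p : V} {z : Fin 3 → D p} :
    z ∈ lowerPart S D p ↔ ∀ n, level S p ≤ n → coord 3 n z = 0 := by
  simp [lowerPart]

theorem mem_upperPart {p : V} {z : Fin 3 → D p} :
    z ∈ upperPart S D p ↔ ∀ n, n < level S p → coord 3 n z = 0 := by
  simp [upperPart]

variable (S D) in
/-- The projection to the first coordinates. -/
noncomputable def lowerProj (p : V) : (Fin 3 → D p) →ₗ[ℂ] lowerPart S D p :=
  LinearMap.codRestrict _ (build 3 fun n => if n < level S p then coord 3 n else 0) fun z => by
    rw [mem_lowerPart]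
    intro n hn
    rw [coord_build, if_neg (not_lt.2 hn)]
    simp

theorem coord_lowerProj {p : V} {n : ℕ} (z : Fin 3 → D p) :
    coord 3 n (lowerProj S D p z).1 = if n < level S p then coord 3 n z else 0 := by
  simp only [lowerProj, LinearMap.codRestrict_apply, coord_build]
  split_ifs with h1 h2
  · rfl
  · rfl
  · rw [coord_apply_of_le (by omega)]
  · rfl

theorem lowerProj_of_mem {p : V} (u : lowerPart S D p) : lowerProj S D p u.1 = u :=
  Subtype.ext (ext_coord fun n => by
    rw [coord_lowerProj]
    split_ifs with h
    · rfl
    · rw [mem_lowerPart.1 u.2 n (not_lt.1 h)])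

theorem isCompl_parts (p : V) : IsCompl (lowerPart S D p) (upperPart S D p) := by
  refine ⟨Submodule.disjoint_def.2 fun z h1 h2 => ext_coord fun n => ?_,
    codisjoint_iff_le_sup.2 fun z _ => Submodule.mem_sup.2
      ⟨_, (lowerProj S D p z).2, z - (lowerProj S D p z).1, ?_, by abel⟩⟩
  · rcases lt_or_ge n (level S p) with h | h
    · rw [mem_upperPart.1 h2 n h, map_zero]
    · rw [mem_lowerPart.1 h1 n h, map_zero]
  · rw [mem_upperPart]
    intro n hn
    rw [map_sub, coord_lowerProj, if_pos hn, sub_self]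

variable (S D) in
/-- The affine space of the chart. -/
abbrev FlagChart := ∀ p, lowerPart S D p →ₗ[ℂ] upperPart S D p

/-- The block entries of a point of the chart. -/
noncomputable def entry (i j : ℕ) (p : V) : FlagChart S D →ₗ[ℂ] D p →ₗ[ℂ] D p where
  toFun f := coord 3 j ∘ₗ (upperPart S D p).subtype ∘ₗ f p ∘ₗ lowerProj S D p ∘ₗ inj 3 i
  map_add' f g := by ext x; simp
  map_smul' c f := by ext x; simp

theorem coord_apply_lowerProj (f : FlagChart S D) (p : V) (z : Fin 3 → D p) (j : ℕ) :
    coord 3 j (f p (lowerProj S D p z)).1 =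
      entry 0 j p f (coord 3 0 z) + entry 1 j p f (coord 3 1 z) + entry 2 j p f (coord 3 2 z) := by
  have h := sum_inj_coord z
  rw [Finset.sum_range_succ, Finset.sum_range_succ, Finset.sum_range_succ, Finset.sum_range_zero,
    zero_add] at h
  conv_lhs => rw [← h]
  simp only [map_add, Submodule.coe_add]
  rfl

theorem entry_of_le {i j : ℕ} {p : V} (h : level S p ≤ i) (f : FlagChart S D) :
    entry i j p f = 0 := by
  ext x
  have : lowerProj S D p (inj 3 i x) = 0 := Subtype.ext (ext_coord fun n => by
    rw [coord_lowerProj, coord_inj]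
    split_ifs with h1 h2
    · omega
    all_goals simp)
  simp [entry, this]

/-- The graph of a point of the chart. -/
noncomputable def flagGraph (f : FlagChart S D) (p : V) : Submodule ℂ (Fin 3 → D p) :=
  LinearMap.range ((lowerPart S D p).subtype + (upperPart S D p).subtype ∘ₗ f p)

theorem mem_flagGraph {f : FlagChart S D} {p : V} {z : Fin 3 → D p} :
    z ∈ flagGraph f p ↔ ∀ j, level S p ≤ j → coord 3 j z =
      entry 0 j p f (coord 3 0 z) + entry 1 j p f (coord 3 1 z) + entry 2 j p f (coord 3 2 z) := by
  constructor
  · rintro ⟨u, rfl⟩ j hj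
    rw [← coord_apply_lowerProj]
    have hu : lowerProj S D p (((lowerPart S D p).subtype +
        (upperPart S D p).subtype ∘ₗ f p) u) = u := Subtype.ext (ext_coord fun n => by
      rw [coord_lowerProj]
      split_ifs with h
      · simp [mem_upperPart.1 (f p u).2 n h]
      · rw [mem_lowerPart.1 u.2 n (not_lt.1 h)])
    rw [hu]
    simp [mem_lowerPart.1 u.2 j hj]
  · intro h
    refine ⟨lowerProj S D p z, ext_coord fun n => ?_⟩
    simp only [LinearMap.add_apply, map_add, LinearMap.comp_apply, Submodule.subtype_apply,
      coord_lowerProj]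
    split_ifs with hn
    · rw [mem_upperPart.1 (f p _).2 n hn, add_zero]
    · rw [coord_apply_lowerProj, ← h n (not_lt.1 hn), zero_add]

theorem mem_flagGraph_of_mem {f : FlagChart S D} {p : V} (hp : p ∈ S) {z : Fin 3 → D p} :
    z ∈ flagGraph f p ↔ coord 3 1 z = entry 0 1 p f (coord 3 0 z) ∧
      coord 3 2 z = entry 0 2 p f (coord 3 0 z) := by
  rw [mem_flagGraph]
  have h1 : ∀ j, entry 1 j p f = 0 := fun j => entry_of_le (by rw [level_of_mem hp]) f
  have h2 : ∀ j, entry 2 j p f = 0 := fun j => entry_of_le (by rw [level_of_mem hp]; omega) f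
  simp only [h1, h2, LinearMap.zero_apply, add_zero, level_of_mem hp]
  refine ⟨fun h => ⟨h 1 le_rfl, h 2 (by omega)⟩, fun h j hj => ?_⟩
  obtain rfl | rfl | hj : j = 1 ∨ j = 2 ∨ 3 ≤ j := by omega
  · exact h.1
  · exact h.2
  · rw [coord_apply_of_le hj]
    simp [entry, coord_of_le hj]

theorem mem_flagGraph_of_notMem {f : FlagChart S D} {p : V} (hp : p ∉ S) {z : Fin 3 → D p} :
    z ∈ flagGraph f p ↔
      coord 3 2 z = entry 0 2 p f (coord 3 0 z) + entry 1 2 p f (coord 3 1 z) := by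
  rw [mem_flagGraph]
  have h2 : ∀ j, entry 2 j p f = 0 := fun j => entry_of_le (by rw [level_of_notMem hp]) f
  simp only [h2, LinearMap.zero_apply, add_zero, level_of_notMem hp]
  refine ⟨fun h => h 2 le_rfl, fun h j hj => ?_⟩
  obtain rfl | hj : j = 2 ∨ 3 ≤ j := by omega
  · exact h
  · rw [coord_apply_of_le hj]
    simp [entry, coord_of_le hj]

theorem flagChart_ext {f g : FlagChart S D} (h1 : ∀ p ∈ S, entry 0 1 p f = entry 0 1 p g)
    (h2 : ∀ p, entry 0 2 p f = entry 0 2 p g) (h3 : ∀ p ∉ S, entry 1 2 p f = entry 1 2 p g) :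
    f = g := by
  funext p
  refine LinearMap.ext fun u => Subtype.ext (ext_coord fun j => ?_)
  rw [← lowerProj_of_mem u, coord_apply_lowerProj, coord_apply_lowerProj]
  by_cases hj3 : 3 ≤ j
  · simp [entry, coord_of_le hj3]
  by_cases hj : j < level S p
  · rw [← coord_apply_lowerProj, ← coord_apply_lowerProj, mem_upperPart.1 (f p _).2 j hj,
      mem_upperPart.1 (g p _).2 j hj]
  by_cases hp : p ∈ S
  · rw [level_of_mem hp] at hj
    have hl : level S p = 1 := level_of_mem hp
    simp only [entry_of_le (i := 1) hl.le, entry_of_le (i := 2) (hl.trans_le one_le_two)]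
    obtain rfl | rfl : j = 1 ∨ j = 2 := by omega
    · rw [h1 p hp]
    · rw [h2 p]
  · rw [level_of_notMem hp] at hj
    have hl : level S p = 2 := level_of_notMem hp
    simp only [entry_of_le (i := 2) hl.le]
    obtain rfl : j = 2 := by omega
    rw [h2 p, h3 p hp]

open scoped Classical in
variable (S D) in
/-- The point of the chart whose block entries are the scalars `x`, `y` on `S` and the scalars
`a`, `b` outside `S`. -/
noncomputable def scalarPoint (x y a b : ℂ) : FlagChart S D := fun p =>
  LinearMap.codRestrict _ ((if p ∈ S then inj 3 1 ∘ₗ (x • coord 3 0) + inj 3 2 ∘ₗ (y • coord 3 0)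
    else inj 3 2 ∘ₗ (a • coord 3 0 + b • coord 3 1)) ∘ₗ (lowerPart S D p).subtype) fun u => by
      rw [mem_upperPart]
      intro n hn
      by_cases hp : p ∈ S
      · rw [level_of_mem hp] at hn
        simp [if_pos hp, coord_inj, show n ≠ 1 by omega, show n ≠ 2 by omega]
      · rw [level_of_notMem hp] at hn
        simp [if_neg hp, coord_inj, show n ≠ 2 by omega]

theorem scalarPoint_apply_of_mem {p : V} (hp : p ∈ S) (x y a b : ℂ) (u : lowerPart S D p) :
    (scalarPoint S D x y a b p u).1 =
      inj 3 1 (x • coord 3 0 u.1) + inj 3 2 (y • coord 3 0 u.1) := by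
  rw [scalarPoint, LinearMap.codRestrict_apply, LinearMap.comp_apply, if_pos hp]
  rfl

theorem scalarPoint_apply_of_notMem {p : V} (hp : p ∉ S) (x y a b : ℂ) (u : lowerPart S D p) :
    (scalarPoint S D x y a b p u).1 = inj 3 2 (a • coord 3 0 u.1 + b • coord 3 1 u.1) := by
  rw [scalarPoint, LinearMap.codRestrict_apply, LinearMap.comp_apply, if_neg hp]
  rfl

theorem entry_apply (i j : ℕ) (p : V) (f : FlagChart S D) (d : D p) :
    entry i j p f d = coord 3 j (f p (lowerProj S D p (inj 3 i d))).1 := rfl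

theorem entry_scalarPoint_of_mem {p : V} (hp : p ∈ S) (x y a b : ℂ) :
    entry 0 1 p (scalarPoint S D x y a b) = x • LinearMap.id ∧
      entry 0 2 p (scalarPoint S D x y a b) = y • LinearMap.id := by
  constructor <;> refine LinearMap.ext fun d => ?_ <;>
    rw [entry_apply, scalarPoint_apply_of_mem hp, coord_lowerProj, level_of_mem hp, coord_inj,
      map_add, coord_inj, coord_inj] <;> simp

theorem entry_scalarPoint_of_notMem {p : V} (hp : p ∉ S) (x y a b : ℂ) :
    entry 0 2 p (scalarPoint S D x y a b) = a • LinearMap.id ∧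
      entry 1 2 p (scalarPoint S D x y a b) = b • LinearMap.id := by
  constructor <;> refine LinearMap.ext fun d => ?_ <;>
    rw [entry_apply, scalarPoint_apply_of_notMem hp, coord_lowerProj, coord_lowerProj,
      level_of_notMem hp, coord_inj, coord_inj, coord_inj] <;> simp

theorem eq_scalarPoint {f : FlagChart S D} {x y a b : ℂ}
    (h1 : ∀ p ∈ S, entry 0 1 p f = x • LinearMap.id ∧ entry 0 2 p f = y • LinearMap.id)
    (h2 : ∀ p ∉ S, entry 0 2 p f = a • LinearMap.id ∧ entry 1 2 p f = b • LinearMap.id) :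
    f = scalarPoint S D x y a b := by
  refine flagChart_ext (fun p hp => ?_) (fun p => ?_) fun p hp => ?_
  · rw [(h1 p hp).1, (entry_scalarPoint_of_mem hp x y a b).1]
  · by_cases hp : p ∈ S
    · rw [(h1 p hp).2, (entry_scalarPoint_of_mem hp x y a b).2]
    · rw [(h2 p hp).1, (entry_scalarPoint_of_notMem hp x y a b).1]
  · rw [(h2 p hp).2, (entry_scalarPoint_of_notMem hp x y a b).2]

theorem smul_scalarPoint (t x y a b : ℂ) :
    t • scalarPoint S D x y a b = scalarPoint S D (t * x) (t * y) (t * a) (t * b) := by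
  refine eq_scalarPoint (fun p hp => ?_) fun p hp => ?_
  · simp only [map_smul, (entry_scalarPoint_of_mem hp x y a b).1,
      (entry_scalarPoint_of_mem hp x y a b).2, smul_smul, and_self]
  · simp only [map_smul, (entry_scalarPoint_of_notMem hp x y a b).1,
      (entry_scalarPoint_of_notMem hp x y a b).2, smul_smul, and_self]

theorem scalarPoint_add (x y a b x' y' a' b' : ℂ) :
    scalarPoint S D x y a b + scalarPoint S D x' y' a' b' =
      scalarPoint S D (x + x') (y + y') (a + a') (b + b') := by
  refine eq_scalarPoint (fun p hp => ?_) fun p hp => ?_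
  · simp only [map_add, (entry_scalarPoint_of_mem hp _ _ _ _).1,
      (entry_scalarPoint_of_mem hp _ _ _ _).2, add_smul, and_self]
  · simp only [map_add, (entry_scalarPoint_of_notMem hp _ _ _ _).1,
      (entry_scalarPoint_of_notMem hp _ _ _ _).2, add_smul, and_self]

end Flag

section Chart

variable {V E : Type*} {s t : E → V} {D : V → Type*} [∀ p, AddCommGroup (D p)]
  [∀ p, Module ℂ (D p)] {ξ η : C1 s t D D} {S : Set V}

/-- The graph of a point of the chart is a subrepresentation of `T_3` if and only if its block
entries are scalars that satisfy two equations: the arrows inside `S` and inside its complement say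
that the entries are endomorphisms of the two bricks, and each arrow from `S` to the complement
gives a linear relation between `ξ` and `η`. -/
theorem IsBrickExtension.flagGraph_stable_iff (hE : IsBrickExtension ξ η S) (f : FlagChart S D) :
    (∀ e, ∀ z ∈ flagGraph f (s e), truncRep 3 ξ η e z ∈ flagGraph f (t e)) ↔
      ∃ x y a b : ℂ, f = scalarPoint S D x y a b ∧ y = a + b * x ∧ a * x + b * y = 0 := by
  have hc : ∀ (e) (z : Fin 3 → D (s e)), coord 3 0 (truncRep 3 ξ η e z) =
      ξ e (coord 3 0 z) + η e (coord 3 1 z) ∧ coord 3 1 (truncRep 3 ξ η e z) =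
      ξ e (coord 3 1 z) + η e (coord 3 2 z) ∧ coord 3 2 (truncRep 3 ξ η e z) =
      ξ e (coord 3 2 z) := fun e z => by
    simp [truncRep, coord_apply_of_le (le_refl 3)]
  constructor
  · intro hf
    have hz : ∀ p (d d' d'' : D p), ∃ z : Fin 3 → D p,
        coord 3 0 z = d ∧ coord 3 1 z = d' ∧ coord 3 2 z = d'' := fun p d d' d'' =>
      ⟨inj 3 0 d + inj 3 1 d' + inj 3 2 d'', by simp [coord_inj]⟩
    have hleft : ∀ e, t e ∈ S → ∀ d, entry 0 1 (t e) f (ξ e d) = ξ e (entry 0 1 (s e) f d) ∧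
        entry 0 2 (t e) f (ξ e d) = ξ e (entry 0 2 (s e) f d) := by
      intro e he d
      have hes := hE.mem_of_mem e he
      have hη := hE.eq_zero_left e he
      obtain ⟨z, h0, h1, h2⟩ := hz (s e) d (entry 0 1 (s e) f d) (entry 0 2 (s e) f d)
      have h := (mem_flagGraph_of_mem he).1
        (hf e z ((mem_flagGraph_of_mem hes).2 (by rw [h0, h1, h2]; exact ⟨rfl, rfl⟩)))
      obtain ⟨c0, c1, c2⟩ := hc e z
      rw [c0, c1, c2, h0, h1, h2, hη] at h
      simp only [LinearMap.zero_apply, add_zero] at h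
      exact ⟨h.1.symm, h.2.symm⟩
    have hright : ∀ e, s e ∉ S → ∀ d, entry 0 2 (t e) f (ξ e d) = ξ e (entry 0 2 (s e) f d) ∧
        entry 1 2 (t e) f (ξ e d) = ξ e (entry 1 2 (s e) f d) := by
      intro e he d
      have het : t e ∉ S := fun h => he (hE.mem_of_mem e h)
      have hη := hE.eq_zero_right e he
      constructor
      · obtain ⟨z, h0, h1, h2⟩ := hz (s e) d 0 (entry 0 2 (s e) f d)
        have h := (mem_flagGraph_of_notMem het).1
          (hf e z ((mem_flagGraph_of_notMem he).2 (by rw [h0, h1, h2]; simp)))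
        obtain ⟨c0, c1, c2⟩ := hc e z
        rw [c0, c1, c2, h0, h1, h2, hη] at h
        simpa using h.symm
      · obtain ⟨z, h0, h1, h2⟩ := hz (s e) 0 d (entry 1 2 (s e) f d)
        have h := (mem_flagGraph_of_notMem het).1
          (hf e z ((mem_flagGraph_of_notMem he).2 (by rw [h0, h1, h2]; simp)))
        obtain ⟨c0, c1, c2⟩ := hc e z
        rw [c0, c1, c2, h0, h1, h2, hη] at h
        simpa using h.symm
    obtain ⟨x, hx⟩ := hE.brick_left (fun p => entry 0 1 p f) fun e he =>
      LinearMap.ext fun d => (hleft e he d).1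
    obtain ⟨y, hy⟩ := hE.brick_left (fun p => entry 0 2 p f) fun e he =>
      LinearMap.ext fun d => (hleft e he d).2
    obtain ⟨a, ha⟩ := hE.brick_right (fun p => entry 0 2 p f) fun e he =>
      LinearMap.ext fun d => (hright e he d).1
    obtain ⟨b, hb⟩ := hE.brick_right (fun p => entry 1 2 p f) fun e he =>
      LinearMap.ext fun d => (hright e he d).2
    obtain ⟨h1, h2⟩ := hE.indep (y - a - b * x) (-(a * x + b * y)) fun e hes het => by
      ext d
      obtain ⟨z, h0, h1, h2⟩ := hz (s e) d (x • d) (y • d)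
      have h := (mem_flagGraph_of_notMem het).1
        (hf e z ((mem_flagGraph_of_mem hes).2 (by rw [h0, h1, h2, hx _ hes, hy _ hes]; simp)))
      obtain ⟨c0, c1, c2⟩ := hc e z
      rw [c0, c1, c2, h0, h1, h2, ha _ het, hb _ het] at h
      simp only [map_smul, LinearMap.smul_apply, LinearMap.id_apply] at h
      simp only [LinearMap.add_apply, LinearMap.smul_apply, LinearMap.zero_apply]
      rw [← sub_eq_zero] at h
      rw [← h]
      module
    exact ⟨x, y, a, b, eq_scalarPoint (fun p hp => ⟨hx p hp, hy p hp⟩)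
      (fun p hp => ⟨ha p hp, hb p hp⟩), by linear_combination h1, by linear_combination -h2⟩
  · rintro ⟨x, y, a, b, rfl, h1, h2⟩ e z hz
    obtain ⟨c0, c1, c2⟩ := hc e z
    by_cases het : t e ∈ S
    · have hes := hE.mem_of_mem e het
      rw [mem_flagGraph_of_mem hes, (entry_scalarPoint_of_mem hes x y a b).1,
        (entry_scalarPoint_of_mem hes x y a b).2] at hz
      rw [mem_flagGraph_of_mem het, (entry_scalarPoint_of_mem het x y a b).1,
        (entry_scalarPoint_of_mem het x y a b).2, c0, c1, c2, hE.eq_zero_left e het, hz.1, hz.2]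
      simp
    rw [mem_flagGraph_of_notMem het, (entry_scalarPoint_of_notMem het x y a b).1,
        (entry_scalarPoint_of_notMem het x y a b).2, c0, c1, c2]
    by_cases hes : s e ∈ S
    · rw [mem_flagGraph_of_mem hes, (entry_scalarPoint_of_mem hes x y a b).1,
        (entry_scalarPoint_of_mem hes x y a b).2] at hz
      rw [hz.1, hz.2]
      simp only [LinearMap.smul_apply, LinearMap.id_apply, map_smul]
      rw [← sub_eq_zero]
      have : y • ξ e (coord 3 0 z) - (a • (ξ e (coord 3 0 z) + x • η e (coord 3 0 z)) +
          b • (x • ξ e (coord 3 0 z) + y • η e (coord 3 0 z))) =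
          (y - (a + b * x)) • ξ e (coord 3 0 z) - (a * x + b * y) • η e (coord 3 0 z) := by
        module
      rw [this, h2, ← h1]
      simp
    · rw [mem_flagGraph_of_notMem hes, (entry_scalarPoint_of_notMem hes x y a b).1,
        (entry_scalarPoint_of_notMem hes x y a b).2] at hz
      rw [hz, hE.eq_zero_right e hes]
      simp

end Chart

end GraphRep

section Singular

open GraphRep Ladder QuiverRep

variable {V : Type u} [Quiver.{v} V] {D : V → Type} [∀ p, AddCommGroup (D p)]
  [∀ p, Module ℂ (D p)] [∀ p, FiniteDimensional ℂ (D p)]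
  {ξ η : C1 arrowSource arrowTarget D D} {S : Set V}

theorem QuiverRep.linMap_mk {D : V → Type} [∀ p, AddCommGroup (D p)] [∀ p, Module ℂ (D p)]
    [∀ p, FiniteDimensional ℂ (D p)] (τ : C1 arrowSource arrowTarget D D) {p q : V} (a : p ⟶ q) :
    (mk D τ).linMap a = τ ⟨p, q, a⟩ := congrFun (mk_maps D τ) ⟨p, q, a⟩

/-- The singular point of the quiver Grassmannian of `T_3`. -/
noncomputable def singularPoint (hE : IsBrickExtension ξ η S) :
    QuiverGrassmannian (tubeRep ξ η 2) fun p => Module.finrank ℂ (lowerPart S D p) where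
  space := lowerPart S D
  isSubrep := by
    have h := (hE.flagGraph_stable_iff 0).2
      ⟨0, 0, 0, 0, (eq_scalarPoint (by simp) (by simp)), by simp⟩
    have h0 : flagGraph (0 : FlagChart S D) = lowerPart S D := by
      funext p
      simp [flagGraph]
    rw [h0] at h
    intro p q a x hx
    rw [linMap_mk]
    exact h ⟨p, q, a⟩ x hx
  finrank_eq _ := rfl

theorem mem_chart_singularPoint (hE : IsBrickExtension ξ η S) (f : FlagChart S D) :
    f ∈ (singularPoint hE).chart (upperPart S D) ↔
      ∃ x y a b : ℂ, f = scalarPoint S D x y a b ∧ y = a + b * x ∧ a * x + b * y = 0 := by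
  rw [← hE.flagGraph_stable_iff]
  refine ⟨fun h e z hz => ?_, fun h p q a z hz => ?_⟩
  · have := h e.1 e.2.1 e.2.2 z hz
    rwa [linMap_mk] at this
  · rw [linMap_mk]
    exact h ⟨p, q, a⟩ z hz

theorem GraphRep.IsBrickExtension.isSingular (hE : IsBrickExtension ξ η S) :
    IsSingularQuiverGrassmannian (tubeRep ξ η 2)
      fun p => Module.finrank ℂ (lowerPart S D p) := by
  refine ⟨singularPoint hE, upperPart S D, isCompl_parts, ?_⟩
  -- The scalars can be read off from one block entry.
  obtain ⟨p, hp, d, hd⟩ := hE.exists_left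
  obtain ⟨q, hq, d', hd'⟩ := hE.exists_right
  obtain ⟨φ, hφ⟩ := Module.Projective.exists_dual_ne_zero ℂ hd
  obtain ⟨ψ, hψ⟩ := Module.Projective.exists_dual_ne_zero ℂ hd'
  let read (i j : ℕ) (p : V) (φ : Module.Dual ℂ (D p)) (d : D p) : Module.Dual ℂ (FlagChart S D) :=
    (φ d)⁻¹ • φ ∘ₗ LinearMap.applyₗ d ∘ₗ entry i j p
  have hread : ∀ (i j : ℕ) (p : V) (φ : Module.Dual ℂ (D p)) (d : D p) (hd : φ d ≠ 0)
      (f : FlagChart S D) (c : ℂ), entry i j p f = c • LinearMap.id → read i j p φ d f = c := by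
    intro i j p φ d hd f c h
    simp only [read, LinearMap.smul_apply, LinearMap.comp_apply, LinearMap.applyₗ_apply_apply, h,
      LinearMap.id_apply, map_smul, smul_eq_mul]
    field_simp
  have hx : ∀ x y a b, read 0 1 p φ d (scalarPoint S D x y a b) = x := fun x y a b =>
    hread _ _ _ _ _ hφ _ _ (entry_scalarPoint_of_mem hp x y a b).1
  have hy : ∀ x y a b, read 0 2 p φ d (scalarPoint S D x y a b) = y := fun x y a b =>
    hread _ _ _ _ _ hφ _ _ (entry_scalarPoint_of_mem hp x y a b).2
  have ha : ∀ x y a b, read 0 2 q ψ d' (scalarPoint S D x y a b) = a := fun x y a b =>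
    hread _ _ _ _ _ hψ _ _ (entry_scalarPoint_of_notMem hq x y a b).1
  have hb : ∀ x y a b, read 1 2 q ψ d' (scalarPoint S D x y a b) = b := fun x y a b =>
    hread _ _ _ _ _ hψ _ _ (entry_scalarPoint_of_notMem hq x y a b).2
  have hsum : scalarPoint S D 0 0 1 0 + scalarPoint S D 0 1 0 0 = scalarPoint S D 0 1 1 0 := by
    rw [scalarPoint_add]; norm_num
  have hmem := mem_chart_singularPoint hE
  have key : ∀ f : FlagChart S D, (∃ x y a b : ℂ, f = scalarPoint S D x y a b ∧ y = a + b * x ∧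
      a * x + b * y = 0) → f = read 0 1 p φ d f • scalarPoint S D 1 0 0 0 +
        read 0 2 p φ d f • scalarPoint S D 0 1 0 0 + read 0 2 q ψ d' f • scalarPoint S D 0 0 1 0 +
        read 1 2 q ψ d' f • scalarPoint S D 0 0 0 1 ∧
      read 0 2 p φ d f = read 0 2 q ψ d' f + read 1 2 q ψ d' f * read 0 1 p φ d f ∧
      read 0 2 q ψ d' f * read 0 1 p φ d f + read 1 2 q ψ d' f * read 0 2 p φ d f = 0 := by
    rintro _ ⟨x, y, a, b, rfl, h1, h2⟩
    rw [hx, hy, ha, hb]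
    refine ⟨?_, h1, h2⟩
    simp only [smul_scalarPoint, scalarPoint_add]
    simp
  refine (singularPoint hE).not_isRegularLocalRing (upperPart S D)
    (x := read 0 1 p φ d) (y := read 0 2 p φ d) (a := read 0 2 q ψ d') (b := read 1 2 q ψ d')
    (vx := scalarPoint S D 1 0 0 0) (vy := scalarPoint S D 0 1 0 0)
    (va := scalarPoint S D 0 0 1 0) (vb := scalarPoint S D 0 0 0 1) ?_ ?_ ?_ ?_ ?_
  · exact fun f hf => key f ((hmem f).1 hf)
  · intro t
    exact (hmem _).2 ⟨_, _, _, _, smul_scalarPoint t 1 0 0 0, by simp⟩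
  · intro t
    refine (hmem _).2 ⟨t * 0, t * 1, t * 1, t * 0, ?_, by simp⟩
    rw [← smul_scalarPoint, ← hsum]
    rfl
  · intro t
    exact (hmem _).2 ⟨_, _, _, _, smul_scalarPoint t 0 0 0 1, by simp⟩
  · have h := hsum
    refine ⟨hx _ _ _ _, ?_, hx _ _ _ _, ha _ _ _ _, ?_, ha _ _ _ _, hb _ _ _ _, ?_, hb _ _ _ _⟩
    · exact (congrArg (read 0 1 p φ d) hsum).trans (hx _ _ _ _)
    · exact (congrArg (read 0 2 q ψ d') hsum).trans (ha _ _ _ _)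
    · exact (congrArg (read 1 2 q ψ d') hsum).trans (hb _ _ _ _)

end Singular

/-! ### From a homogeneous brick to a tube -/

namespace GraphRep

section HomogeneousBrick

variable {V E : Type*} {s t : E → V} {D : V → Type*} [∀ p, AddCommGroup (D p)]
  [∀ p, Module ℂ (D p)] [∀ p, FiniteDimensional ℂ (D p)] [Fintype V] [Fintype E]

/-- A brick `ξ` whose dimension vector is radical and which is isomorphic to its Auslander–Reiten
translate by means of `ζ`. -/
structure IsHomogeneousBrick (ξ : C1 s t D D) (ζ : C1 t s D D) : Prop where
  preprojective : IsPreprojective D ξ ζ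
  nondegenerate : IsNondegenerate ξ ζ
  radical : IsRadicalVector s t fun p => Module.finrank ℂ (D p)
  brick : ∀ c ∈ LinearMap.ker (coboundary ξ ξ), ∃ r : ℂ, ∀ p, c p = r • LinearMap.id

namespace IsHomogeneousBrick

variable {ξ : C1 s t D D} {ζ : C1 t s D D} (hB : IsHomogeneousBrick ξ ζ) {o : V}
  (ho : Module.finrank ℂ (D o) = 1)
include hB ho

omit [∀ p, FiniteDimensional ℂ (D p)] in
theorem sum_eq [DecidableEq V] : (∑ e, ((if s e = o then Module.finrank ℂ (D (t e)) else 0) +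
    if t e = o then Module.finrank ℂ (D (s e)) else 0)) = 2 := by
  have h := hB.radical fun p => if p = o then 1 else 0
  simp only [ite_mul, one_mul, zero_mul, mul_ite, mul_one, mul_zero, Finset.sum_ite_eq',
    Finset.mem_univ, if_true, ho] at h
  exact h

omit ho [∀ p, FiniteDimensional ℂ (D p)] in
theorem sum_mul_eq : ∑ e, Module.finrank ℂ (D (s e)) * Module.finrank ℂ (D (t e)) =
    ∑ p, Module.finrank ℂ (D p) * Module.finrank ℂ (D p) := by
  have h := hB.radical fun p => Module.finrank ℂ (D p)
  rw [Finset.sum_add_distrib] at h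
  dsimp only at h
  omega

/-- The endomorphisms of the restriction to the complement of a sink `o` are scalars. -/
theorem exists_smul_of_sink (hs : ∀ e, s e ≠ o) (c : C0 D D)
    (hc : ∀ e, t e ≠ o → c (t e) ∘ₗ ξ e = ξ e ∘ₗ c (s e)) :
    ∃ r : ℂ, ∀ p, p ≠ o → c p = r • LinearMap.id := by
  classical
  let K : ∀ p, Submodule ℂ (D p) := fun p => if p = o then ⊤ else ⊥
  have hKo : ∀ p, p = o → K p = ⊤ := fun p h => if_pos h
  have hK : ∀ p, p ≠ o → K p = ⊥ := fun p h => if_neg h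
  have hKξ : ∀ e, K (s e) ≤ (K (t e)).comap (ξ e) := fun e => by
    rw [hK _ (hs e)]; exact bot_le
  let m : C1 s t (fun p => D p ⧸ K p) fun p => D p ⧸ K p := fun e => Submodule.mapQ _ _ _ (hKξ e)
  -- There is no morphism from the restriction, regarded as a quotient, to `ξ`.
  have h0 : Module.finrank ℂ (LinearMap.ker (coboundary m ξ)) = 0 := by
    rw [Submodule.finrank_eq_zero, Submodule.eq_bot_iff]
    intro h hh
    rw [mem_ker_coboundary] at hh
    obtain ⟨r, hr⟩ := hB.brick (fun p => h p ∘ₗ (K p).mkQ) (mem_ker_coboundary.2 fun e => by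
      rw [← LinearMap.comp_assoc, ← hh e, LinearMap.comp_assoc, LinearMap.comp_assoc,
        Submodule.mapQ_mkQ])
    have hr0 : r = 0 := by
      have : Nontrivial (D o) := Module.nontrivial_of_finrank_pos (R := ℂ) (by omega)
      obtain ⟨x, hx⟩ := exists_ne (0 : D o)
      have h1 := LinearMap.congr_fun (hr o) x
      have h2 : (K o).mkQ x = 0 := by
        rw [Submodule.mkQ_apply, Submodule.Quotient.mk_eq_zero, hKo o rfl]; trivial
      rw [LinearMap.comp_apply, h2, map_zero, LinearMap.smul_apply, LinearMap.id_apply] at h1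
      exact (smul_eq_zero.1 h1.symm).resolve_right hx
    funext p
    refine Submodule.linearMap_qext _ ?_
    rw [hr p, hr0, zero_smul]
    rfl
  have hmd : ∀ p, Module.finrank ℂ (D p ⧸ K p) + (if p = o then 1 else 0) =
      Module.finrank ℂ (D p) := fun p => by
    rw [← Submodule.finrank_quotient_add_finrank (K p)]
    congr 1
    split_ifs with h
    · rw [hKo p h, finrank_top, h, ho]
    · rw [hK p h, finrank_bot]
  have h1 : Module.finrank ℂ (LinearMap.ker (coboundary ξ m)) = 1 := by
    have h2 : Module.finrank ℂ (LinearMap.ker (coboundary ξ m)) +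
        ∑ e, Module.finrank ℂ (D (s e)) * Module.finrank ℂ (D (t e) ⧸ K (t e)) =
        ∑ p, Module.finrank ℂ (D p) * Module.finrank ℂ (D p ⧸ K p) +
          Module.finrank ℂ (LinearMap.ker (coboundary m ξ)) := by
      rw [← finrank_C0 (T := fun p => D p ⧸ K p), ← finrank_C1 (T := fun p => D p ⧸ K p)]
      exact finrank_hom_eq hB.preprojective hB.nondegenerate hB.radical m
    rw [h0] at h2
    have h3 := hB.sum_eq ho
    simp only [if_neg (hs _), zero_add] at h3
    have h4 := hB.sum_mul_eq
    have h5 : ∑ e, Module.finrank ℂ (D (s e)) * Module.finrank ℂ (D (t e)) =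
        ∑ e, Module.finrank ℂ (D (s e)) * Module.finrank ℂ (D (t e) ⧸ K (t e)) + 2 := by
      rw [← h3, ← Finset.sum_add_distrib]
      refine Finset.sum_congr rfl fun e _ => ?_
      conv_lhs => rw [← hmd (t e), mul_add]
      simp
    have h6 : ∑ p, Module.finrank ℂ (D p) * Module.finrank ℂ (D p) =
        ∑ p, Module.finrank ℂ (D p) * Module.finrank ℂ (D p ⧸ K p) + 1 := by
      have : ∑ p, (if p = o then Module.finrank ℂ (D p) else 0) = 1 := by simp [ho]
      rw [← this, ← Finset.sum_add_distrib]
      refine Finset.sum_congr rfl fun p _ => ?_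
      conv_lhs => enter [2]; rw [← hmd p]
      conv_lhs => rw [mul_add]
      simp
    omega
  have hpr : (fun p => (K p).mkQ : C0 D fun p => D p ⧸ K p) ∈
      LinearMap.ker (coboundary ξ m) := mem_ker_coboundary.2 fun e => (Submodule.mapQ_mkQ ..).symm
  have hcK : ∀ p, K p ≤ (K p).comap (c p) := fun p => by
    by_cases h : p = o
    · rw [hKo p h]; exact le_top
    · rw [hK p h]; exact bot_le
  have hf : (fun p => (K p).mapQ _ (c p) (hcK p) ∘ₗ (K p).mkQ : C0 D fun p => D p ⧸ K p) ∈
      LinearMap.ker (coboundary ξ m) := mem_ker_coboundary.2 fun e => by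
    ext x
    by_cases h : t e = o
    · have : Subsingleton (D (t e) ⧸ K (t e)) := by
        rw [hKo _ h]; infer_instance
      exact Subsingleton.elim _ _
    · exact congrArg (K (t e)).mkQ (LinearMap.congr_fun (hc e h) x)
  by_cases hne : (⟨_, hpr⟩ : LinearMap.ker (coboundary ξ m)) = 0
  · refine ⟨0, fun p hp => ?_⟩
    have h2 := congrFun (congrArg Subtype.val hne) p
    ext x
    have h3 : (K p).mkQ x = 0 := LinearMap.congr_fun h2 x
    rw [Submodule.mkQ_apply, Submodule.Quotient.mk_eq_zero, hK p hp] at h3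
    rw [(Submodule.mem_bot ℂ).1 h3]
    simp
  · obtain ⟨r, hr⟩ := (finrank_eq_one_iff_of_nonzero' _ hne).1 h1 ⟨_, hf⟩
    refine ⟨r, fun p hp => ?_⟩
    have h2 := congrFun (congrArg Subtype.val hr) p
    ext x
    have h3 : r • (K p).mkQ x = (K p).mkQ (c p x) := LinearMap.congr_fun h2 x
    rw [← map_smul, Submodule.mkQ_apply, Submodule.mkQ_apply, Submodule.Quotient.eq, hK p hp,
      Submodule.mem_bot, sub_eq_zero] at h3
    exact h3.symm

/-- The endomorphisms of the restriction to the complement of a source `o` are scalars. -/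
theorem exists_smul_of_source (ht : ∀ e, t e ≠ o) (c : C0 D D)
    (hc : ∀ e, s e ≠ o → c (t e) ∘ₗ ξ e = ξ e ∘ₗ c (s e)) :
    ∃ r : ℂ, ∀ p, p ≠ o → c p = r • LinearMap.id := by
  classical
  let K : ∀ p, Submodule ℂ (D p) := fun p => if p = o then ⊥ else ⊤
  have hKo : ∀ p, p = o → K p = ⊥ := fun p h => if_pos h
  have hK : ∀ p, p ≠ o → K p = ⊤ := fun p h => if_neg h
  have hKξ : ∀ e, ∀ x ∈ K (s e), ξ e x ∈ K (t e) := fun e x _ => by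
    rw [hK _ (ht e)]; trivial
  let m : C1 s t (fun p => K p) fun p => K p := fun e => (ξ e).restrict (hKξ e)
  -- There is no morphism from `ξ` to the restriction, regarded as a subrepresentation.
  have h0 : Module.finrank ℂ (LinearMap.ker (coboundary ξ m)) = 0 := by
    rw [Submodule.finrank_eq_zero, Submodule.eq_bot_iff]
    intro h hh
    rw [mem_ker_coboundary] at hh
    obtain ⟨r, hr⟩ := hB.brick (fun p => (K p).subtype ∘ₗ h p) (mem_ker_coboundary.2 fun e => by
      rw [LinearMap.comp_assoc, hh e]
      rfl)
    have hr0 : r = 0 := by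
      have : Nontrivial (D o) := Module.nontrivial_of_finrank_pos (R := ℂ) (by omega)
      obtain ⟨x, hx⟩ := exists_ne (0 : D o)
      have h1 := LinearMap.congr_fun (hr o) x
      have h2 : (h o x : D o) = 0 := (Submodule.mem_bot ℂ).1 ((hKo o rfl).le (h o x).2)
      rw [LinearMap.comp_apply, Submodule.subtype_apply, h2, LinearMap.smul_apply,
        LinearMap.id_apply] at h1
      exact (smul_eq_zero.1 h1.symm).resolve_right hx
    funext p
    refine LinearMap.ext fun x => Subtype.ext ?_
    have := LinearMap.congr_fun (hr p) x
    rw [hr0, zero_smul] at this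
    exact this
  have hmd : ∀ p, Module.finrank ℂ (K p) + (if p = o then 1 else 0) =
      Module.finrank ℂ (D p) := fun p => by
    split_ifs with h
    · rw [hKo p h, finrank_bot, h, ho]
    · rw [hK p h, finrank_top, add_zero]
  have h1 : Module.finrank ℂ (LinearMap.ker (coboundary m ξ)) = 1 := by
    have h2 : Module.finrank ℂ (LinearMap.ker (coboundary ξ m)) +
        ∑ e, Module.finrank ℂ (D (s e)) * Module.finrank ℂ (K (t e)) =
        ∑ p, Module.finrank ℂ (D p) * Module.finrank ℂ (K p) +
          Module.finrank ℂ (LinearMap.ker (coboundary m ξ)) := by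
      rw [← finrank_C0 (T := fun p => K p), ← finrank_C1 (T := fun p => K p)]
      exact finrank_hom_eq hB.preprojective hB.nondegenerate hB.radical m
    rw [h0] at h2
    have h4 := hB.sum_mul_eq
    have h5 : ∑ e, Module.finrank ℂ (D (s e)) * Module.finrank ℂ (D (t e)) =
        ∑ e, Module.finrank ℂ (D (s e)) * Module.finrank ℂ (K (t e)) := by
      refine Finset.sum_congr rfl fun e _ => ?_
      rw [← hmd (t e), if_neg (ht e), add_zero]
    have h6 : ∑ p, Module.finrank ℂ (D p) * Module.finrank ℂ (D p) =
        ∑ p, Module.finrank ℂ (D p) * Module.finrank ℂ (K p) + 1 := by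
      have : ∑ p, (if p = o then Module.finrank ℂ (D p) else 0) = 1 := by simp [ho]
      rw [← this, ← Finset.sum_add_distrib]
      refine Finset.sum_congr rfl fun p _ => ?_
      conv_lhs => enter [2]; rw [← hmd p]
      conv_lhs => rw [mul_add]
      simp
    omega
  have hin : (fun p => (K p).subtype : C0 (fun p => K p) D) ∈
      LinearMap.ker (coboundary m ξ) := mem_ker_coboundary.2 fun e => rfl
  have hf : (fun p => c p ∘ₗ (K p).subtype : C0 (fun p => K p) D) ∈
      LinearMap.ker (coboundary m ξ) := mem_ker_coboundary.2 fun e => by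
    ext x
    by_cases h : s e = o
    · have h2 : x = 0 := Subtype.ext ((Submodule.mem_bot ℂ).1 ((hKo _ h).le x.2))
      rw [h2, map_zero, map_zero]
    · exact LinearMap.congr_fun (hc e h) x
  by_cases hne : (⟨_, hin⟩ : LinearMap.ker (coboundary m ξ)) = 0
  · refine ⟨0, fun p hp => ?_⟩
    have h2 := congrFun (congrArg Subtype.val hne) p
    ext x
    have hx : x ∈ K p := by rw [hK p hp]; trivial
    have h3 : x = 0 := LinearMap.congr_fun h2 (⟨x, hx⟩ : K p)
    rw [h3]
    simp
  · obtain ⟨r, hr⟩ := (finrank_eq_one_iff_of_nonzero' _ hne).1 h1 ⟨_, hf⟩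
    refine ⟨r, fun p hp => ?_⟩
    have h2 := congrFun (congrArg Subtype.val hr) p
    ext x
    have hx : x ∈ K p := by rw [hK p hp]; trivial
    exact (LinearMap.congr_fun h2 (⟨x, hx⟩ : K p)).symm

/-- Along the arrows between a sink or source `o` and its complement there is a cocycle which is
linearly independent of `ξ`. -/
theorem exists_indep (hst : ∀ e, s e = o → t e ≠ o) : ∃ η : C1 s t D D,
    (∀ e, s e ≠ o → t e ≠ o → η e = 0) ∧
    ∀ α β : ℂ, (∀ e, s e = o ∨ t e = o → α • ξ e + β • η e = 0) → α = 0 ∧ β = 0 := by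
  classical
  let Y := ∀ e : {e // s e = o ∨ t e = o}, D (s e.1) →ₗ[ℂ] D (t e.1)
  have hY : Module.finrank ℂ Y = 2 := by
    rw [Module.finrank_pi_fintype, ← hB.sum_eq ho, ← Finset.sum_subtype
      (Finset.univ.filter fun e => s e = o ∨ t e = o) (by simp)
      (fun e => Module.finrank ℂ (D (s e) →ₗ[ℂ] D (t e))), Finset.sum_filter]
    refine Finset.sum_congr rfl fun e _ => ?_
    rw [Module.finrank_linearMap]
    by_cases h1 : s e = o
    · have h2 : Module.finrank ℂ (D (s e)) = 1 := by rw [h1, ho]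
      simp [h1, hst e h1, h2]
    · by_cases h2 : t e = o
      · have h3 : Module.finrank ℂ (D (t e)) = 1 := by rw [h2, ho]
        simp [h1, h2, h3]
      · simp [h1, h2]
  let ξ' : Y := fun e => ξ e.1
  obtain ⟨z, hz⟩ : ∃ z : Y, z ∉ Submodule.span ℂ {ξ'} := by
    by_contra! h
    have h1 := finrank_span_le_card (R := ℂ) {ξ'}
    rw [(Submodule.eq_top_iff').2 h, finrank_top, hY] at h1
    simp at h1
  have hξ' : ξ' ≠ 0 := by
    intro h
    obtain ⟨r, hr⟩ := hB.brick (fun p => if p = o then LinearMap.id else 0)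
      (mem_ker_coboundary.2 fun e => by
        by_cases he : s e = o ∨ t e = o
        · have : ξ e = 0 := congrFun h ⟨e, he⟩
          rw [this]; simp
        · rw [not_or] at he
          simp [he])
    have hr1 : r = 1 := by
      have : Nontrivial (D o) := Module.nontrivial_of_finrank_pos (R := ℂ) (by omega)
      obtain ⟨x, hx⟩ := exists_ne (0 : D o)
      have h1 := LinearMap.congr_fun (hr o) x
      simp only [if_true, LinearMap.id_apply, LinearMap.smul_apply] at h1
      have h2 : (r - 1) • x = 0 := by rw [sub_smul, ← h1, one_smul, sub_self]
      exact sub_eq_zero.1 ((smul_eq_zero.1 h2).resolve_right hx)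
    -- Then the representation would be concentrated at `o`.
    have h0 : ∀ p, p ≠ o → Module.finrank ℂ (D p) = 0 := fun p hp => by
      have h1 := hr p
      rw [if_neg hp, hr1, one_smul] at h1
      have : Subsingleton (D p) := ⟨fun x y => by
        rw [← LinearMap.id_apply (R := ℂ) x, ← LinearMap.id_apply (R := ℂ) y, ← h1]; rfl⟩
      exact Module.finrank_zero_of_subsingleton
    have h2 := hB.sum_eq ho
    rw [Finset.sum_eq_zero fun e _ => ?_] at h2
    · omega
    · by_cases h1 : s e = o
      · simp [h1, hst e h1, h0 _ (hst e h1)]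
      · by_cases h2 : t e = o <;> simp [h1, h2, h0 _ h1]
  refine ⟨fun e => if h : s e = o ∨ t e = o then z ⟨e, h⟩ else 0, fun e h1 h2 => ?_,
    fun α β h => ?_⟩
  · exact dif_neg (by tauto)
  · have h1 : α • ξ' + β • z = 0 := funext fun e => by
      have := h e.1 e.2
      dsimp only at this
      rwa [dif_pos e.2] at this
    have hβ : β = 0 := by
      by_contra hβ
      refine hz (Submodule.mem_span_singleton.2 ⟨-(β⁻¹ * α), ?_⟩)
      rw [neg_smul, mul_smul, eq_neg_of_add_eq_zero_left h1, smul_neg, neg_neg,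
        inv_smul_smul₀ hβ]
    rw [hβ, zero_smul, add_zero] at h1
    exact ⟨(smul_eq_zero.1 h1).resolve_right hξ', hβ⟩

omit hB [∀ p, FiniteDimensional ℂ (D p)] [Fintype V] [Fintype E] in
theorem exists_smul_at (c : C0 D D) : ∃ r : ℂ, c o = r • LinearMap.id := by
  have : Nontrivial (D o) := Module.nontrivial_of_finrank_pos (R := ℂ) (by omega)
  obtain ⟨x, hx⟩ := exists_ne (0 : D o)
  have h := (finrank_eq_one_iff_of_nonzero' x hx).1 ho
  obtain ⟨r, hr⟩ := h (c o x)
  refine ⟨r, LinearMap.ext fun y => ?_⟩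
  obtain ⟨b, rfl⟩ := h y
  rw [map_smul, ← hr, LinearMap.smul_apply, LinearMap.id_apply, smul_comm]

theorem exists_isBrickExtension_of_sink (hs : ∀ e, s e ≠ o) :
    ∃ η : C1 s t D D, IsBrickExtension ξ η {o}ᶜ := by
  obtain ⟨η, h0, hind⟩ := hB.exists_indep ho fun e h => absurd h (hs e)
  refine ⟨η, ⟨fun e _ => hs e, fun e he => h0 e (hs e) he, fun e he => absurd (hs e) he,
    fun c hc => hB.exists_smul_of_sink ho hs c hc, fun c _ => ?_, fun α β h => ?_⟩⟩
  · obtain ⟨r, hr⟩ := exists_smul_at ho c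
    refine ⟨r, fun p hp => ?_⟩
    obtain rfl : p = o := not_not.1 hp
    exact hr
  · exact hind α β fun e he => h e (hs e) (not_not.2 (he.resolve_left (hs e)))

theorem exists_isBrickExtension_of_source (ht : ∀ e, t e ≠ o) :
    ∃ η : C1 s t D D, IsBrickExtension ξ η {o} := by
  obtain ⟨η, h0, hind⟩ := hB.exists_indep ho fun e _ => ht e
  refine ⟨η, ⟨fun e he => absurd he (ht e), fun e he => absurd he (ht e), fun e he => h0 e he (ht e),
    fun c _ => ?_, fun c hc => hB.exists_smul_of_source ho ht c hc, fun α β h => ?_⟩⟩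
  · obtain ⟨r, hr⟩ := exists_smul_at ho c
    refine ⟨r, fun p hp => ?_⟩
    obtain rfl : p = o := hp
    exact hr
  · exact hind α β fun e he => h e (he.resolve_right (ht e)) (ht e)

theorem exists_isBrickExtension (hso : (∀ e, s e ≠ o) ∨ ∀ e, t e ≠ o) :
    ∃ (η : C1 s t D D) (S : Set V), IsBrickExtension ξ η S := by
  rcases hso with h | h
  · exact (hB.exists_isBrickExtension_of_sink ho h).imp fun η h => ⟨_, h⟩
  · exact (hB.exists_isBrickExtension_of_source ho h).imp fun η h => ⟨_, h⟩

end IsHomogeneousBrick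

end HomogeneousBrick

end GraphRep

open GraphRep in
/-- A homogeneous brick whose dimension at a sink or source is `1` yields a homogeneous tube that
contains a representation with a singular quiver Grassmannian. -/
theorem GraphRep.IsHomogeneousBrick.exists_singular {V : Type u} [Quiver.{v} V] [Fintype V]
    [Fintype (QuiverArrow V)] {D : V → Type} [∀ p, AddCommGroup (D p)] [∀ p, Module ℂ (D p)]
    [∀ p, FiniteDimensional ℂ (D p)] {ξ : C1 arrowSource arrowTarget D D}
    {ζ : C1 arrowTarget arrowSource D D} (hB : IsHomogeneousBrick ξ ζ) {o : V}
    (ho : Module.finrank ℂ (D o) = 1)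
    (hso : (∀ e : QuiverArrow V, arrowSource e ≠ o) ∨ ∀ e : QuiverArrow V, arrowTarget e ≠ o) :
    ∃ (X : QuiverRep V) (e : V → ℕ),
      Indecomposable X ∧ LiesInHomogeneousTube X ∧ IsSingularQuiverGrassmannian X e := by
  obtain ⟨η, S, hE⟩ := hB.exists_isBrickExtension ho hso
  obtain ⟨ζ', rfl, hζ'⟩ := exists_isPreprojectiveSeries η hB.brick hB.preprojective
  have hF : IsHomogeneousFamily ξ η ζ' S := ⟨hζ', hB.nondegenerate, hB.radical, hE⟩
  exact ⟨tubeRep ξ η 2, _, hF.indecomposable 2,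
    ⟨tubeRep ξ η, hF.isHomogeneousTube, 2, ⟨Iso.refl _⟩⟩, hE.isSingular⟩

/-! ### Representations by subspaces -/

section Edges

/-- Two vertices are adjacent if they are joined by an edge of the list. -/
def IsAdj (E : List (ℕ × ℕ)) (p q : ℕ) : Prop := (p, q) ∈ E ∨ (q, p) ∈ E

theorem IsAdj.symm {E : List (ℕ × ℕ)} {p q : ℕ} (h : IsAdj E p q) : IsAdj E q p := Or.symm h

/-- The sum of a function of pairs of adjacent vertices over the neighbours of a vertex. -/
def neighbourSum {M : Type*} [AddCommMonoid M] (E : List (ℕ × ℕ)) (p : ℕ) (g : ℕ → M) : M :=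
  (E.map fun e => (if e.1 = p then g e.2 else 0) + if e.2 = p then g e.1 else 0).sum

theorem neighbourSum_eq {M : Type*} [AddCommMonoid M] {N : ℕ} {E : List (ℕ × ℕ)}
    (hE : ∀ e ∈ E, e.1 < N ∧ e.2 < N) (p : ℕ) (g : ℕ → M) :
    neighbourSum E p g =
      ∑ q : Fin N, (E.count (p, q.val) + E.count (q.val, p)) • g q := by
  have key : ∀ (a : ℕ), a < N → ∀ (P : Prop) [Decidable P],
      (if P then g a else 0) = ∑ q : Fin N, (if P ∧ a = q.val then 1 else 0) • g q := by
    intro a ha P _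
    rw [Finset.sum_eq_single ⟨a, ha⟩]
    · by_cases hP : P <;> simp [hP]
    · intro q _ hq
      rw [if_neg, zero_smul]
      rintro ⟨-, h⟩
      exact hq (Fin.ext h.symm)
    · simp
  induction E with
  | nil => simp [neighbourSum]
  | cons e E ih =>
    have h1 := hE e (by simp)
    have h2 := ih fun e' he' => hE e' (by simp [he'])
    rw [neighbourSum] at h2 ⊢
    rw [List.map_cons, List.sum_cons, h2, key _ h1.2, key _ h1.1, ← Finset.sum_add_distrib,
      ← Finset.sum_add_distrib]
    refine Finset.sum_congr rfl fun q _ => ?_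
    rw [← add_smul, ← add_smul, List.count_cons, List.count_cons]
    congr 1
    obtain ⟨a, b⟩ := e
    simp only [beq_iff_eq, Prod.mk.injEq]
    have h3 : (b = p ∧ a = q.val) ↔ (a = q.val ∧ b = p) := and_comm
    simp only [h3]
    omega

theorem mem_of_count_ne_zero {E : List (ℕ × ℕ)} {p q : ℕ}
    (h : E.count (p, q) + E.count (q, p) ≠ 0) : IsAdj E p q := by
  by_contra hc
  rw [IsAdj, not_or, ← List.count_eq_zero, ← List.count_eq_zero] at hc
  omega

variable {V : Type u} [Quiver.{v} V]

open GraphRep in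
theorem sum_arrows_eq [Fintype V] [Fintype (QuiverArrow V)] {M : Type*} [AddCommMonoid M]
    {N : ℕ} {E : List (ℕ × ℕ)} (σ : V ≃ Fin N)
    (hσ : ∀ i j : V, Nonempty (((i ⟶ j) ⊕ (j ⟶ i)) ≃
      Fin (E.count ((σ i).val, (σ j).val) + E.count ((σ j).val, (σ i).val))))
    (G : V → V → M) :
    ∑ e : QuiverArrow V, (G (arrowSource e) (arrowTarget e) + G (arrowTarget e) (arrowSource e)) =
      ∑ p, ∑ q, (E.count ((σ p).val, (σ q).val) + E.count ((σ q).val, (σ p).val)) • G p q := by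
  classical
  have hfin : ∀ p q : V, Finite (p ⟶ q) := fun p q =>
    Finite.of_injective (fun a => (hσ p q).some (Sum.inl a))
      ((hσ p q).some.injective.comp Sum.inl_injective)
  have : ∀ p q : V, Fintype (p ⟶ q) := fun p q => Fintype.ofFinite _
  have hcard : ∀ p q : V, E.count ((σ p).val, (σ q).val) + E.count ((σ q).val, (σ p).val) =
      Fintype.card (p ⟶ q) + Fintype.card (q ⟶ p) := fun p q => by
    rw [← Fintype.card_sum, Fintype.card_congr (hσ p q).some, Fintype.card_fin]
  have h1 : ∀ F : V → V → M, ∑ e : QuiverArrow V, F (arrowSource e) (arrowTarget e) =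
      ∑ p, ∑ q, Fintype.card (p ⟶ q) • F p q := fun F => by
    have h2 : ∑ e : QuiverArrow V, F (arrowSource e) (arrowTarget e) =
        @Finset.sum (Σ p q : V, (p ⟶ q)) M _ (@Finset.univ (Σ p q : V, (p ⟶ q)) Sigma.instFintype)
          (fun e => F e.1 e.2.1) :=
      Finset.sum_congr (Finset.ext fun e => by simp) fun _ _ => rfl
    rw [h2]
    refine (Fintype.sum_sigma _).trans (Finset.sum_congr rfl fun p _ => ?_)
    refine (Fintype.sum_sigma _).trans (Finset.sum_congr rfl fun q _ => ?_)
    simp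
  rw [Finset.sum_add_distrib, h1 G, h1 fun p q => G q p,
    Finset.sum_comm (f := fun p q => Fintype.card (p ⟶ q) • G q p), ← Finset.sum_add_distrib]
  refine Finset.sum_congr rfl fun p _ => ?_
  rw [← Finset.sum_add_distrib]
  refine Finset.sum_congr rfl fun q _ => ?_
  rw [hcard, add_smul]

end Edges

/-- A representation of the preprojective algebra of a graph by subspaces `U p` of one vector space
`C` in the following form: of the two maps belonging to an edge `{p, q}`, one is the inclusion of
one of the spaces `U p`, `U q` into the other and the other one is given by an operator `A p q`
of `C`; the relation at `p` is `∑ s p q A p q = 0` on `U p`. It is simple, and its restriction to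
any orientation of the graph is a brick. -/
structure IsSubspaceSystem {C : Type*} [AddCommGroup C] [Module ℂ C] (N : ℕ) (E : List (ℕ × ℕ))
    (U : ℕ → Submodule ℂ C) (A : ℕ → ℕ → C →ₗ[ℂ] C) (s : ℕ → ℕ → ℂ) : Prop where
  lt : ∀ e ∈ E, e.1 < N ∧ e.2 < N
  symm : ∀ p q, A p q = A q p
  neg : ∀ p q, IsAdj E p q → s q p = -s p q
  sign_ne : ∀ p q, IsAdj E p q → s p q ≠ 0
  nested : ∀ p q, IsAdj E p q → (U p ≤ U q ∧ ∀ x ∈ U q, A p q x ∈ U p) ∨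
    (U q ≤ U p ∧ ∀ x ∈ U p, A p q x ∈ U q)
  relation : ∀ p < N, ∀ x ∈ U p, neighbourSum E p (fun q => s p q • A p q x) = 0
  radical : ∀ p < N, neighbourSum E p (fun q => Module.finrank ℂ (U q)) =
    2 * Module.finrank ℂ (U p)
  nonzero : ∃ p q, IsAdj E p q ∧ U p ≠ ⊥ ∧ U q ≠ ⊥ ∧ (U p ≤ U q → ∃ x ∈ U q, A p q x ≠ 0) ∧
    (U q ≤ U p → ∃ x ∈ U p, A p q x ≠ 0)
  simple : ∀ W : ℕ → Submodule ℂ C, (∀ p, W p ≤ U p) →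
    (∀ p q, IsAdj E p q → (U p ≤ U q ∧ W p ≤ W q ∧ ∀ x ∈ W q, A p q x ∈ W p) ∨
      (U q ≤ U p ∧ W q ≤ W p ∧ ∀ x ∈ W p, A p q x ∈ W q)) →
    (∀ p < N, W p = ⊥) ∨ ∀ p < N, W p = U p
  brick : ∀ g : ℕ → C →ₗ[ℂ] C, (∀ p, ∀ x ∈ U p, g p x ∈ U p) →
    (∀ p q, IsAdj E p q → (U p ≤ U q ∧ ∀ x ∈ U p, g q x = g p x) ∨
      (U q ≤ U p ∧ ∀ x ∈ U q, g p x = g q x) ∨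
      (¬ U p ≤ U q ∧ ∀ x ∈ U p, g q (A p q x) = A p q (g p x)) ∨
      (¬ U q ≤ U p ∧ ∀ x ∈ U q, g p (A p q x) = A p q (g q x))) →
    ∃ r : ℂ, ∀ p < N, ∀ x ∈ U p, g p x = r • x

namespace IsSubspaceSystem

open GraphRep

variable {C : Type} [AddCommGroup C] [Module ℂ C] [FiniteDimensional ℂ C] {N : ℕ}
  {E : List (ℕ × ℕ)} {U : ℕ → Submodule ℂ C} {A : ℕ → ℕ → C →ₗ[ℂ] C} {s : ℕ → ℕ → ℂ}
  (hA : IsSubspaceSystem N E U A s)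

open scoped Classical in
variable (U A) in
/-- The map along an arrow from `p` to `q`. -/
noncomputable def forward (p q : ℕ) : C →ₗ[ℂ] C := if U p ≤ U q then LinearMap.id else A p q

open scoped Classical in
variable (U A s) in
/-- The map in the direction opposite to an arrow from `p` to `q`. -/
noncomputable def backward (p q : ℕ) : C →ₗ[ℂ] C :=
  s q p • if U p ≤ U q then A p q else LinearMap.id

include hA

omit [FiniteDimensional ℂ C]

theorem forward_mem {p q : ℕ} (h : IsAdj E p q) : ∀ x ∈ U p, forward U A p q x ∈ U q := by
  intro x hx
  by_cases hpq : U p ≤ U q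
  · rw [forward, if_pos hpq]
    exact hpq hx
  · rw [forward, if_neg hpq]
    rcases hA.nested p q h with h1 | h1
    · exact absurd h1.1 hpq
    · exact h1.2 x hx

theorem backward_mem {p q : ℕ} (h : IsAdj E p q) : ∀ x ∈ U q, backward U A s p q x ∈ U p := by
  intro x hx
  refine Submodule.smul_mem _ _ ?_
  by_cases hpq : U p ≤ U q
  · rw [if_pos hpq]
    rcases hA.nested p q h with h1 | h1
    · exact h1.2 x hx
    · exact h1.1 (h1.2 x (h1.1 hx))
  · rw [if_neg hpq]
    rcases hA.nested p q h with h1 | h1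
    · exact absurd h1.1 hpq
    · exact h1.1 hx

theorem forward_backward (p q : ℕ) (x : C) :
    forward U A p q (backward U A s p q x) = s q p • A q p x := by
  rw [hA.symm q p]
  by_cases hpq : U p ≤ U q <;> simp [forward, backward, hpq]

theorem backward_forward {p q : ℕ} (h : IsAdj E p q) (x : C) :
    backward U A s p q (forward U A p q x) = -(s p q • A p q x) := by
  rw [← neg_smul, ← hA.neg p q h]
  by_cases hpq : U p ≤ U q <;> simp [forward, backward, hpq]

/-- A family of subspaces that is stable under the maps in both directions is trivial. -/
theorem trivial_of_stable (W : ℕ → Submodule ℂ C) (hW : ∀ p, W p ≤ U p)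
    (hst : ∀ p q, IsAdj E p q → ((∀ x ∈ W p, forward U A p q x ∈ W q) ∧
      ∀ x ∈ W q, backward U A s p q x ∈ W p) ∨ ((∀ x ∈ W q, forward U A q p x ∈ W p) ∧
      ∀ x ∈ W p, backward U A s q p x ∈ W q)) :
    (∀ p < N, W p = ⊥) ∨ ∀ p < N, W p = U p := by
  have key : ∀ p q, IsAdj E p q → (∀ x ∈ W p, forward U A p q x ∈ W q) →
      (∀ x ∈ W q, backward U A s p q x ∈ W p) → (U p ≤ U q ∧ W p ≤ W q ∧ ∀ x ∈ W q, A p q x ∈ W p) ∨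
      (U q ≤ U p ∧ W q ≤ W p ∧ ∀ x ∈ W p, A p q x ∈ W q) := by
    intro p q h h1 h2
    have hs : s q p ≠ 0 := hA.sign_ne q p h.symm
    by_cases hpq : U p ≤ U q
    · refine Or.inl ⟨hpq, fun x hx => ?_, fun x hx => ?_⟩
      · simpa [forward, hpq] using h1 x hx
      · have := Submodule.smul_mem _ (s q p)⁻¹ (h2 x hx)
        simpa [backward, hpq, smul_smul, hs] using this
    · have hqp : U q ≤ U p := (hA.nested p q h).elim (fun h => absurd h.1 hpq) fun h => h.1
      refine Or.inr ⟨hqp, fun x hx => ?_, fun x hx => ?_⟩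
      · have := Submodule.smul_mem _ (s q p)⁻¹ (h2 x hx)
        simpa [backward, hpq, smul_smul, hs] using this
      · simpa [forward, hpq] using h1 x hx
  refine hA.simple W hW fun p q h => ?_
  rcases hst p q h with h1 | h1
  · exact key p q h h1.1 h1.2
  · have h2 := key q p h.symm h1.1 h1.2
    rw [hA.symm p q]
    exact h2.symm

theorem backward_ne_zero : ∃ p q, IsAdj E p q ∧ (∃ x ∈ U q, backward U A s p q x ≠ 0) ∧
    ∃ x ∈ U p, backward U A s q p x ≠ 0 := by
  obtain ⟨p, q, h, hp, hq, hpq, hqp⟩ := hA.nonzero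
  refine ⟨p, q, h, ?_, ?_⟩
  · have hs : s q p ≠ 0 := hA.sign_ne q p h.symm
    by_cases h1 : U p ≤ U q
    · obtain ⟨x, hx, hx0⟩ := hpq h1
      exact ⟨x, hx, by simp [backward, h1, hs, hx0]⟩
    · obtain ⟨x, hx, hx0⟩ := Submodule.exists_mem_ne_zero_of_ne_bot hq
      exact ⟨x, hx, by simp [backward, h1, hs, hx0]⟩
  · have hs : s p q ≠ 0 := hA.sign_ne p q h
    by_cases h1 : U q ≤ U p
    · obtain ⟨x, hx, hx0⟩ := hqp h1
      exact ⟨x, hx, by simp [backward, h1, hs, hA.symm q p, hx0]⟩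
    · obtain ⟨x, hx, hx0⟩ := Submodule.exists_mem_ne_zero_of_ne_bot hp
      exact ⟨x, hx, by simp [backward, h1, hs, hx0]⟩

section Quiver

variable {V : Type u} [Quiver.{v} V] (σ : V ≃ Fin N)
    (hσ : ∀ i j : V, Nonempty (((i ⟶ j) ⊕ (j ⟶ i)) ≃
      Fin (E.count ((σ i).val, (σ j).val) + E.count ((σ j).val, (σ i).val))))

omit hA in
include hσ in
theorem isAdj_of_arrow (e : QuiverArrow V) : IsAdj E (σ (arrowSource e)) (σ (arrowTarget e)) := by
  refine mem_of_count_ne_zero fun h => ?_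
  have := (hσ (arrowSource e) (arrowTarget e)).some (Sum.inl e.2.2)
  rw [h] at this
  exact this.elim0

omit hA in
include hσ in
theorem exists_arrow {p q : V} (h : IsAdj E (σ p) (σ q)) :
    (∃ e : QuiverArrow V, arrowSource e = p ∧ arrowTarget e = q) ∨
      ∃ e : QuiverArrow V, arrowSource e = q ∧ arrowTarget e = p := by
  have hpos : 0 < E.count ((σ p).val, (σ q).val) + E.count ((σ q).val, (σ p).val) := by
    rcases h with h | h
    · have := List.count_pos_iff.2 h
      omega
    · have := List.count_pos_iff.2 h
      omega
  rcases (hσ p q).some.symm ⟨0, hpos⟩ with a | a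
  · exact Or.inl ⟨⟨p, q, a⟩, rfl, rfl⟩
  · exact Or.inr ⟨⟨q, p, a⟩, rfl, rfl⟩

/-- The representation of a quiver belonging to a system of subspaces. -/
noncomputable def rep : C1 (V := V) arrowSource arrowTarget (fun p => U (σ p)) fun p => U (σ p) :=
  fun e => (forward U A (σ (arrowSource e)) (σ (arrowTarget e))).restrict
    (hA.forward_mem (isAdj_of_arrow σ hσ e))

/-- The maps in the opposite directions. -/
noncomputable def corep : C1 (V := V) arrowTarget arrowSource (fun p => U (σ p)) fun p => U (σ p) :=
  fun e => (backward U A s (σ (arrowSource e)) (σ (arrowTarget e))).restrict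
    (hA.backward_mem (isAdj_of_arrow σ hσ e))

theorem coe_rep (e : QuiverArrow V) (x : U (σ (arrowSource e))) :
    (hA.rep σ hσ e x : C) = forward U A (σ (arrowSource e)) (σ (arrowTarget e)) x := rfl

theorem coe_corep (e : QuiverArrow V) (x : U (σ (arrowTarget e))) :
    (hA.corep σ hσ e x : C) = backward U A s (σ (arrowSource e)) (σ (arrowTarget e)) x := rfl

theorem isNondegenerate : IsNondegenerate (hA.rep σ hσ) (hA.corep σ hσ) := by
  -- A subrepresentation in the double quiver is trivial.
  have key : ∀ W : ∀ p : V, Submodule ℂ (U (σ p)),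
      (∀ e, ∀ x ∈ W (arrowSource e), hA.rep σ hσ e x ∈ W (arrowTarget e)) →
      (∀ e, ∀ x ∈ W (arrowTarget e), hA.corep σ hσ e x ∈ W (arrowSource e)) →
      (∀ p, W p = ⊥) ∨ ∀ p, W p = ⊤ := by
    intro W h1 h2
    let W' : ℕ → Submodule ℂ C := fun n =>
      if h : n < N then (W (σ.symm ⟨n, h⟩)).map (Submodule.subtype _) else ⊥
    have hW' : ∀ p, W' (σ p) = (W p).map (U (σ p)).subtype := fun p => by
      have : ∀ n : Fin N, W' n = (W (σ.symm n)).map (U (σ (σ.symm n))).subtype := fun n => by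
        simp only [W', n.2, dif_pos]
      rw [this]
      generalize hq : σ.symm (σ p) = q
      obtain rfl : p = q := by rw [← hq, Equiv.symm_apply_apply]
      rfl
    have hstep : ∀ e : QuiverArrow V,
        (∀ x ∈ W' (σ (arrowSource e)), forward U A (σ (arrowSource e)) (σ (arrowTarget e)) x ∈
          W' (σ (arrowTarget e))) ∧ ∀ x ∈ W' (σ (arrowTarget e)),
            backward U A s (σ (arrowSource e)) (σ (arrowTarget e)) x ∈ W' (σ (arrowSource e)) := by
      intro e
      rw [hW', hW']
      constructor
      · rintro _ ⟨x, hx, rfl⟩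
        exact ⟨_, h1 e x hx, rfl⟩
      · rintro _ ⟨x, hx, rfl⟩
        exact ⟨_, h2 e x hx, rfl⟩
    have h3 := hA.trivial_of_stable W' (fun n => by
      by_cases h : n < N
      · obtain ⟨p, hp⟩ := σ.surjective ⟨n, h⟩
        have hn : n = (σ p).val := by rw [hp]
        rw [hn, hW']
        exact Submodule.map_subtype_le _ _
      · simp only [W', h, dif_neg, not_false_iff]
        exact bot_le) fun m n hmn => by
      have hlt : m < N ∧ n < N := by
        rcases hmn with h | h
        · exact hA.lt _ h
        · exact (hA.lt _ h).symm
      obtain ⟨p, hp⟩ := σ.surjective ⟨m, hlt.1⟩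
      obtain ⟨q, hq⟩ := σ.surjective ⟨n, hlt.2⟩
      obtain rfl : m = (σ p).val := by rw [hp]
      obtain rfl : n = (σ q).val := by rw [hq]
      rcases exists_arrow σ hσ hmn with ⟨e, rfl, rfl⟩ | ⟨e, rfl, rfl⟩
      · exact Or.inl (hstep e)
      · exact Or.inr (hstep e)
    refine h3.imp (fun h p => ?_) fun h p => ?_
    · have := h _ (σ p).2
      rw [hW'] at this
      refine Submodule.map_injective_of_injective (U (σ p)).subtype_injective ?_
      rw [this, Submodule.map_bot]
    · have := h _ (σ p).2
      rw [hW'] at this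
      refine Submodule.map_injective_of_injective (U (σ p)).subtype_injective ?_
      rw [this, Submodule.map_subtype_top]
  obtain ⟨m, n, hmn, ⟨x, hx, hx0⟩, ⟨y, hy, hy0⟩⟩ := hA.backward_ne_zero
  have hcorep : ∃ e, hA.corep σ hσ e ≠ 0 := by
    have hlt : m < N ∧ n < N := by
      rcases hmn with h | h
      · exact hA.lt _ h
      · exact (hA.lt _ h).symm
    obtain ⟨p, hp⟩ := σ.surjective ⟨m, hlt.1⟩
    obtain ⟨q, hq⟩ := σ.surjective ⟨n, hlt.2⟩
    obtain rfl : m = (σ p).val := by rw [hp]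
    obtain rfl : n = (σ q).val := by rw [hq]
    rcases exists_arrow σ hσ hmn with ⟨e, rfl, rfl⟩ | ⟨e, rfl, rfl⟩
    · exact ⟨e, fun h => hx0 (congrArg Subtype.val (LinearMap.congr_fun h ⟨x, hx⟩))⟩
    · exact ⟨e, fun h => hy0 (congrArg Subtype.val (LinearMap.congr_fun h ⟨y, hy⟩))⟩
  obtain ⟨e, he⟩ := hcorep
  constructor
  · intro W h1 h2
    refine (key W h1 fun e x hx => ?_).resolve_right fun h => he ?_
    · rw [LinearMap.mem_ker.1 (h2 e hx)]
      exact zero_mem _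
    · have := h2 e
      rw [h, top_le_iff, LinearMap.ker_eq_top] at this
      exact this
  · intro W h1 h2
    refine (key W h1 fun e x hx => h2 e ⟨x, rfl⟩).resolve_left fun h => he ?_
    have := h2 e
    rwa [h, le_bot_iff, LinearMap.range_eq_bot] at this

theorem isBrick (c : C0 (fun p : V => U (σ p)) fun p => U (σ p))
    (hc : c ∈ LinearMap.ker (coboundary (hA.rep σ hσ) (hA.rep σ hσ))) :
    ∃ r : ℂ, ∀ p, c p = r • LinearMap.id := by
  rw [mem_ker_coboundary] at hc
  have hext : ∀ n : ℕ, ∃ g : C →ₗ[ℂ] C, (∀ x ∈ U n, g x ∈ U n) ∧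
      ∀ p (h : n = (σ p).val) (x : U (σ p)), g x = c p x := by
    intro n
    by_cases h : n < N
    · obtain ⟨p, hp⟩ := σ.surjective ⟨n, h⟩
      obtain rfl : n = (σ p).val := by rw [hp]
      obtain ⟨g, hg⟩ := LinearMap.exists_extend ((U (σ p)).subtype ∘ₗ c p)
      have hg' : ∀ x : U (σ p), g x = c p x := LinearMap.congr_fun hg
      refine ⟨g, fun x hx => ?_, fun q hq x => ?_⟩
      · rw [hg' ⟨x, hx⟩]
        exact (c p ⟨x, hx⟩).2
      · obtain rfl : p = q := σ.injective (Fin.ext hq)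
        exact hg' x
    · exact ⟨0, fun x _ => zero_mem _, fun p hp => absurd (hp ▸ (σ p).2) h⟩
  choose g hgU hg using hext
  have hg' : ∀ p (x : C) (hx : x ∈ U (σ p)), g (σ p) x = c p ⟨x, hx⟩ := fun p x hx =>
    hg (σ p) p rfl ⟨x, hx⟩
  have hstep : ∀ e : QuiverArrow V, (U (σ (arrowSource e)) ≤ U (σ (arrowTarget e)) ∧
      ∀ x ∈ U (σ (arrowSource e)), g (σ (arrowTarget e)) x = g (σ (arrowSource e)) x) ∨
      (¬ U (σ (arrowSource e)) ≤ U (σ (arrowTarget e)) ∧ ∀ x ∈ U (σ (arrowSource e)),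
        g (σ (arrowTarget e)) (A (σ (arrowSource e)) (σ (arrowTarget e)) x) =
          A (σ (arrowSource e)) (σ (arrowTarget e)) (g (σ (arrowSource e)) x)) := by
    intro e
    have h : ∀ x ∈ U (σ (arrowSource e)),
        g (σ (arrowTarget e)) (forward U A (σ (arrowSource e)) (σ (arrowTarget e)) x) =
          forward U A (σ (arrowSource e)) (σ (arrowTarget e)) (g (σ (arrowSource e)) x) := by
      intro x hx
      rw [hg' _ _ hx, hg' _ _ (hA.forward_mem (isAdj_of_arrow σ hσ e) x hx)]
      exact congrArg Subtype.val (LinearMap.congr_fun (hc e) ⟨x, hx⟩)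
    by_cases hle : U (σ (arrowSource e)) ≤ U (σ (arrowTarget e))
    · simp only [forward, if_pos hle, LinearMap.id_apply] at h
      exact Or.inl ⟨hle, h⟩
    · simp only [forward, if_neg hle] at h
      exact Or.inr ⟨hle, h⟩
  obtain ⟨r, hr⟩ := hA.brick g hgU fun m n hmn => by
    have hlt : m < N ∧ n < N := by
      rcases hmn with h | h
      · exact hA.lt _ h
      · exact (hA.lt _ h).symm
    obtain ⟨p, hp⟩ := σ.surjective ⟨m, hlt.1⟩
    obtain ⟨q, hq⟩ := σ.surjective ⟨n, hlt.2⟩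
    obtain rfl : m = (σ p).val := by rw [hp]
    obtain rfl : n = (σ q).val := by rw [hq]
    rcases exists_arrow σ hσ hmn with ⟨e, rfl, rfl⟩ | ⟨e, rfl, rfl⟩
    · rcases hstep e with h | h
      · exact Or.inl h
      · exact Or.inr (Or.inr (Or.inl h))
    · rw [hA.symm]
      rcases hstep e with h | h
      · exact Or.inr (Or.inl h)
      · exact Or.inr (Or.inr (Or.inr h))
  refine ⟨r, fun p => LinearMap.ext fun x => Subtype.ext ?_⟩
  rw [← hg' p x x.2, hr _ (σ p).2 x x.2]
  rfl

variable [FiniteDimensional ℂ C] [Fintype V] [Fintype (QuiverArrow V)]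

include hσ in
omit [FiniteDimensional ℂ C] in
theorem isRadicalVector : IsRadicalVector (V := V) arrowSource arrowTarget
    fun p => Module.finrank ℂ (U (σ p)) := by
  intro m
  have h := sum_arrows_eq σ hσ fun p q => m p * Module.finrank ℂ (U (σ q))
  have h1 : ∀ e : QuiverArrow V, m (arrowSource e) * Module.finrank ℂ (U (σ (arrowTarget e))) +
      Module.finrank ℂ (U (σ (arrowSource e))) * m (arrowTarget e) =
      m (arrowSource e) * Module.finrank ℂ (U (σ (arrowTarget e))) +
      m (arrowTarget e) * Module.finrank ℂ (U (σ (arrowSource e))) := fun e => by ring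
  simp only [h1, h, Finset.mul_sum]
  refine Finset.sum_congr rfl fun p _ => ?_
  have h2 := hA.radical _ (σ p).2
  rw [neighbourSum_eq hA.lt, ← σ.sum_comp] at h2
  rw [mul_left_comm, ← h2, Finset.mul_sum]
  refine Finset.sum_congr rfl fun q _ => ?_
  rw [smul_eq_mul, smul_eq_mul]
  ring

theorem isPreprojective :
    IsPreprojective (fun p : V => U (σ p)) (hA.rep σ hσ) (hA.corep σ hσ) := by
  intro c
  have hproj : ∀ p : V, ∃ π : C →ₗ[ℂ] U (σ p), π ∘ₗ (U (σ p)).subtype = LinearMap.id := fun p =>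
    (U (σ p)).subtype.exists_leftInverse_of_injective (Submodule.ker_subtype _)
  choose π hπ using hproj
  have hπ' : ∀ p (y : U (σ p)), π p y = y := fun p => LinearMap.congr_fun (hπ p)
  let G : V → V → ℂ := fun p q => LinearMap.trace ℂ (U (σ p))
    (c p ∘ₗ π p ∘ₗ (s (σ p) (σ q) • A (σ p) (σ q)) ∘ₗ (U (σ p)).subtype)
  have h1 : ∀ e : QuiverArrow V, LinearMap.trace ℂ (U (σ (arrowTarget e)))
      (coboundary (hA.rep σ hσ) (hA.rep σ hσ) c e ∘ₗ hA.corep σ hσ e) =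
      G (arrowSource e) (arrowTarget e) + G (arrowTarget e) (arrowSource e) := by
    intro e
    have h2 : coboundary (hA.rep σ hσ) (hA.rep σ hσ) c e =
      c (arrowTarget e) ∘ₗ hA.rep σ hσ e - hA.rep σ hσ e ∘ₗ c (arrowSource e) := rfl
    have h3 : c (arrowSource e) ∘ₗ hA.corep σ hσ e ∘ₗ hA.rep σ hσ e =
        -(c (arrowSource e) ∘ₗ π (arrowSource e) ∘ₗ (s (σ (arrowSource e)) (σ (arrowTarget e)) •
          A (σ (arrowSource e)) (σ (arrowTarget e))) ∘ₗ (U (σ (arrowSource e))).subtype) := by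
      refine LinearMap.ext fun x => ?_
      have h4 := hA.backward_forward (isAdj_of_arrow σ hσ e) x
      rw [LinearMap.comp_apply, LinearMap.comp_apply,
        ← hπ' _ (hA.corep σ hσ e (hA.rep σ hσ e x)), coe_corep, coe_rep, h4, map_neg, map_neg]
      rfl
    have h4 : c (arrowTarget e) ∘ₗ hA.rep σ hσ e ∘ₗ hA.corep σ hσ e =
        c (arrowTarget e) ∘ₗ π (arrowTarget e) ∘ₗ (s (σ (arrowTarget e)) (σ (arrowSource e)) •
          A (σ (arrowTarget e)) (σ (arrowSource e))) ∘ₗ (U (σ (arrowTarget e))).subtype := by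
      refine LinearMap.ext fun x => ?_
      have h5 := hA.forward_backward (σ (arrowSource e)) (σ (arrowTarget e)) x
      rw [LinearMap.comp_apply, LinearMap.comp_apply,
        ← hπ' _ (hA.rep σ hσ e (hA.corep σ hσ e x)), coe_rep, coe_corep, h5]
      rfl
    have h5 : LinearMap.trace ℂ (U (σ (arrowTarget e)))
        (hA.rep σ hσ e ∘ₗ (c (arrowSource e) ∘ₗ hA.corep σ hσ e)) =
        LinearMap.trace ℂ (U (σ (arrowSource e)))
          ((c (arrowSource e) ∘ₗ hA.corep σ hσ e) ∘ₗ hA.rep σ hσ e) :=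
      LinearMap.trace_comp_comm' _ _
    rw [h2, LinearMap.sub_comp, map_sub, LinearMap.comp_assoc, LinearMap.comp_assoc, h4, h5,
      LinearMap.comp_assoc, h3, map_neg, sub_neg_eq_add, add_comm]
  rw [Finset.sum_congr rfl fun e _ => h1 e, sum_arrows_eq σ hσ G]
  refine Finset.sum_eq_zero fun p _ => ?_
  let F : (C →ₗ[ℂ] C) →ₗ[ℂ] ℂ := LinearMap.trace ℂ (U (σ p)) ∘ₗ
    (LinearMap.llcomp ℂ _ _ _ (c p ∘ₗ π p)) ∘ₗ LinearMap.lcomp ℂ C (U (σ p)).subtype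
  have hF : ∀ q, G p q = F (s (σ p) (σ q) • A (σ p) (σ q)) := fun q => rfl
  have h3 : ∑ q, (E.count ((σ p).val, (σ q).val) + E.count ((σ q).val, (σ p).val)) • G p q =
      F (∑ q, (E.count ((σ p).val, (σ q).val) + E.count ((σ q).val, (σ p).val)) •
        s (σ p) (σ q) • A (σ p) (σ q)) := by
    simp only [hF, map_sum, map_nsmul]
  have h4 : (∑ q, (E.count ((σ p).val, (σ q).val) + E.count ((σ q).val, (σ p).val)) •
        s (σ p) (σ q) • A (σ p) (σ q)) ∘ₗ (U (σ p)).subtype = 0 := by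
    refine LinearMap.ext fun x => ?_
    have h5 := hA.relation _ (σ p).2 x x.2
    rw [neighbourSum_eq hA.lt, ← σ.sum_comp] at h5
    simpa only [LinearMap.comp_apply, LinearMap.sum_apply, LinearMap.smul_apply,
      Submodule.subtype_apply, LinearMap.zero_apply] using h5
  rw [h3]
  simp only [F, LinearMap.comp_apply, LinearMap.lcomp_apply', h4, map_zero]

theorem isHomogeneousBrick : IsHomogeneousBrick (hA.rep σ hσ) (hA.corep σ hσ) :=
  ⟨hA.isPreprojective σ hσ, hA.isNondegenerate σ hσ, hA.isRadicalVector σ hσ, hA.isBrick σ hσ⟩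

end Quiver

end IsSubspaceSystem

/-! ### Cycles -/

section Cycle

open GraphRep

variable {V : Type u} [Quiver.{v} V]

/-- A finite acyclic quiver has a sink. -/
theorem IsAcyclicQuiver.exists_sink [Finite V] [Nonempty V] (hac : IsAcyclicQuiver V) :
    ∃ o : V, ∀ e : QuiverArrow V, arrowSource e ≠ o := by
  by_contra! h
  choose e he using h
  let f : V → V := fun p => arrowTarget (e p)
  have hf : ∀ p, Nonempty (p ⟶ f p) := fun p => by
    have h1 : Nonempty (arrowSource (e p) ⟶ arrowTarget (e p)) := ⟨(e p).2.2⟩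
    rwa [he p] at h1
  have hpath : ∀ (n : ℕ) (p : V), ∃ π : Quiver.Path p (f^[n] p), π.length = n := by
    intro n p
    induction n with
    | zero => exact ⟨Quiver.Path.nil, rfl⟩
    | succ n ih =>
      obtain ⟨π, hπ⟩ := ih
      rw [Function.iterate_succ_apply']
      exact ⟨π.cons (hf _).some, by rw [Quiver.Path.length_cons, hπ]⟩
  obtain ⟨p⟩ := ‹Nonempty V›
  obtain ⟨m, n, hmn, h⟩ := Finite.exists_ne_map_eq_of_infinite fun n => f^[n] p
  wlog hlt : m < n generalizing m n
  · exact this n m hmn.symm h.symm (by omega)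
  have h1 := hpath (n - m) (f^[m] p)
  rw [← Function.iterate_add_apply, Nat.sub_add_cancel hlt.le, ← h] at h1
  obtain ⟨π, hπ⟩ := h1
  have := hac _ π
  omega

/-- A system of subspaces with a line at a sink or source of the quiver yields a singular quiver
Grassmannian. -/
theorem exists_singular_of_system {C : Type} [AddCommGroup C] [Module ℂ C]
    [FiniteDimensional ℂ C] {N : ℕ} {E : List (ℕ × ℕ)} {U : ℕ → Submodule ℂ C}
    {A : ℕ → ℕ → C →ₗ[ℂ] C} {s : ℕ → ℕ → ℂ} (hA : IsSubspaceSystem N E U A s) (σ : V ≃ Fin N)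
    (hσ : ∀ i j : V, Nonempty (((i ⟶ j) ⊕ (j ⟶ i)) ≃
      Fin (E.count ((σ i).val, (σ j).val) + E.count ((σ j).val, (σ i).val)))) {o : V}
    (ho : Module.finrank ℂ (U (σ o)) = 1)
    (hso : (∀ e : QuiverArrow V, arrowSource e ≠ o) ∨ ∀ e : QuiverArrow V, arrowTarget e ≠ o) :
    ∃ (X : QuiverRep V) (e : V → ℕ),
      Indecomposable X ∧ LiesInHomogeneousTube X ∧ IsSingularQuiverGrassmannian X e := by
  have : Fintype V := Fintype.ofEquiv _ σ.symm
  have : ∀ p q : V, Finite (p ⟶ q) := fun p q =>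
    Finite.of_injective (fun a => (hσ p q).some (Sum.inl a))
      ((hσ p q).some.injective.comp Sum.inl_injective)
  have : Fintype (QuiverArrow V) := Fintype.ofFinite _
  exact (hA.isHomogeneousBrick σ hσ).exists_singular ho hso

/-- A vertex at the end of a single edge is a sink or a source. -/
theorem sink_or_source_of_leaf {N : ℕ} {E : List (ℕ × ℕ)} (hE : ∀ e ∈ E, e.1 < N ∧ e.2 < N)
    (σ : V ≃ Fin N) (hσ : ∀ i j : V, Nonempty (((i ⟶ j) ⊕ (j ⟶ i)) ≃
      Fin (E.count ((σ i).val, (σ j).val) + E.count ((σ j).val, (σ i).val)))) {o : V}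
    (h1 : neighbourSum E (σ o) (fun _ => 1) ≤ 1) :
    (∀ e : QuiverArrow V, arrowSource e ≠ o) ∨ ∀ e : QuiverArrow V, arrowTarget e ≠ o := by
  by_contra! h
  obtain ⟨⟨⟨p, p', a⟩, rfl⟩, ⟨⟨r, r', b⟩, hb⟩⟩ := h
  obtain rfl : r' = p := hb
  have : Fintype V := Fintype.ofEquiv _ σ.symm
  rw [neighbourSum_eq hE, ← σ.sum_comp] at h1
  let X := Σ q : V, Fin (E.count ((σ r').val, (σ q).val) + E.count ((σ q).val, (σ r').val))
  have hX : Subsingleton X := by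
    rw [← Fintype.card_le_one_iff_subsingleton, Fintype.card_sigma]
    simpa using h1
  have h2 : (⟨p', (hσ r' p').some (Sum.inl a)⟩ : X) = ⟨r, (hσ r' r).some (Sum.inr b)⟩ :=
    Subsingleton.elim _ _
  obtain rfl : p' = r := congrArg Sigma.fst h2
  exact Sum.inl_ne_inr ((hσ r' p').some.injective (eq_of_heq (Sigma.mk.inj h2).2))

theorem sum_map_range {M : Type*} [AddCommMonoid M] (n : ℕ) (f : ℕ → M) :
    ((List.range n).map f).sum = ∑ i ∈ Finset.range n, f i := rfl

theorem neighbourSum_cycle {M : Type*} [AddCommMonoid M] {n p : ℕ} (hn : 1 ≤ n) (hp : p < n + 1)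
    (g : ℕ → M) : neighbourSum (ExtDynkin.A n hn).edges p g =
      g ((p + 1) % (n + 1)) + g ((p + n) % (n + 1)) := by
  have h1 : ∀ i < n + 1, (i + 1) % (n + 1) = p ↔ i = (p + n) % (n + 1) := by
    intro i hi
    rcases Nat.eq_zero_or_pos p with rfl | hp0
    · rw [zero_add, Nat.mod_eq_of_lt (by omega : n < n + 1)]
      constructor
      · intro h
        by_contra hne
        rw [Nat.mod_eq_of_lt (by omega)] at h
        omega
      · rintro rfl
        exact Nat.mod_self _
    · have h2 : (p + n) % (n + 1) = p - 1 := by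
        rw [show p + n = p - 1 + (n + 1) by omega, Nat.add_mod_right, Nat.mod_eq_of_lt (by omega)]
      rw [h2]
      constructor
      · intro h
        by_cases hi' : i = n
        · rw [hi', Nat.mod_self] at h
          omega
        · rw [Nat.mod_eq_of_lt (by omega)] at h
          omega
      · rintro rfl
        rw [Nat.mod_eq_of_lt (by omega)]
        omega
  rw [neighbourSum, ExtDynkin.edges, List.map_map, sum_map_range]
  simp only [Function.comp_apply]
  rw [Finset.sum_add_distrib, Finset.sum_ite_eq', if_pos (Finset.mem_range.2 hp)]
  congr 1
  rw [Finset.sum_congr rfl fun i hi => by rw [if_congr (h1 i (Finset.mem_range.1 hi)) rfl rfl],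
    Finset.sum_ite_eq', if_pos (Finset.mem_range.2 (Nat.mod_lt _ (by omega)))]

theorem isAdj_cycle {n p q : ℕ} (hn : 1 ≤ n) (h : IsAdj (ExtDynkin.A n hn).edges p q) :
    (p < n + 1 ∧ q = (p + 1) % (n + 1)) ∨ (q < n + 1 ∧ p = (q + 1) % (n + 1)) := by
  rcases h with h | h
  all_goals
    simp only [ExtDynkin.edges, List.mem_map, List.mem_range, Prod.mk.injEq] at h
    obtain ⟨i, hi, rfl, rfl⟩ := h
  · exact Or.inl ⟨hi, rfl⟩
  · exact Or.inr ⟨hi, rfl⟩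

/-- For a cycle all spaces are `ℂ` and all maps are `1` or `-1`. -/
theorem isSubspaceSystem_cycle {n : ℕ} (hn : 2 ≤ n) :
    IsSubspaceSystem (C := ℂ) (n + 1) (ExtDynkin.A n (by omega)).edges (fun _ => ⊤)
      (fun _ _ => LinearMap.id) fun p q => if q = (p + 1) % (n + 1) then 1 else -1 := by
  have hne : ∀ p < n + 1, ∀ q, q = (p + 1) % (n + 1) → p ≠ (q + 1) % (n + 1) := by
    rintro p hp _ rfl h
    rw [Nat.mod_add_mod] at h
    rcases lt_or_ge (p + 1 + 1) (n + 1) with h1 | h1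
    · rw [Nat.mod_eq_of_lt h1] at h
      omega
    · rw [Nat.mod_eq_sub_mod h1, Nat.mod_eq_of_lt (by omega)] at h
      omega
  -- Two families indexed by the vertices agree if they agree at adjacent vertices.
  have hconn : ∀ {X : Type} (f : ℕ → X),
      (∀ p q, IsAdj (ExtDynkin.A n (by omega)).edges p q → f p = f q) →
      ∀ p < n + 1, f p = f 0 := by
    intro X f hf p hp
    induction p with
    | zero => rfl
    | succ p ih =>
      rw [← ih (by omega)]
      refine (hf p (p + 1) (Or.inl ?_)).symm
      simp only [ExtDynkin.edges, List.mem_map, List.mem_range]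
      exact ⟨p, by omega, by rw [Nat.mod_eq_of_lt hp]⟩
  have hadj : ∀ p q, IsAdj (ExtDynkin.A n (by omega)).edges p q → _ :=
    fun p q => isAdj_cycle (by omega)
  refine ⟨fun e he => ?_, fun _ _ => rfl, fun p q h => ?_, fun p q h => ?_,
    fun p q _ => Or.inl ⟨le_rfl, by simp⟩, fun p hp x _ => ?_, fun p hp => ?_, ?_,
    fun W _ h => ?_, fun g _ h => ?_⟩
  · simp only [ExtDynkin.edges, List.mem_map, List.mem_range] at he
    obtain ⟨i, hi, rfl⟩ := he
    exact ⟨hi, Nat.mod_lt _ (by omega)⟩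
  · rcases hadj p q h with ⟨h1, h2⟩ | ⟨h1, h2⟩
    · rw [if_pos h2, if_neg (hne p h1 q h2)]
    · rw [if_pos h2, if_neg (hne q h1 p h2), neg_neg]
  · split_ifs <;> norm_num
  · rw [neighbourSum_cycle (by omega) hp, if_pos rfl, if_neg]
    · simp
    · intro h
      refine hne ((p + n) % (n + 1)) (Nat.mod_lt _ (by omega)) p ?_ h
      rw [Nat.mod_add_mod, add_assoc, Nat.add_mod_right, Nat.mod_eq_of_lt hp]
  · rw [neighbourSum_cycle (by omega) hp]
    simp
  · refine ⟨0, 1, Or.inl ?_, by simp, by simp, fun _ => ⟨1, by simp⟩, fun _ => ⟨1, by simp⟩⟩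
    simp only [ExtDynkin.edges, List.mem_map, List.mem_range]
    exact ⟨0, by omega, by rw [Nat.mod_eq_of_lt (by omega)]⟩
  · have h1 := hconn W fun p q hpq => by
      rcases h p q hpq with ⟨-, h1, h2⟩ | ⟨-, h1, h2⟩
      · exact le_antisymm h1 h2
      · exact le_antisymm h2 h1
    rcases eq_bot_or_eq_top (W 0) with h0 | h0
    · exact Or.inl fun p hp => by rw [h1 p hp, h0]
    · exact Or.inr fun p hp => by rw [h1 p hp, h0]
  · have h1 := hconn (fun p => g p 1) fun p q hpq => by
      rcases h p q hpq with ⟨-, h1⟩ | ⟨-, h1⟩ | ⟨h1, -⟩ | ⟨h1, -⟩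
      · exact (h1 1 trivial).symm
      · exact h1 1 trivial
      · exact absurd le_rfl h1
      · exact absurd le_rfl h1
    refine ⟨g 0 1, fun p hp x _ => ?_⟩
    have h2 := (g p).map_smul x 1
    rw [smul_eq_mul, mul_one] at h2
    rw [h2, h1 p hp, smul_eq_mul, smul_eq_mul, mul_comm]

/-- The theorem for the Kronecker quiver. The two arrows have to be treated differently, and the
homogeneous brick is `(1, 1)`, with `ζ = (1, -1)`. -/
theorem exists_singular_of_kronecker (hac : IsAcyclicQuiver V)
    (σ : V ≃ Fin (ExtDynkin.A 1 le_rfl).numVertices)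
    (hσ : ∀ i j : V, Nonempty (((i ⟶ j) ⊕ (j ⟶ i)) ≃
      Fin ((ExtDynkin.A 1 le_rfl).mult (σ i) (σ j)))) :
    ∃ (X : QuiverRep V) (e : V → ℕ),
      Indecomposable X ∧ LiesInHomogeneousTube X ∧ IsSingularQuiverGrassmannian X e := by
  have hfin : Fintype V := Fintype.ofEquiv _ σ.symm
  have hV : Nonempty V := ⟨σ.symm ⟨0, by decide⟩⟩
  have : ∀ p q : V, Finite (p ⟶ q) := fun p q =>
    Finite.of_injective (fun a => (hσ p q).some (Sum.inl a))
      ((hσ p q).some.injective.comp Sum.inl_injective)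
  have : Fintype (QuiverArrow V) := Fintype.ofFinite _
  obtain ⟨b, hb⟩ := hac.exists_sink
  obtain ⟨a, hab, hV2⟩ : ∃ a : V, a ≠ b ∧ ∀ p, p ≠ b → p = a := by
    have h2 : ∀ i : Fin 2, ∃ j, j ≠ i ∧ ∀ k, k ≠ i → k = j := by decide
    obtain ⟨j, h3, h4⟩ := h2 (σ b)
    exact ⟨σ.symm j, fun h => h3 (by rw [← h]; exact (σ.apply_symm_apply j).symm),
      fun p hp => by rw [← h4 (σ p) fun h => hp (σ.injective h)]; exact (σ.symm_apply_apply p).symm⟩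
  have hs : ∀ e : QuiverArrow V, arrowSource e = a := fun e => hV2 _ (hb e)
  have ht : ∀ e : QuiverArrow V, arrowTarget e = b := fun e => by
    by_contra h
    obtain ⟨p, q, c⟩ := e
    obtain rfl : p = a := hs ⟨p, q, c⟩
    obtain rfl : q = p := hV2 q h
    exact one_ne_zero (hac q c.toPath)
  have hsum : ∀ m : V → ℕ, ∑ e : QuiverArrow V, (m (arrowSource e) + m (arrowTarget e)) =
      2 * ∑ p, m p := by
    intro m
    rw [sum_arrows_eq σ hσ fun p _ => m p, Finset.mul_sum]
    refine Finset.sum_congr rfl fun p _ => ?_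
    rw [← Finset.sum_smul, smul_eq_mul]
    congr 1
    have h2 : ∀ i : Fin 2, ∑ j : Fin 2, ((ExtDynkin.A 1 le_rfl).edges.count (i.val, j.val) +
      (ExtDynkin.A 1 le_rfl).edges.count (j.val, i.val)) = 2 := by decide
    rw [← h2 (σ p)]
    exact σ.sum_comp fun j : Fin 2 => (ExtDynkin.A 1 le_rfl).edges.count ((σ p).val, j.val) +
      (ExtDynkin.A 1 le_rfl).edges.count (j.val, (σ p).val)
  have hcard : Fintype.card (QuiverArrow V) = 2 := by
    have h1 := hsum fun _ => 1
    have h2 : Fintype.card V = 2 := Fintype.card_congr σ |>.trans (Fintype.card_fin _)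
    simp only [Finset.sum_const, Finset.card_univ, smul_eq_mul, h2] at h1
    omega
  let φ : QuiverArrow V ≃ Fin 2 := Fintype.equivFinOfCardEq hcard
  -- The representation with both maps equal to `1`; the preprojective relation requires the two
  -- opposite maps to have sum zero.
  let z : QuiverArrow V → ℂ := fun e => ![1, -1] (φ e)
  have hz : ∀ e, z e ≠ 0 := fun e => by
    have : ∀ i : Fin 2, (![1, -1] i : ℂ) ≠ 0 := by
      intro i
      fin_cases i <;> simp
    exact this _
  have hz0 : ∑ e, z e = 0 := by
    have := φ.sum_comp fun i => (![1, -1] i : ℂ)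
    simp only [Fin.sum_univ_two] at this
    refine this.trans ?_
    simp
  have : Nonempty (QuiverArrow V) := ⟨φ.symm 0⟩
  obtain ⟨e₀⟩ := this
  let ξ : C1 (V := V) arrowSource arrowTarget (fun _ => ℂ) fun _ => ℂ := fun _ => LinearMap.id
  let ζ : C1 (V := V) arrowTarget arrowSource (fun _ => ℂ) fun _ => ℂ :=
    fun e => z e • LinearMap.id
  have hB : IsHomogeneousBrick ξ ζ := by
    refine ⟨fun c => ?_, ⟨fun W h1 h2 => ?_, fun W h1 h2 => ?_⟩, fun m => ?_, fun c hc => ?_⟩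
    · have h1 : ∀ e, LinearMap.trace ℂ ℂ (coboundary ξ ξ c e ∘ₗ ζ e) =
          z e * LinearMap.trace ℂ ℂ (c b - c a) := fun e => by
        have h2 : coboundary ξ ξ c e ∘ₗ ζ e =
            z e • (c (arrowTarget e) - c (arrowSource e)) := by
          refine LinearMap.ext fun x => ?_
          have h3 : ∀ p, c p (z e * x) = z e * c p x := fun p => (c p).map_smul (z e) x
          change c (arrowTarget e) (z e * x) - c (arrowSource e) (z e * x) =
            z e * (c (arrowTarget e) x - c (arrowSource e) x)
          rw [h3, h3, mul_sub]
        rw [h2, map_smul, hs, ht, smul_eq_mul]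
      rw [Finset.sum_congr rfl fun e _ => h1 e, ← Finset.sum_mul, hz0, zero_mul]
    · have hWb : W b = ⊥ := by
        rw [eq_bot_iff]
        intro x hx
        have := h2 e₀ (by rw [ht]; exact hx)
        have h3 : z e₀ * x = 0 := this
        exact (mul_eq_zero.1 h3).resolve_left (hz _)
      intro p
      by_cases hp : p = b
      · rw [hp, hWb]
      · rw [hV2 p hp, eq_bot_iff, ← hWb]
        have := h1 e₀
        rw [hs, ht] at this
        exact this
    · have hWa : W a = ⊤ := by
        rw [eq_top_iff]
        intro x _
        have := h2 e₀ ⟨(z e₀)⁻¹ * x, rfl⟩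
        rw [hs] at this
        have h3 : ζ e₀ ((z e₀)⁻¹ * x) = x := by
          change z e₀ * ((z e₀)⁻¹ * x) = x
          rw [mul_inv_cancel_left₀ (hz _)]
        rwa [h3] at this
      intro p
      by_cases hp : p = b
      · rw [hp, eq_top_iff, ← hWa]
        have := h1 e₀
        rw [hs, ht] at this
        exact this
      · rw [hV2 p hp, hWa]
    · simpa using hsum m
    · rw [mem_ker_coboundary] at hc
      have h1 : c b = c a := by
        have := hc e₀
        rw [← ht e₀, ← hs e₀]
        exact this
      have h2 : ∀ p, c p = c a := fun p => by
        by_cases hp : p = b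
        · rw [hp, h1]
        · rw [hV2 p hp]
      refine ⟨c a 1, fun p => ?_⟩
      rw [h2]
      ext
      simp
  exact hB.exists_singular (o := b) (by simp) (Or.inl hb)

end Cycle

/-! ### Type D -/

namespace TypeD

/-- The vertices of the path `2, …, n - 2`. -/
abbrev IsInner (n p : ℕ) : Prop := 2 ≤ p ∧ p ≤ n - 2

/-- The operators belonging to the four leaves; their kernels are the lines spanned by `(1, 0)`,
`(0, 1)`, `(1, 1)`, `(1, -1)`, and their sum is zero. -/
noncomputable def leafOp (n p : ℕ) : ℂ × ℂ →ₗ[ℂ] ℂ × ℂ :=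
  let x := LinearMap.fst ℂ ℂ ℂ
  let y := LinearMap.snd ℂ ℂ ℂ
  if p = 0 then ((-2 : ℂ) • y).prod 0 else if p = 1 then (0 : ℂ × ℂ →ₗ[ℂ] ℂ).prod ((2 : ℂ) • x)
  else if p = n - 1 then (y - x).prod (y - x) else (x + y).prod (-(x + y))

/-- The operator belonging to the edges of the path. -/
noncomputable def pathOp : ℂ × ℂ →ₗ[ℂ] ℂ × ℂ :=
  ((-2 : ℂ) • LinearMap.snd ℂ ℂ ℂ).prod ((2 : ℂ) • LinearMap.fst ℂ ℂ ℂ)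

/-- The operators belonging to the edges. -/
noncomputable def op (n p q : ℕ) : ℂ × ℂ →ₗ[ℂ] ℂ × ℂ :=
  if IsInner n p then if IsInner n q then pathOp else leafOp n q
  else if IsInner n q then leafOp n p else 0

/-- The spaces at the vertices. -/
noncomputable def space (n p : ℕ) : Submodule ℂ (ℂ × ℂ) :=
  if IsInner n p then ⊤ else LinearMap.ker (leafOp n p)

/-- A height function that determines the signs: leaves are lower than the vertices of the path. -/
def height (n p : ℕ) : ℕ := if IsInner n p then p else 0

/-- The signs. -/
noncomputable def sign (n p q : ℕ) : ℂ := if height n q < height n p then 1 else -1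

variable {n : ℕ}

theorem leafOp_cases (n p : ℕ) :
    (p = 0 ∧ ∀ x, leafOp n p x = (-2 * x.2, 0)) ∨ (p = 1 ∧ ∀ x, leafOp n p x = (0, 2 * x.1)) ∨
    (p ≠ 0 ∧ p ≠ 1 ∧ p = n - 1 ∧ ∀ x, leafOp n p x = (x.2 - x.1, x.2 - x.1)) ∨
    (p ≠ 0 ∧ p ≠ 1 ∧ p ≠ n - 1 ∧ ∀ x, leafOp n p x = (x.1 + x.2, -(x.1 + x.2))) := by
  unfold leafOp
  by_cases h0 : p = 0
  · exact Or.inl ⟨h0, fun x => by simp [h0]⟩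
  by_cases h1 : p = 1
  · exact Or.inr (Or.inl ⟨h1, fun x => by simp [h1]⟩)
  by_cases h2 : p = n - 1
  · refine Or.inr (Or.inr (Or.inl ⟨h0, h1, h2, fun x => ?_⟩))
    rw [if_neg h0, if_neg h1, if_pos h2]
    rfl
  · refine Or.inr (Or.inr (Or.inr ⟨h0, h1, h2, fun x => ?_⟩))
    rw [if_neg h0, if_neg h1, if_neg h2]
    rfl

theorem pathOp_apply (x : ℂ × ℂ) : pathOp x = (-2 * x.2, 2 * x.1) := rfl

theorem leafOp_leafOp (p : ℕ) (x : ℂ × ℂ) : leafOp n p (leafOp n p x) = 0 := by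
  rcases leafOp_cases n p with ⟨-, h⟩ | ⟨-, h⟩ | ⟨-, -, -, h⟩ | ⟨-, -, -, h⟩ <;> simp [h]

/-- The kernels of the operators of the leaves are their images, and lines. -/
theorem leafOp_spec (n p : ℕ) : (∀ x ∈ LinearMap.ker (leafOp n p), ∃ y, leafOp n p y = x) ∧
    Module.finrank ℂ (LinearMap.ker (leafOp n p)) = 1 ∧ ∃ x, leafOp n p x ≠ 0 := by
  have key : ∀ v w : ℂ × ℂ, v ≠ 0 → leafOp n p w = v →
      (∀ x, leafOp n p x = 0 → ∃ c : ℂ, x = c • v) → 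
      (∀ x ∈ LinearMap.ker (leafOp n p), ∃ y, leafOp n p y = x) ∧
        Module.finrank ℂ (LinearMap.ker (leafOp n p)) = 1 ∧ ∃ x, leafOp n p x ≠ 0 := by
    intro v w hv hw h
    refine ⟨fun x hx => ?_, ?_, w, by rwa [hw]⟩
    · obtain ⟨c, rfl⟩ := h x hx
      exact ⟨c • w, by rw [map_smul, hw]⟩
    · have : LinearMap.ker (leafOp n p) = Submodule.span ℂ {v} := by
        refine le_antisymm (fun x hx => ?_) ?_
        · obtain ⟨c, rfl⟩ := h x hx
          exact Submodule.smul_mem _ _ (Submodule.mem_span_singleton_self v)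
        · rw [Submodule.span_le, Set.singleton_subset_iff]
          change leafOp n p v = 0
          rw [← hw, leafOp_leafOp]
      rw [this, finrank_span_singleton hv]
  rcases leafOp_cases n p with ⟨-, h⟩ | ⟨-, h⟩ | ⟨-, -, -, h⟩ | ⟨-, -, -, h⟩
  · refine key (1, 0) (0, -1 / 2) (by simp) (by rw [h]; norm_num) fun x hx => ⟨x.1, ?_⟩
    rw [h] at hx
    simp only [Prod.mk_eq_zero, mul_eq_zero] at hx
    ext <;> simp
    simpa using hx
  · refine key (0, 1) (1 / 2, 0) (by simp) (by rw [h]; norm_num) fun x hx => ⟨x.2, ?_⟩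
    rw [h] at hx
    simp only [Prod.mk_eq_zero, mul_eq_zero] at hx
    ext <;> simp
    simpa using hx
  · refine key (1, 1) (0, 1) (by simp) (by rw [h]; norm_num) fun x hx => ⟨x.1, ?_⟩
    rw [h] at hx
    simp only [Prod.mk_eq_zero] at hx
    ext <;> simp
    linear_combination hx.1
  · refine key (1, -1) (1, 0) (by simp) (by rw [h]; norm_num) fun x hx => ⟨x.1, ?_⟩
    rw [h] at hx
    simp only [Prod.mk_eq_zero] at hx
    ext <;> simp
    linear_combination hx.1

theorem space_of_isInner {p : ℕ} (h : IsInner n p) : space n p = ⊤ := if_pos h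

theorem space_of_not_isInner {p : ℕ} (h : ¬ IsInner n p) :
    space n p = LinearMap.ker (leafOp n p) := if_neg h

theorem not_top_le {p : ℕ} (h : ¬ IsInner n p) : ¬ ⊤ ≤ space n p := by
  rw [space_of_not_isInner h, top_le_iff, LinearMap.ker_eq_top]
  intro h0
  obtain ⟨x, hx⟩ := (leafOp_spec n p).2.2
  exact hx (by rw [h0]; rfl)

theorem isAdj_cases (hn : 4 ≤ n) {p q : ℕ} (h : IsAdj (ExtDynkin.D n hn).edges p q) :
    (IsInner n p ∧ IsInner n q ∧ (q = p + 1 ∨ p = q + 1)) ∨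
      (IsInner n p ∧ ¬ IsInner n q) ∨ (¬ IsInner n p ∧ IsInner n q) := by
  simp only [IsAdj, ExtDynkin.edges, List.mem_append, List.mem_map, List.mem_range, List.mem_cons,
    Prod.mk.injEq, List.not_mem_nil, or_false] at h
  rcases h with (((⟨rfl, rfl⟩ | ⟨rfl, rfl⟩) | ⟨i, hi, rfl, rfl⟩) | ⟨rfl, rfl⟩) |
    (((⟨rfl, rfl⟩ | ⟨rfl, rfl⟩) | ⟨i, hi, rfl, rfl⟩) | ⟨rfl, rfl⟩)
  · exact Or.inr (Or.inr ⟨by simp [IsInner], le_rfl, by omega⟩)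
  · exact Or.inr (Or.inr ⟨by simp [IsInner], le_rfl, by omega⟩)
  · by_cases h : i + 3 ≤ n - 2
    · exact Or.inl ⟨⟨by omega, by omega⟩, ⟨by omega, h⟩, Or.inl rfl⟩
    · exact Or.inr (Or.inl ⟨⟨by omega, by omega⟩, fun h' => h h'.2⟩)
  · exact Or.inr (Or.inl ⟨⟨by omega, le_rfl⟩, fun h' => by have := h'.2; omega⟩)
  · exact Or.inr (Or.inl ⟨⟨le_rfl, by omega⟩, by simp [IsInner]⟩)
  · exact Or.inr (Or.inl ⟨⟨le_rfl, by omega⟩, by simp [IsInner]⟩)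
  · by_cases h : i + 3 ≤ n - 2
    · exact Or.inl ⟨⟨by omega, h⟩, ⟨by omega, by omega⟩, Or.inr rfl⟩
    · exact Or.inr (Or.inr ⟨fun h' => h h'.2, by omega, by omega⟩)
  · exact Or.inr (Or.inr ⟨fun h' => by have := h'.2; omega, by omega, le_rfl⟩)

theorem isAdj_path (hn : 4 ≤ n) {p : ℕ} (h : 2 ≤ p) (h' : p ≤ n - 2) :
    IsAdj (ExtDynkin.D n hn).edges p (p + 1) := by
  refine Or.inl ?_
  simp only [ExtDynkin.edges, List.mem_append, List.mem_map, List.mem_range]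
  exact Or.inl (Or.inr ⟨p - 2, by omega, by ext <;> simp <;> omega⟩)

theorem isAdj_leaf (hn : 4 ≤ n) {p : ℕ} (hp : p < n + 1) (h : ¬ IsInner n p) :
    ∃ q, IsInner n q ∧ IsAdj (ExtDynkin.D n hn).edges p q := by
  have h1 : p = 0 ∨ p = 1 ∨ p = n - 1 ∨ p = n := by
    simp only [IsInner] at h
    omega
  rcases h1 with rfl | rfl | rfl | rfl
  · exact ⟨2, ⟨le_rfl, by omega⟩, Or.inl (by simp [ExtDynkin.edges])⟩
  · exact ⟨2, ⟨le_rfl, by omega⟩, Or.inl (by simp [ExtDynkin.edges])⟩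
  · have := isAdj_path hn (p := n - 2) (by omega) le_rfl
    rw [show n - 2 + 1 = n - 1 by omega] at this
    exact ⟨n - 2, ⟨by omega, le_rfl⟩, this.symm⟩
  · exact ⟨p - 2, ⟨by omega, le_rfl⟩, Or.inr (by simp [ExtDynkin.edges])⟩

theorem neighbourSum_eq_ite {M : Type*} [AddCommMonoid M] (hn : 4 ≤ n) (p : ℕ) (g : ℕ → M) :
    neighbourSum (ExtDynkin.D n hn).edges p g =
      (((if 0 = p then g 2 else 0) + if 2 = p then g 0 else 0) +
        ((if 1 = p then g 2 else 0) + if 2 = p then g 1 else 0)) +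
      ((if 2 ≤ p ∧ p ≤ n - 2 then g (p + 1) else 0) +
        if 3 ≤ p ∧ p ≤ n - 1 then g (p - 1) else 0) +
      ((if n - 2 = p then g n else 0) + if n = p then g (n - 2) else 0) := by
  rw [neighbourSum, ExtDynkin.edges, List.map_append, List.map_append, List.map_map,
    List.sum_append, List.sum_append, sum_map_range]
  congr 2
  · simp
  · simp only [Function.comp_apply]
    rw [Finset.sum_add_distrib]
    congr 1
    · split_ifs with h
      · rw [Finset.sum_eq_single (p - 2)]
        · rw [if_pos (by omega)]
          congr 1
          omega
        · intro i _ hi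
          rw [if_neg (by omega)]
        · intro hi
          simp only [Finset.mem_range] at hi
          omega
      · refine Finset.sum_eq_zero fun i hi => if_neg ?_
        simp only [Finset.mem_range] at hi
        omega
    · split_ifs with h
      · rw [Finset.sum_eq_single (p - 3)]
        · rw [if_pos (by omega)]
          congr 1
          omega
        · intro i _ hi
          rw [if_neg (by omega)]
        · intro hi
          simp only [Finset.mem_range] at hi
          omega
      · refine Finset.sum_eq_zero fun i hi => if_neg ?_
        simp only [Finset.mem_range] at hi
        omega
  · simp

/-- The neighbours of the vertices: a leaf has one inner neighbour, and the other vertices have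
four leaves, two leaves and an inner vertex, or two inner vertices as neighbours. -/
theorem neighbourSum_cases (hn : 4 ≤ n) {p : ℕ} (hp : p < n + 1) :
    (¬ IsInner n p ∧ ∃ q, IsInner n q ∧ ∀ {M : Type} [AddCommMonoid M] (g : ℕ → M),
      neighbourSum (ExtDynkin.D n hn).edges p g = g q) ∨
    (IsInner n p ∧ n = 4 ∧ ∀ {M : Type} [AddCommMonoid M] (g : ℕ → M),
      neighbourSum (ExtDynkin.D n hn).edges p g = g 0 + g 1 + g (n - 1) + g n) ∨
    (IsInner n p ∧ IsInner n (p + 1) ∧ p = 2 ∧ ∀ {M : Type} [AddCommMonoid M] (g : ℕ → M),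
      neighbourSum (ExtDynkin.D n hn).edges p g = g 0 + g 1 + g (p + 1)) ∨
    (IsInner n p ∧ IsInner n (p - 1) ∧ ∀ {M : Type} [AddCommMonoid M] (g : ℕ → M),
      neighbourSum (ExtDynkin.D n hn).edges p g = g (p - 1) + g (n - 1) + g n) ∨
    (IsInner n p ∧ IsInner n (p - 1) ∧ IsInner n (p + 1) ∧ ∀ {M : Type} [AddCommMonoid M]
      (g : ℕ → M), neighbourSum (ExtDynkin.D n hn).edges p g = g (p - 1) + g (p + 1)) := by
  have h1 : (p = 0 ∨ p = 1) ∨ p = n - 1 ∨ p = n ∨ (n = 4 ∧ p = 2) ∨ (5 ≤ n ∧ p = 2) ∨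
      (5 ≤ n ∧ p = n - 2) ∨ (3 ≤ p ∧ p ≤ n - 3) := by omega
  rcases h1 with h | rfl | rfl | ⟨rfl, rfl⟩ | ⟨h, rfl⟩ | ⟨h, rfl⟩ | ⟨h, h'⟩
  · refine Or.inl ⟨by simp only [IsInner]; omega, 2, ⟨le_rfl, by omega⟩, fun g => ?_⟩
    rw [neighbourSum_eq_ite]
    rcases h with rfl | rfl
    · simp [show n - 2 ≠ 0 by omega, show n ≠ 0 by omega]
    · simp [show n - 2 ≠ 1 by omega, show n ≠ 1 by omega]
  · refine Or.inl ⟨by simp only [IsInner]; omega, n - 2, ⟨by omega, le_rfl⟩, fun g => ?_⟩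
    rw [neighbourSum_eq_ite]
    simp [show 0 ≠ n - 1 by omega, show 1 ≠ n - 1 by omega, show 2 ≠ n - 1 by omega,
      show ¬ n - 1 ≤ n - 2 by omega, show 3 ≤ n - 1 by omega, show n - 2 ≠ n - 1 by omega,
      show n ≠ n - 1 by omega, show n - 1 - 1 = n - 2 by omega]
  · refine Or.inl ⟨by simp only [IsInner]; omega, p - 2, ⟨by omega, le_rfl⟩, fun g => ?_⟩
    rw [neighbourSum_eq_ite]
    simp [show 0 ≠ p by omega, show 1 ≠ p by omega, show 2 ≠ p by omega,
      show ¬ p ≤ p - 2 by omega, show ¬ p ≤ p - 1 by omega, show p - 2 ≠ p by omega]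
  · refine Or.inr (Or.inl ⟨⟨le_rfl, le_rfl⟩, rfl, fun g => ?_⟩)
    rw [neighbourSum_eq_ite]
    simp
  · refine Or.inr (Or.inr (Or.inl ⟨⟨le_rfl, by omega⟩, ⟨by omega, by omega⟩, rfl, fun g => ?_⟩))
    rw [neighbourSum_eq_ite]
    simp [show 2 ≤ n - 2 by omega, show n - 2 ≠ 2 by omega, show n ≠ 2 by omega]
  · refine Or.inr (Or.inr (Or.inr (Or.inl ⟨⟨by omega, le_rfl⟩, ⟨by omega, by omega⟩,
      fun g => ?_⟩)))
    rw [neighbourSum_eq_ite]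
    simp [show 0 ≠ n - 2 by omega, show 1 ≠ n - 2 by omega, show 2 ≠ n - 2 by omega,
      show 2 ≤ n - 2 by omega, show 3 ≤ n - 2 by omega, show n - 2 ≤ n - 1 by omega,
      show n ≠ n - 2 by omega, show n - 2 + 1 = n - 1 by omega, add_comm (g (n - 1))]
  · refine Or.inr (Or.inr (Or.inr (Or.inr ⟨⟨by omega, by omega⟩, ⟨by omega, by omega⟩,
      ⟨by omega, by omega⟩, fun g => ?_⟩)))
    rw [neighbourSum_eq_ite]
    simp [show 0 ≠ p by omega, show 1 ≠ p by omega, show 2 ≠ p by omega,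
      show 2 ≤ p by omega, show 3 ≤ p by omega, show p ≤ n - 2 by omega, show p ≤ n - 1 by omega,
      show n ≠ p by omega, show n - 2 ≠ p by omega, add_comm (g (p + 1))]

theorem lt_of_mem_edges (hn : 4 ≤ n) : ∀ e ∈ (ExtDynkin.D n hn).edges, e.1 < n + 1 ∧ e.2 < n + 1 := by
  rintro ⟨a, b⟩ h
  simp only [ExtDynkin.edges, List.mem_append, List.mem_map, List.mem_range, List.mem_cons,
    Prod.mk.injEq, List.not_mem_nil, or_false] at h
  rcases h with ((⟨rfl, rfl⟩ | ⟨rfl, rfl⟩) | ⟨i, hi, rfl, rfl⟩) | ⟨rfl, rfl⟩ <;> simp only <;>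
    omega

theorem finrank_space {p : ℕ} :
    Module.finrank ℂ (space n p) = if IsInner n p then 2 else 1 := by
  split_ifs with h
  · rw [space_of_isInner h, finrank_top]
    simp
  · rw [space_of_not_isInner h, (leafOp_spec n p).2.1]

/-- Planes at the vertices of the path, and four lines with the cross ratio `-1` at the leaves. -/
theorem isSubspaceSystem (hn : 4 ≤ n) :
    IsSubspaceSystem (n + 1) (ExtDynkin.D n hn).edges (space n) (op n) (sign n) := by
  have hadj : ∀ p q, IsAdj (ExtDynkin.D n hn).edges p q → _ := fun p q => isAdj_cases hn
  have hin0 : ¬ IsInner n 0 := by simp [IsInner]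
  have hin1 : ¬ IsInner n 1 := by simp [IsInner]
  have hin3 : ¬ IsInner n (n - 1) := by simp only [IsInner]; omega
  have hin4 : ¬ IsInner n n := by simp only [IsInner]; omega
  have hin2 : IsInner n 2 := ⟨le_rfl, by omega⟩
  have hsymm : ∀ p q, op n p q = op n q p := fun p q => by
    by_cases hp : IsInner n p <;> by_cases hq : IsInner n q <;> rw [op, op]
    · rw [if_pos hp, if_pos hq, if_pos hq, if_pos hp]
    · rw [if_pos hp, if_neg hq, if_neg hq, if_pos hp]
    · rw [if_neg hp, if_pos hq, if_pos hq, if_neg hp]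
    · rw [if_neg hp, if_neg hq, if_neg hq, if_neg hp]
  have hheight : ∀ p q, IsAdj (ExtDynkin.D n hn).edges p q → height n p ≠ height n q := by
    intro p q h
    rcases hadj p q h with ⟨h1, h2, h3⟩ | ⟨h1, h2⟩ | ⟨h1, h2⟩ <;> rw [height, height]
    · rw [if_pos h1, if_pos h2]
      omega
    · rw [if_pos h1, if_neg h2]
      simp only [IsInner] at h1
      omega
    · rw [if_neg h1, if_pos h2]
      simp only [IsInner] at h2
      omega
  have hsleaf : ∀ p q, IsInner n p → ¬ IsInner n q → sign n p q = 1 := fun p q hp hq => by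
    rw [sign, height, height, if_pos hp, if_neg hq]
    exact if_pos (by simp only [IsInner] at hp; omega)
  have hspath : ∀ p q, IsInner n p → IsInner n q → sign n p q = if q < p then 1 else -1 :=
    fun p q hp hq => by rw [sign, height, height, if_pos hp, if_pos hq]
  have hpl : ∀ p q, IsInner n p → ¬ IsInner n q → op n p q = leafOp n q := fun p q hp hq => by
    rw [op, if_pos hp, if_neg hq]
  have hpp : ∀ p q, IsInner n p → IsInner n q → op n p q = pathOp := fun p q hp hq => by
    rw [op, if_pos hp, if_pos hq]
  have hl0 : ∀ x, leafOp n 0 x = (-2 * x.2, 0) := fun x => by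
    rcases leafOp_cases n 0 with ⟨-, h⟩ | ⟨h0, h⟩ | ⟨h0, h⟩ | ⟨h0, h⟩
    exacts [h x, absurd h0 (by omega), absurd rfl h0, absurd rfl h0]
  have hl1 : ∀ x, leafOp n 1 x = (0, 2 * x.1) := fun x => by
    rcases leafOp_cases n 1 with ⟨h0, h⟩ | ⟨h0, h⟩ | ⟨-, h0, h⟩ | ⟨-, h0, h⟩
    exacts [absurd h0 (by omega), h x, absurd rfl h0, absurd rfl h0]
  have hl3 : ∀ x, leafOp n (n - 1) x = (x.2 - x.1, x.2 - x.1) := fun x => by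
    rcases leafOp_cases n (n - 1) with ⟨h0, h⟩ | ⟨h0, h⟩ | ⟨-, -, -, h⟩ | ⟨-, -, h0, h⟩
    exacts [absurd h0 (by omega), absurd h0 (by omega), h x, absurd rfl h0]
  have hl4 : ∀ x, leafOp n n x = (x.1 + x.2, -(x.1 + x.2)) := fun x => by
    rcases leafOp_cases n n with ⟨h0, h⟩ | ⟨h0, h⟩ | ⟨-, -, h0, h⟩ | ⟨-, -, h0, h⟩
    exacts [absurd h0 (by omega), absurd h0 (by omega), absurd h0 (by omega), h x]
  -- A property of the inner vertices that is shared by adjacent ones.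
  have hconn : ∀ {X : Type} (f : ℕ → X), (∀ p q, IsAdj (ExtDynkin.D n hn).edges p q →
      IsInner n p → IsInner n q → f p = f q) → ∀ p, IsInner n p → f p = f 2 := by
    rintro X f hf p ⟨h1, h2⟩
    induction p, h1 using Nat.le_induction with
    | base => rfl
    | succ p hp ih =>
      rw [← ih (by omega)]
      exact (hf _ _ (isAdj_path hn hp (by omega)) ⟨hp, by omega⟩ ⟨by omega, h2⟩).symm
  refine ⟨lt_of_mem_edges hn, hsymm, fun p q h => ?_, fun p q _ => ?_, fun p q h => ?_,
    fun p hp x hx => ?_, fun p hp => ?_, ?_, fun W hW h => ?_, fun g hg h => ?_⟩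
  · have := hheight p q h
    rw [sign, sign]
    split_ifs
    · omega
    · exact (neg_neg 1).symm
    · rfl
    · omega
  · rw [sign]
    split_ifs <;> norm_num
  · rcases hadj p q h with ⟨h1, h2, -⟩ | ⟨h1, h2⟩ | ⟨h1, h2⟩
    · rw [space_of_isInner h1, space_of_isInner h2]
      exact Or.inl ⟨le_rfl, fun _ _ => trivial⟩
    · rw [hpl p q h1 h2, space_of_isInner h1, space_of_not_isInner h2]
      exact Or.inr ⟨le_top, fun x _ => leafOp_leafOp q x⟩
    · rw [hsymm, hpl q p h2 h1, space_of_isInner h2, space_of_not_isInner h1]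
      exact Or.inl ⟨le_top, fun x _ => leafOp_leafOp p x⟩
  · rcases neighbourSum_cases hn hp with ⟨h, q, hq, hs⟩ | ⟨h, -, hs⟩ | ⟨h, h', -, hs⟩ |
      ⟨h, h', hs⟩ | ⟨h, h', h'', hs⟩ <;> rw [hs]
    · rw [space_of_not_isInner h] at hx
      rw [hsymm, hpl q p hq h, LinearMap.mem_ker.1 hx, smul_zero]
    · simp only [hsleaf p _ h hin0, hsleaf p _ h hin1, hsleaf p _ h hin3, hsleaf p _ h hin4,
        hpl p _ h hin0, hpl p _ h hin1, hpl p _ h hin3, hpl p _ h hin4, hl0, hl1, hl3, hl4]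
      ext <;> simp <;> ring
    · simp only [hsleaf p _ h hin0, hsleaf p _ h hin1, hspath p _ h h', hpl p _ h hin0,
        hpl p _ h hin1, hpp p _ h h', hl0, hl1, pathOp_apply]
      ext <;> simp
    · have : p - 1 < p := by
        simp only [IsInner] at h
        omega
      simp only [hsleaf p _ h hin3, hsleaf p _ h hin4, hspath p _ h h', if_pos this,
        hpl p _ h hin3, hpl p _ h hin4, hpp p _ h h', hl3, hl4, pathOp_apply]
      ext <;> simp <;> ring
    · have : p - 1 < p := by
        simp only [IsInner] at h
        omega
      simp only [hspath p _ h h', hspath p _ h h'', if_pos this, hpp p _ h h', hpp p _ h h'']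
      simp
  · simp only [finrank_space]
    rcases neighbourSum_cases hn hp with ⟨h, q, hq, hs⟩ | ⟨h, -, hs⟩ | ⟨h, h', -, hs⟩ |
      ⟨h, h', hs⟩ | ⟨h, h', h'', hs⟩ <;> rw [hs]
    · rw [if_pos hq, if_neg h]
    · rw [if_neg hin0, if_neg hin1, if_neg hin3, if_neg hin4, if_pos h]
    · rw [if_neg hin0, if_neg hin1, if_pos h', if_pos h]
    · rw [if_pos h', if_neg hin3, if_neg hin4, if_pos h]
    · rw [if_pos h', if_pos h'', if_pos h]
  · refine ⟨2, 0, Or.inr (by simp [ExtDynkin.edges]), ?_, ?_, fun h => ?_, fun _ => ?_⟩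
    · intro h0
      have := finrank_space (n := n) (p := 2)
      rw [h0, if_pos hin2, finrank_bot] at this
      omega
    · intro h0
      have := finrank_space (n := n) (p := 0)
      rw [h0, if_neg hin0, finrank_bot] at this
      omega
    · rw [space_of_isInner hin2] at h
      exact absurd h (not_top_le hin0)
    · rw [hpl 2 0 hin2 hin0]
      exact ⟨(0, 1), by rw [space_of_isInner hin2]; trivial, by rw [hl0]; simp⟩
  · have hB : Function.Injective pathOp := by
      intro x y hxy
      simp only [pathOp_apply, Prod.mk.injEq] at hxy
      ext
      · linear_combination hxy.2 / 2
      · linear_combination -hxy.1 / 2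
    -- Since the operators of the path are injective, `W` is constant along the path.
    have hstep : ∀ W₁ W₂ : Submodule ℂ (ℂ × ℂ), W₁ ≤ W₂ → (∀ x ∈ W₂, pathOp x ∈ W₁) →
        W₁ = W₂ := by
      intro W₁ W₂ h1 h2
      refine Submodule.eq_of_le_of_finrank_le h1 ?_
      rw [(Submodule.equivMapOfInjective pathOp hB W₂).finrank_eq]
      exact Submodule.finrank_mono (Submodule.map_le_iff_le_comap.2 h2)
    have hW2 := hconn W fun p q hpq hp hq => by
      have := h p q hpq
      rw [hpp p q hp hq] at this
      rcases this with ⟨-, h1, h2⟩ | ⟨-, h1, h2⟩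
      · exact hstep _ _ h1 h2
      · exact (hstep _ _ h1 h2).symm
    have hleaf : ∀ p < n + 1, ¬ IsInner n p → W p ≤ W 2 ∧ ∀ x ∈ W 2, leafOp n p x ∈ W p := by
      intro p hp hpi
      obtain ⟨q, hq, hpq⟩ := isAdj_leaf hn hp hpi
      have := h p q hpq
      rw [hW2 q hq, hsymm, hpl q p hq hpi] at this
      rcases this with ⟨-, h1, h2⟩ | ⟨h1, -, -⟩
      · exact ⟨h1, h2⟩
      · rw [space_of_isInner hq] at h1
        exact absurd h1 (not_top_le hpi)
    by_cases h0 : W 2 = ⊥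
    · refine Or.inl fun p hp => ?_
      by_cases hpi : IsInner n p
      · rw [hW2 p hpi, h0]
      · rw [eq_bot_iff, ← h0]
        exact (hleaf p hp hpi).1
    · have htop : W 2 = ⊤ := by
        obtain ⟨x, hx, hx0⟩ := Submodule.exists_mem_ne_zero_of_ne_bot h0
        have h1 : ∀ y ∈ W 2, ((-2 * y.2, 0) : ℂ × ℂ) ∈ W 2 := fun y hy => by
          rw [← hl0]
          exact (hleaf 0 (by omega) hin0).1 ((hleaf 0 (by omega) hin0).2 y hy)
        have h2 : ∀ y ∈ W 2, ((0, 2 * y.1) : ℂ × ℂ) ∈ W 2 := fun y hy => by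
          rw [← hl1]
          exact (hleaf 1 (by omega) hin1).1 ((hleaf 1 (by omega) hin1).2 y hy)
        have h3 : ((1, 0) : ℂ × ℂ) ∈ W 2 ∧ ((0, 1) : ℂ × ℂ) ∈ W 2 := by
          have h4 : ∀ a : ℂ, a ≠ 0 → ((0, 2 * a) : ℂ × ℂ) ∈ W 2 →
              ((1, 0) : ℂ × ℂ) ∈ W 2 ∧ ((0, 1) : ℂ × ℂ) ∈ W 2 := by
            intro a ha h5
            have h6 := Submodule.smul_mem _ (2 * a)⁻¹ h5
            have h7 : (2 * a)⁻¹ • ((0, 2 * a) : ℂ × ℂ) = (0, 1) := by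
              ext <;> simp
              field_simp
            rw [h7] at h6
            have h8 := Submodule.smul_mem _ (-(1 / 2) : ℂ) (h1 _ h6)
            have h9 : (-(1 / 2) : ℂ) • ((-2 * 1, 0) : ℂ × ℂ) = (1, 0) := by
              ext <;> simp
            exact ⟨h9 ▸ h8, h6⟩
          by_cases hx1 : x.1 = 0
          · have hx2 : x.2 ≠ 0 := fun h => hx0 (Prod.ext hx1 h)
            exact h4 (-2 * x.2) (by simpa using hx2) (h2 _ (h1 x hx))
          · exact h4 x.1 hx1 (h2 x hx)
        rw [eq_top_iff]
        rintro ⟨a, b⟩ -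
        have := add_mem (Submodule.smul_mem _ a h3.1) (Submodule.smul_mem _ b h3.2)
        simpa using this
      refine Or.inr fun p hp => ?_
      by_cases hpi : IsInner n p
      · rw [hW2 p hpi, htop, space_of_isInner hpi]
      · refine le_antisymm (hW p) fun x hx => ?_
        rw [space_of_not_isInner hpi] at hx
        obtain ⟨y, rfl⟩ := (leafOp_spec n p).1 x hx
        exact (hleaf p hp hpi).2 y (by rw [htop]; trivial)
  · have hg2 := hconn g fun p q hpq hp hq => by
      have := h p q hpq
      rw [space_of_isInner hp, space_of_isInner hq] at this
      rcases this with ⟨-, h1⟩ | ⟨-, h1⟩ | ⟨h1, -⟩ | ⟨h1, -⟩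
      · exact LinearMap.ext fun x => (h1 x trivial).symm
      · exact LinearMap.ext fun x => h1 x trivial
      · exact absurd le_rfl h1
      · exact absurd le_rfl h1
    have hleaf : ∀ p < n + 1, ¬ IsInner n p → (∀ x, leafOp n p x = 0 → g 2 x = g p x) ∨
        ∀ x, g p (leafOp n p x) = leafOp n p (g 2 x) := by
      intro p hp hpi
      obtain ⟨q, hq, hpq⟩ := isAdj_leaf hn hp hpi
      have := h p q hpq
      rw [hg2 q hq, hsymm, hpl q p hq hpi, space_of_isInner hq] at this
      rcases this with ⟨-, h1⟩ | ⟨h1, -⟩ | ⟨h1, -⟩ | ⟨-, h1⟩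
      · rw [space_of_not_isInner hpi] at h1
        exact Or.inl h1
      · exact absurd h1 (not_top_le hpi)
      · exact absurd le_top h1
      · exact Or.inr fun x => h1 x trivial
    have hker : ∀ p < n + 1, ¬ IsInner n p → ∀ x, leafOp n p x = 0 → leafOp n p (g 2 x) = 0 := by
      intro p hp hpi x hx
      rcases hleaf p hp hpi with h1 | h1
      · rw [h1 x hx]
        have := hg p x (by rw [space_of_not_isInner hpi]; exact hx)
        rw [space_of_not_isInner hpi] at this
        exact this
      · rw [← h1, hx, map_zero]
    -- The operator `g 2` preserves the lines spanned by `(1, 0)`, `(0, 1)` and `(1, 1)`.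
    have h1 := hker 0 (by omega) hin0 (1, 0) (by rw [hl0]; simp)
    have h2 := hker 1 (by omega) hin1 (0, 1) (by rw [hl1]; simp)
    have h3 := hker (n - 1) (by omega) hin3 (1, 1) (by rw [hl3]; simp)
    have h4 : g 2 (1, 1) = g 2 (1, 0) + g 2 (0, 1) := by
      rw [← map_add]
      simp
    rw [hl0] at h1
    rw [hl1] at h2
    rw [hl3, h4] at h3
    simp only [Prod.mk_eq_zero, mul_eq_zero, neg_eq_zero, OfNat.ofNat_ne_zero, false_or, and_true,
      true_and, and_self, Prod.fst_add, Prod.snd_add] at h1 h2 h3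
    have h5 : ∀ x, g 2 x = (g 2 (1, 0)).1 • x := by
      intro x
      have h6 : x = x.1 • ((1, 0) : ℂ × ℂ) + x.2 • ((0, 1) : ℂ × ℂ) := by ext <;> simp
      have h7 : g 2 x = x.1 • g 2 (1, 0) + x.2 • g 2 (0, 1) := by
        conv_lhs => rw [h6]
        rw [map_add, map_smul, map_smul]
      rw [h7]
      ext
      · simp [h2, mul_comm]
      · simp only [Prod.snd_add, Prod.smul_snd, smul_eq_mul]
        linear_combination x.1 * h1 + x.2 * (h3 + h2 - h1)
    refine ⟨(g 2 (1, 0)).1, fun p hp x hx => ?_⟩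
    by_cases hpi : IsInner n p
    · rw [hg2 p hpi, h5]
    · rw [space_of_not_isInner hpi] at hx
      rcases hleaf p hp hpi with h6 | h6
      · rw [← h6 x hx, h5]
      · obtain ⟨y, rfl⟩ := (leafOp_spec n p).1 x hx
        rw [h6, h5, map_smul]

theorem exists_singular {V : Type u} [Quiver.{v} V] (hn : 4 ≤ n) (σ : V ≃ Fin (n + 1))
    (hσ : ∀ i j : V, Nonempty (((i ⟶ j) ⊕ (j ⟶ i)) ≃
      Fin ((ExtDynkin.D n hn).mult (σ i) (σ j)))) :
    ∃ (X : QuiverRep V) (e : V → ℕ),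
      Indecomposable X ∧ LiesInHomogeneousTube X ∧ IsSingularQuiverGrassmannian X e := by
  have h0 : ¬ IsInner n 0 := by simp [IsInner]
  have ho : (σ (σ.symm ⟨0, Nat.succ_pos n⟩)).val = 0 := by rw [σ.apply_symm_apply]
  refine exists_singular_of_system (isSubspaceSystem hn) σ hσ (o := σ.symm ⟨0, Nat.succ_pos n⟩)
    ?_ (sink_or_source_of_leaf (lt_of_mem_edges hn) σ hσ ?_) <;> rw [ho]
  · rw [finrank_space, if_neg h0]
  · rcases neighbourSum_cases hn (Nat.succ_pos n) with
      ⟨-, q, -, h⟩ | ⟨h, -⟩ | ⟨h, -⟩ | ⟨h, -⟩ | ⟨h, -⟩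
    · exact (h fun _ => 1).le
    all_goals exact absurd h h0

end TypeD

/-! ### Stars with three arms -/

section UniformNilpotent

variable {C : Type*} [AddCommGroup C] [Module ℂ C] [FiniteDimensional ℂ C] {A : Module.End ℂ C}

theorem finrank_ker_pow_le (A : Module.End ℂ C) (i : ℕ) :
    Module.finrank ℂ (LinearMap.ker (A ^ i)) ≤ Module.finrank ℂ (LinearMap.ker A) * i := by
  induction i with
  | zero =>
    have : LinearMap.ker (A ^ 0) = ⊥ := LinearMap.ker_eq_bot.2 fun _ _ h => h
    rw [this, finrank_bot]
    exact Nat.zero_le _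
  | succ i ih =>
    rw [← LinearMap.finrank_range_add_finrank_ker
      ((A ^ i).domRestrict (LinearMap.ker (A ^ (i + 1)))), mul_add, mul_one, add_comm]
    refine add_le_add ?_ (Submodule.finrank_mono ?_)
    · refine le_trans ?_ ih
      rw [← (Submodule.equivMapOfInjective _ (LinearMap.ker (A ^ (i + 1))).injective_subtype
        (LinearMap.ker ((A ^ i).domRestrict (LinearMap.ker (A ^ (i + 1)))))).symm.finrank_eq]
      refine Submodule.finrank_mono ?_
      rintro _ ⟨x, hx, rfl⟩
      exact hx
    · rintro _ ⟨⟨x, hx⟩, rfl⟩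
      rw [LinearMap.mem_ker, pow_succ'] at hx
      exact hx

variable {m d : ℕ} (hm : A ^ m = 0) (hd : Module.finrank ℂ (LinearMap.ker A) ≤ d)
  (hmd : d * m = Module.finrank ℂ C)

include hm hd hmd

/-- A nilpotent operator all of whose Jordan blocks have size `m`. -/
theorem finrank_range_pow_of_uniform {i : ℕ} (hi : i ≤ m) :
    Module.finrank ℂ (LinearMap.range (A ^ i)) = d * (m - i) := by
  have h1 : ∀ j, Module.finrank ℂ (LinearMap.ker (A ^ j)) ≤ d * j := fun j =>
    (finrank_ker_pow_le A j).trans (Nat.mul_le_mul_right _ hd)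
  have h2 : LinearMap.range (A ^ i) ≤ LinearMap.ker (A ^ (m - i)) := by
    rintro _ ⟨x, rfl⟩
    rw [LinearMap.mem_ker, ← Module.End.mul_apply, ← pow_add, Nat.sub_add_cancel hi, hm]
    rfl
  have h3 := LinearMap.finrank_range_add_finrank_ker (A ^ i)
  have h4 := (Submodule.finrank_mono h2).trans (h1 _)
  have h5 : d * (m - i) + d * i = d * m := by rw [← mul_add, Nat.sub_add_cancel hi]
  have h6 := h1 i
  omega

theorem mem_range_pow_of_uniform {i : ℕ} (hi : i ≤ m) {x : C} (hx : (A ^ i) x = 0) :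
    ∃ y, (A ^ (m - i)) y = x := by
  have h1 : LinearMap.range (A ^ (m - i)) ≤ LinearMap.ker (A ^ i) := by
    rintro _ ⟨x, rfl⟩
    rw [LinearMap.mem_ker, ← Module.End.mul_apply, ← pow_add, Nat.add_sub_cancel' hi, hm]
    rfl
  have h2 : Module.finrank ℂ (LinearMap.ker (A ^ i)) ≤
      Module.finrank ℂ (LinearMap.range (A ^ (m - i))) := by
    rw [finrank_range_pow_of_uniform hm hd hmd (Nat.sub_le _ _), Nat.sub_sub_self hi]
    exact (finrank_ker_pow_le A i).trans (Nat.mul_le_mul_right _ hd)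
  have h3 : x ∈ LinearMap.range (A ^ (m - i)) := by
    rw [Submodule.eq_of_le_of_finrank_le h1 h2]
    exact hx
  exact h3

end UniformNilpotent

/-- The invariant subspaces of a nilpotent operator with a single Jordan block are the kernels of
its powers. -/
theorem eq_ker_pow_of_invariant {C : Type*} [AddCommGroup C] [Module ℂ C] [FiniteDimensional ℂ C]
    {A : Module.End ℂ C} {m : ℕ} (hm : A ^ m = 0)
    (hd : Module.finrank ℂ (LinearMap.ker A) ≤ 1) {W : Submodule ℂ C} (hW : ∀ x ∈ W, A x ∈ W) :
    W = LinearMap.ker (A ^ Module.finrank ℂ W) := by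
  have h1 : ∀ (j : ℕ) (x : W), (((A.restrict hW) ^ j) x : C) = (A ^ j) x := by
    intro j x
    induction j with
    | zero => rfl
    | succ j ih => rw [pow_succ', pow_succ', Module.End.mul_apply, Module.End.mul_apply, ← ih]; rfl
  refine Submodule.eq_of_le_of_finrank_le (fun x hx => ?_) ?_
  · have h2 : (⟨x, hx⟩ : W) ∈ LinearMap.ker ((A.restrict hW) ^ m) := by
      refine Subtype.ext ?_
      rw [h1, hm]
      rfl
    have h3 := Module.End.ker_pow_le_ker_pow_finrank _ _ h2
    have h4 := congrArg Subtype.val (LinearMap.mem_ker.1 h3)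
    rw [h1] at h4
    exact h4
  · exact (finrank_ker_pow_le A _).trans ((Nat.mul_le_mul_right _ hd).trans (one_mul _).le)

/-- Three nilpotent operators with sum zero, the `k`-th of them having `d k` Jordan blocks, all of
size `m k`, such that no proper subspace is invariant and only the scalars preserve the kernels of
all their powers. -/
structure IsStarTriple {C : Type*} [AddCommGroup C] [Module ℂ C] (A : Fin 3 → Module.End ℂ C)
    (m d : Fin 3 → ℕ) : Prop where
  sum_eq_zero : A 0 + A 1 + A 2 = 0
  two_le : ∀ k, 2 ≤ m k
  pow_eq_zero : ∀ k, A k ^ m k = 0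
  finrank_ker_le : ∀ k, Module.finrank ℂ (LinearMap.ker (A k)) ≤ d k
  mul_eq : ∀ k, d k * m k = Module.finrank ℂ C
  sum_eq : d 0 + d 1 + d 2 = Module.finrank ℂ C
  eq_one : d 0 = 1
  cyclic : ∃ x, A 0 x = 0 ∧ (A 0 ^ (m 0 - 1)) (A 1 x) ≠ 0
  scalar : ∀ f : Module.End ℂ C, (∀ k i x, (A k ^ i) x = 0 → (A k ^ i) (f x) = 0) →
    ∃ r : ℂ, ∀ x, f x = r • x

/-- The graph is a star with three arms: `v k j` is the vertex at distance `j` from the centre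
on the arm `k`, for `j < m k`. -/
structure IsStarGraph (N : ℕ) (E : List (ℕ × ℕ)) (m : Fin 3 → ℕ) (v : Fin 3 → ℕ → ℕ)
    (arm : ℕ → Fin 3) (depth : ℕ → ℕ) : Prop where
  lt : ∀ e ∈ E, e.1 < N ∧ e.2 < N
  center : ∀ k, v k 0 = v 0 0
  depth_eq : ∀ k, ∀ j < m k, depth (v k j) = j
  arm_eq : ∀ k, ∀ j < m k, 0 < j → arm (v k j) = k
  of_mem : ∀ e ∈ E, ∃ k, ∃ j < m k, j + 1 < m k ∧
    ((e.1 = v k j ∧ e.2 = v k (j + 1)) ∨ (e.2 = v k j ∧ e.1 = v k (j + 1)))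
  mem : ∀ k, ∀ j < m k, j + 1 < m k → (v k j, v k (j + 1)) ∈ E ∨ (v k (j + 1), v k j) ∈ E
  exists_eq : ∀ p < N, ∃ k, ∃ j < m k, p = v k j
  neighbourSum_center : ∀ {M : Type} [AddCommMonoid M] (g : ℕ → M),
    neighbourSum E (v 0 0) g = g (v 0 1) + g (v 1 1) + g (v 2 1)
  neighbourSum_arm : ∀ {M : Type} [AddCommMonoid M] (g : ℕ → M) (k) (j), 0 < j → j < m k →
    neighbourSum E (v k j) g = g (v k (j - 1)) + if j + 1 < m k then g (v k (j + 1)) else 0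

namespace IsStarTriple

variable {C : Type} [AddCommGroup C] [Module ℂ C] [FiniteDimensional ℂ C]
  {A : Fin 3 → Module.End ℂ C} {m d : Fin 3 → ℕ} (hA : IsStarTriple A m d)
  {N : ℕ} {E : List (ℕ × ℕ)} {v : Fin 3 → ℕ → ℕ} {arm : ℕ → Fin 3} {depth : ℕ → ℕ}
  (hE : IsStarGraph N E m v arm depth)

variable (A arm depth) in
/-- The spaces at the vertices of the star. -/
def space (p : ℕ) : Submodule ℂ C := LinearMap.range (A (arm p) ^ depth p)

variable (A arm depth) in
/-- The operator at an edge is that of the arm of its outer vertex. -/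
def op (p q : ℕ) : Module.End ℂ C :=
  if depth p < depth q then A (arm q) else if depth q < depth p then A (arm p) else 0

variable (depth) in
/-- The signs. -/
def sign (p q : ℕ) : ℂ := if depth p < depth q then 1 else -1

include hE

omit [FiniteDimensional ℂ C] in
theorem space_eq {k : Fin 3} {j : ℕ} (hj : j < m k) :
    space A arm depth (v k j) = LinearMap.range (A k ^ j) := by
  rw [space, hE.depth_eq k j hj]
  rcases Nat.eq_zero_or_pos j with rfl | h
  · rw [pow_zero, pow_zero]
  · rw [hE.arm_eq k j hj h]

include hA

theorem finrank_space {k : Fin 3} {j : ℕ} (hj : j < m k) :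
    Module.finrank ℂ (space A arm depth (v k j)) = d k * (m k - j) := by
  rw [space_eq hE hj, finrank_range_pow_of_uniform (hA.pow_eq_zero k) (hA.finrank_ker_le k)
    (hA.mul_eq k) hj.le]

omit [FiniteDimensional ℂ C] hE in
theorem pos (k : Fin 3) : 0 < d k := by
  have h1 := hA.mul_eq k
  have h2 := hA.mul_eq 0
  have h3 := hA.two_le 0
  rw [hA.eq_one] at h2
  exact Nat.pos_of_ne_zero fun h => by rw [h] at h1; omega

omit [FiniteDimensional ℂ C] hA in
theorem op_eq {k : Fin 3} {j : ℕ} (hj : j + 1 < m k) :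
    op A arm depth (v k j) (v k (j + 1)) = A k := by
  rw [op, hE.depth_eq k j (by omega), hE.depth_eq k _ hj, if_pos (Nat.lt_succ_self j),
    hE.arm_eq k _ hj (Nat.succ_pos j)]

omit [FiniteDimensional ℂ C] hA hE in
theorem op_comm (p q : ℕ) : op A arm depth p q = op A arm depth q p := by
  rw [op, op]
  split_ifs <;> first | rfl | omega

theorem space_lt {k : Fin 3} {j : ℕ} (hj : j + 1 < m k) :
    space A arm depth (v k (j + 1)) ≤ space A arm depth (v k j) ∧
      ¬ space A arm depth (v k j) ≤ space A arm depth (v k (j + 1)) := by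
  constructor
  · rw [space_eq hE hj, space_eq hE (by omega)]
    rintro _ ⟨x, rfl⟩
    exact ⟨A k x, by rw [pow_succ]; rfl⟩
  · intro h
    have h1 := Submodule.finrank_mono h
    rw [hA.finrank_space hE hj, hA.finrank_space hE (by omega)] at h1
    have h2 := Nat.le_of_mul_le_mul_left h1 (hA.pos k)
    omega

omit [FiniteDimensional ℂ C] hA in
theorem map_mem_space {k : Fin 3} {j : ℕ} (hj : j + 1 < m k) {x : C}
    (hx : x ∈ space A arm depth (v k j)) : A k x ∈ space A arm depth (v k (j + 1)) := by
  rw [space_eq hE (by omega)] at hx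
  obtain ⟨y, rfl⟩ := hx
  rw [space_eq hE hj]
  exact ⟨y, by rw [pow_succ']; rfl⟩

omit [FiniteDimensional ℂ C] hA in
theorem exists_of_mem_space {k : Fin 3} {j : ℕ} (hj : j + 1 < m k) {x : C}
    (hx : x ∈ space A arm depth (v k (j + 1))) : ∃ y ∈ space A arm depth (v k j), A k y = x := by
  rw [space_eq hE hj] at hx
  obtain ⟨y, rfl⟩ := hx
  rw [space_eq hE (by omega)]
  exact ⟨(A k ^ j) y, ⟨y, rfl⟩, by rw [pow_succ']; rfl⟩

omit [FiniteDimensional ℂ C] in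
theorem pow_apply_eq_zero {k : Fin 3} {j i : ℕ} (hj : j < m k) (hi : m k ≤ i + j) {x : C}
    (hx : x ∈ space A arm depth (v k j)) : (A k ^ i) x = 0 := by
  rw [space_eq hE hj] at hx
  obtain ⟨y, rfl⟩ := hx
  rw [← Module.End.mul_apply, ← pow_add, ← Nat.sub_add_cancel hi, pow_add, hA.pow_eq_zero, mul_zero]
  rfl

omit [FiniteDimensional ℂ C] hA in
theorem space_center (k : Fin 3) (hk : 0 < m k) : space A arm depth (v k 0) = ⊤ := by
  rw [space_eq hE hk, pow_zero]
  exact LinearMap.range_id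

/-- An endomorphism of the restriction of the representation to an orientation satisfies
`A ^ a g A ^ b = 0` for `a + b = n` at the vertex that is the `n`-th one from the end of its arm. -/
theorem pow_comp_pow_eq_zero {g : ℕ → C →ₗ[ℂ] C} {k : Fin 3}
    (hg : ∀ p, ∀ x ∈ space A arm depth p, g p x ∈ space A arm depth p)
    (h : ∀ j, j + 1 < m k →
      (∀ x ∈ space A arm depth (v k (j + 1)), g (v k j) x = g (v k (j + 1)) x) ∨
      ∀ x ∈ space A arm depth (v k j), g (v k (j + 1)) (A k x) = A k (g (v k j) x))
    (n : ℕ) (hn : n < m k) :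
    ∀ a b, a + b = n + 1 → ∀ x ∈ space A arm depth (v k (m k - 1 - n)),
      (A k ^ a) (g (v k (m k - 1 - n)) ((A k ^ b) x)) = 0 := by
  induction n with
  | zero =>
    intro a b hab x hx
    rcases Nat.eq_zero_or_pos b with rfl | hb
    · exact hA.pow_apply_eq_zero hE (by omega) (by omega) (hg _ _ hx)
    · rw [hA.pow_apply_eq_zero hE (by omega) (by omega) hx, map_zero, map_zero]
  | succ n ih =>
    intro a b hab x hx
    have ih := ih (by omega)
    have hj : m k - 1 - n = m k - 1 - (n + 1) + 1 := by omega
    rw [hj] at ih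
    set j := m k - 1 - (n + 1) with hjdef
    rcases h j (by omega) with h1 | h1
    · cases b with
      | zero => exact hA.pow_apply_eq_zero hE (by omega) (by omega) (hg _ _ hx)
      | succ b =>
        have h2 := map_mem_space hE (by omega : j + 1 < m k) hx
        have h3 : (A k ^ b) (A k x) ∈ space A arm depth (v k (j + 1)) :=
          Module.End.pow_apply_mem_of_forall_mem b (fun y hy => map_mem_space hE (by omega)
            ((hA.space_lt hE (by omega : j + 1 < m k)).1 hy)) _ h2
        rw [pow_succ, Module.End.mul_apply, h1 _ h3]
        exact ih a b (by omega) _ h2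
    · cases a with
      | zero => rw [hA.pow_apply_eq_zero hE (by omega) (by omega) hx, map_zero, map_zero]
      | succ a =>
        have h3 : (A k ^ b) x ∈ space A arm depth (v k j) :=
          Module.End.pow_apply_mem_of_forall_mem b (fun y hy => (hA.space_lt hE
            (by omega : j + 1 < m k)).1 (map_mem_space hE (by omega) hy)) _ hx
        have h4 : A k ((A k ^ b) x) = (A k ^ b) (A k x) := by
          rw [← Module.End.mul_apply, ← pow_succ', pow_succ, Module.End.mul_apply]
        rw [pow_succ, Module.End.mul_apply, ← h1 _ h3, h4]
        exact ih a b (by omega) _ (map_mem_space hE (by omega) hx)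

/-- Three nilpotent operators as above give a system of subspaces of the star: the space at distance
`j` from the centre on the arm `k` is the range of `A k ^ j`. -/
theorem isSubspaceSystem :
    IsSubspaceSystem N E (space A arm depth) (op A arm depth) (sign depth) := by
  have hadj : ∀ p q, IsAdj E p q → ∃ k j, j + 1 < m k ∧
      ((p = v k j ∧ q = v k (j + 1)) ∨ (q = v k j ∧ p = v k (j + 1))) := by
    rintro p q (h | h) <;> obtain ⟨k, j, -, h1, h2⟩ := hE.of_mem _ h
    · exact ⟨k, j, h1, h2⟩
    · exact ⟨k, j, h1, h2.symm⟩
  have hdepth : ∀ p q, IsAdj E p q → depth p ≠ depth q := by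
    intro p q h
    obtain ⟨k, j, h1, ⟨rfl, rfl⟩ | ⟨rfl, rfl⟩⟩ := hadj p q h <;>
      rw [hE.depth_eq k j (by omega), hE.depth_eq k _ h1] <;> omega
  have hs1 : ∀ k j, j + 1 < m k → sign depth (v k j) (v k (j + 1)) = 1 := by
    intro k j hj
    rw [sign, hE.depth_eq k j (by omega), hE.depth_eq k _ hj, if_pos (Nat.lt_succ_self j)]
  have hs2 : ∀ k j, j + 1 < m k → sign depth (v k (j + 1)) (v k j) = -1 := by
    intro k j hj
    rw [sign, hE.depth_eq k j (by omega), hE.depth_eq k _ hj, if_neg (by omega)]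
  refine ⟨hE.lt, op_comm, fun p q h => ?_, fun p q _ => ?_, fun p q h => ?_,
    fun p hp x hx => ?_, fun p hp => ?_, ?_, fun W hW h => ?_, fun g hg h => ?_⟩
  · have := hdepth p q h
    rw [sign, sign]
    split_ifs
    · omega
    · exact (neg_neg (1 : ℂ)).symm
    · rfl
    · omega
  · rw [sign]
    split_ifs <;> norm_num
  · obtain ⟨k, j, h1, ⟨rfl, rfl⟩ | ⟨rfl, rfl⟩⟩ := hadj p q h
    · rw [op_eq hE h1]
      exact Or.inr ⟨(hA.space_lt hE h1).1, fun x hx => map_mem_space hE h1 hx⟩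
    · rw [op_comm, op_eq hE h1]
      exact Or.inl ⟨(hA.space_lt hE h1).1, fun x hx => map_mem_space hE h1 hx⟩
  · obtain ⟨k, j, hj, rfl⟩ := hE.exists_eq p hp
    cases j with
    | zero =>
      rw [hE.center, hE.neighbourSum_center]
      have h1 : ∀ l, sign depth (v 0 0) (v l 1) • op A arm depth (v 0 0) (v l 1) x = A l x := by
        intro l
        have hl := hA.two_le l
        rw [← hE.center l, hs1 l 0 (by omega), op_eq hE (by omega), one_smul]
      rw [h1, h1, h1, ← LinearMap.add_apply, ← LinearMap.add_apply, hA.sum_eq_zero]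
      rfl
    | succ j =>
      rw [hE.neighbourSum_arm _ k _ (Nat.succ_pos j) hj, Nat.succ_eq_add_one, Nat.add_sub_cancel, hs2 k j hj, op_comm,
        op_eq hE hj]
      split_ifs with h1
      · rw [hs1 k _ h1, op_eq hE h1, one_smul, neg_one_smul, neg_add_cancel]
      · have := hA.pow_apply_eq_zero hE hj (i := 1) (by omega) hx
        rw [pow_one] at this
        rw [this, smul_zero, zero_add]
  · obtain ⟨k, j, hj, rfl⟩ := hE.exists_eq p hp
    cases j with
    | zero =>
      rw [hE.center, hE.neighbourSum_center]
      have h0 := hA.two_le 0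
      have h1 := hA.two_le 1
      have h2 := hA.two_le 2
      rw [hA.finrank_space hE (by omega), hA.finrank_space hE (by omega),
        hA.finrank_space hE (by omega), hA.finrank_space hE (by omega), Nat.sub_zero, hA.mul_eq 0,
        Nat.mul_sub, Nat.mul_sub, Nat.mul_sub, hA.mul_eq, hA.mul_eq, hA.mul_eq, mul_one, mul_one,
        mul_one]
      have h3 := hA.sum_eq
      omega
    | succ j =>
      rw [hE.neighbourSum_arm _ k _ (Nat.succ_pos j) hj, Nat.succ_eq_add_one, Nat.add_sub_cancel,
        hA.finrank_space hE (by omega), hA.finrank_space hE hj]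
      split_ifs with h1
      · rw [hA.finrank_space hE h1, ← mul_add, mul_left_comm]
        congr 1
        omega
      · rw [show m k - j = 2 by omega, show m k - (j + 1) = 1 by omega]
        omega
  · have h0 := hA.two_le 0
    have h1 : IsAdj E (v 0 0) (v 0 1) := hE.mem 0 0 (by omega) (by omega)
    have hne : ∀ j, j < m 0 → space A arm depth (v 0 j) ≠ ⊥ := by
      intro j hj h
      have h2 := hA.finrank_space hE hj
      rw [h, finrank_bot, hA.eq_one] at h2
      omega
    refine ⟨_, _, h1, hne 0 (by omega), hne 1 (by omega),
      fun h => absurd h (hA.space_lt hE (by omega : 0 + 1 < m 0)).2, fun _ => ?_⟩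
    rw [op_eq hE (by omega)]
    by_contra! hc
    refine hne 1 (by omega) ((Submodule.eq_bot_iff _).2 fun x hx => ?_)
    obtain ⟨y, hy, rfl⟩ := exists_of_mem_space hE (by omega : 0 + 1 < m 0) hx
    exact hc y hy
  · have hedge : ∀ k j, j + 1 < m k → W (v k (j + 1)) ≤ W (v k j) ∧
        ∀ x ∈ W (v k j), A k x ∈ W (v k (j + 1)) := by
      intro k j hj
      have h1 := h _ _ (hE.mem k j (by omega) hj)
      rw [op_eq hE hj] at h1
      rcases h1 with ⟨h2, -⟩ | ⟨-, h2⟩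
      · exact absurd h2 (hA.space_lt hE hj).2
      · exact h2
    have hinv : ∀ k, ∀ x ∈ W (v 0 0), A k x ∈ W (v 0 0) := by
      intro k x hx
      have hk := hA.two_le k
      rw [← hE.center k] at hx ⊢
      have h1 := hedge k 0 (by omega)
      exact h1.1 (h1.2 x hx)
    have hker := eq_ker_pow_of_invariant (hA.pow_eq_zero 0)
      ((hA.finrank_ker_le 0).trans hA.eq_one.le) (hinv 0)
    set w := Module.finrank ℂ (W (v 0 0)) with hw
    have hn := hA.mul_eq 0
    rw [hA.eq_one, one_mul] at hn
    have hw' : w = 0 ∨ m 0 ≤ w := by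
      by_contra! hc
      obtain ⟨x, hx, hx'⟩ := hA.cyclic
      have h1 : x ∈ W (v 0 0) := by
        rw [hker, LinearMap.mem_ker, ← Nat.sub_add_cancel (Nat.pos_of_ne_zero hc.1), pow_succ,
          Module.End.mul_apply, hx, map_zero]
      have h2 := hinv 1 x h1
      rw [hker, LinearMap.mem_ker] at h2
      refine hx' ?_
      rw [show m 0 - 1 = (m 0 - 1 - w) + w by omega, pow_add, Module.End.mul_apply, h2, map_zero]
    rcases hw' with h0 | h0
    · refine Or.inl fun p hp => ?_
      obtain ⟨k, j, hj, rfl⟩ := hE.exists_eq p hp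
      induction j with
      | zero =>
        rw [hE.center]
        exact Submodule.finrank_eq_zero.1 h0
      | succ j ih =>
        have hlt : v k j < N := by
          rcases hE.mem k j (by omega) hj with h1 | h1
          exacts [(hE.lt _ h1).1, (hE.lt _ h1).2]
        rw [eq_bot_iff, ← ih (by omega) hlt]
        exact (hedge k j hj).1
    · refine Or.inr fun p hp => ?_
      obtain ⟨k, j, hj, rfl⟩ := hE.exists_eq p hp
      refine le_antisymm (hW _) ?_
      clear hp
      induction j with
      | zero =>
        rw [hE.center, Submodule.eq_top_of_finrank_eq (le_antisymm (Submodule.finrank_le _)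
          (hn.ge.trans h0) : Module.finrank ℂ (W (v 0 0)) = Module.finrank ℂ C)]
        exact le_top
      | succ j ih =>
        intro x hx
        obtain ⟨y, hy, rfl⟩ := exists_of_mem_space hE hj hx
        exact (hedge k j hj).2 y (ih (by omega) hy)
  · have hedge : ∀ k j, j + 1 < m k →
        (∀ x ∈ space A arm depth (v k (j + 1)), g (v k j) x = g (v k (j + 1)) x) ∨
        ∀ x ∈ space A arm depth (v k j), g (v k (j + 1)) (A k x) = A k (g (v k j) x) := by
      intro k j hj
      have h1 := h _ _ (hE.mem k j (by omega) hj)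
      rw [op_eq hE hj] at h1
      have h2 := hA.space_lt hE hj
      rcases h1 with ⟨h3, -⟩ | ⟨-, h3⟩ | ⟨-, h3⟩ | ⟨h3, -⟩
      · exact absurd h3 h2.2
      · exact Or.inl h3
      · exact Or.inr h3
      · exact absurd h2.1 h3
    -- An endomorphism preserves the kernels of the powers of the operators at the centre.
    obtain ⟨r, hr⟩ := hA.scalar (g (v 0 0)) fun k i x hx => by
      have hk := hA.two_le k
      rcases le_or_gt (m k) i with hi | hi
      · rw [← Nat.sub_add_cancel hi, pow_add, hA.pow_eq_zero, mul_zero]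
        rfl
      · obtain ⟨y, rfl⟩ := mem_range_pow_of_uniform (hA.pow_eq_zero k) (hA.finrank_ker_le k)
          (hA.mul_eq k) hi.le hx
        have h1 := hA.pow_comp_pow_eq_zero hE hg (hedge k) (m k - 1) (by omega) i (m k - i)
          (by omega) y
        rw [Nat.sub_self] at h1
        rw [← hE.center k]
        exact h1 (by rw [space_center hE k (by omega)]; trivial)
    refine ⟨r, fun p hp => ?_⟩
    obtain ⟨k, j, hj, rfl⟩ := hE.exists_eq p hp
    clear hp
    induction j with
    | zero =>
      rw [hE.center]
      exact fun x _ => hr x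
    | succ j ih =>
      intro x hx
      rcases hedge k j hj with h1 | h1
      · rw [← h1 x hx, ih (by omega) x ((hA.space_lt hE hj).1 hx)]
      · obtain ⟨y, hy, rfl⟩ := exists_of_mem_space hE hj hx
        rw [h1 y hy, ih (by omega) y hy, map_smul]

end IsStarTriple

/-! ### The types E -/

section Star

open GraphRep

variable {V : Type u} [Quiver.{v} V]

/-- The space at the end of the arm `0` is a line, since `d 0 = 1`. -/
theorem exists_singular_of_star {C : Type} [AddCommGroup C] [Module ℂ C] [FiniteDimensional ℂ C]
    {A : Fin 3 → Module.End ℂ C} {m d : Fin 3 → ℕ} (hA : IsStarTriple A m d)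
    {N : ℕ} {E : List (ℕ × ℕ)} {w : Fin 3 → ℕ → ℕ} {arm : ℕ → Fin 3} {depth : ℕ → ℕ}
    (hE : IsStarGraph N E m w arm depth) (σ : V ≃ Fin N)
    (hσ : ∀ i j : V, Nonempty (((i ⟶ j) ⊕ (j ⟶ i)) ≃
      Fin (E.count ((σ i).val, (σ j).val) + E.count ((σ j).val, (σ i).val)))) :
    ∃ (X : QuiverRep V) (e : V → ℕ),
      Indecomposable X ∧ LiesInHomogeneousTube X ∧ IsSingularQuiverGrassmannian X e := by
  have h0 := hA.two_le 0
  have hlt : w 0 (m 0 - 1) < N := by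
    have h1 := hE.mem 0 (m 0 - 1 - 1) (by omega) (by omega)
    rw [Nat.sub_add_cancel (by omega)] at h1
    rcases h1 with h1 | h1
    exacts [(hE.lt _ h1).2, (hE.lt _ h1).1]
  have ho : (σ (σ.symm ⟨_, hlt⟩)).val = w 0 (m 0 - 1) := by rw [σ.apply_symm_apply]
  refine exists_singular_of_system (hA.isSubspaceSystem hE) σ hσ (o := σ.symm ⟨_, hlt⟩) ?_
    (sink_or_source_of_leaf hE.lt σ hσ ?_)
  · rw [ho, hA.finrank_space hE (by omega), hA.eq_one]
    omega
  · rw [ho, hE.neighbourSum_arm _ 0 _ (by omega) (by omega), if_neg (by omega), add_zero]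

end Star

/-- The operator maps the space of the vectors vanishing at the coordinates of level greater than
`i` to the one for `i - 1`, and is injective modulo these spaces. -/
def ShiftsLevel {n : ℕ} (A : Module.End ℂ (Fin n → ℂ)) (l : Fin n → ℕ) : Prop :=
  ∀ (i : ℕ) (x : Fin n → ℂ), (∀ j, i ≤ l j → A x j = 0) ↔ ∀ j, i + 1 ≤ l j → x j = 0

namespace ShiftsLevel

variable {n : ℕ} {A : Module.End ℂ (Fin n → ℂ)} {l : Fin n → ℕ} (h : ShiftsLevel A l)

include h

theorem pow_apply_eq_zero_iff {i : ℕ} {x : Fin n → ℂ} :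
    (A ^ i) x = 0 ↔ ∀ j, i ≤ l j → x j = 0 := by
  have key : ∀ (i t : ℕ) (x : Fin n → ℂ),
      (∀ j, t ≤ l j → (A ^ i) x j = 0) ↔ ∀ j, t + i ≤ l j → x j = 0 := by
    intro i
    induction i with
    | zero => exact fun t x => Iff.rfl
    | succ i ih =>
      intro t x
      rw [pow_succ, Module.End.mul_apply, ih, h (t + i) x]
      rfl
  rw [funext_iff, ← zero_add i, ← key, zero_add]
  simp

theorem pow_eq_zero {m : ℕ} (hm : ∀ j, l j < m) : A ^ m = 0 :=
  LinearMap.ext fun _ => h.pow_apply_eq_zero_iff.2 fun j hj => absurd (hm j) (by omega)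

theorem apply_single_eq_zero {f : Module.End ℂ (Fin n → ℂ)}
    (hf : ∀ i x, (A ^ i) x = 0 → (A ^ i) (f x) = 0) {j k : Fin n} (hjk : l j < l k) :
    f (Pi.single j 1) k = 0 := by
  have h1 : (A ^ (l j + 1)) (Pi.single j 1) = 0 := h.pow_apply_eq_zero_iff.2 fun i hi =>
    Pi.single_eq_of_ne (fun hij => by rw [hij] at hi; omega) _
  exact h.pow_apply_eq_zero_iff.1 (hf _ _ h1) k hjk

end ShiftsLevel

theorem finrank_ker_le_of_coordinates {n d : ℕ} (A : Module.End ℂ (Fin n → ℂ)) (J : Fin d → Fin n)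
    (h : ∀ x, A x = 0 → (∀ i, x (J i) = 0) → x = 0) :
    Module.finrank ℂ (LinearMap.ker A) ≤ d := by
  have := LinearMap.finrank_le_finrank_of_injective
    (f := (LinearMap.funLeft ℂ ℂ J).domRestrict (LinearMap.ker A)) (by
      rw [← LinearMap.ker_eq_bot, LinearMap.ker_eq_bot']
      rintro ⟨x, hx⟩ hx'
      exact Subtype.ext (h x hx fun i => congrFun hx' i))
  simpa using this

theorem apply_eq_sum {n : ℕ} (f : Module.End ℂ (Fin n → ℂ)) (x : Fin n → ℂ) (k : Fin n) :
    f x k = ∑ j, x j * f (Pi.single j 1) k := by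
  conv_lhs => rw [← Finset.univ_sum_single x, map_sum]
  rw [Finset.sum_apply]
  refine Finset.sum_congr rfl fun j _ => ?_
  rw [show Pi.single j (x j) = x j • (Pi.single j 1 : Fin n → ℂ) by
    rw [← Pi.single_smul, smul_eq_mul, mul_one], map_smul]
  rfl

namespace TypeE

/-- The operators for `E₆`: the strictly upper and strictly lower triangular parts of a matrix
with zero diagonal, and the negative of this matrix, which is nilpotent with one Jordan block. -/
noncomputable def op6 : Fin 3 → Module.End ℂ (Fin 3 → ℂ) :=
  ![Matrix.mulVecLin !![0, 1, 1; 0, 0, 1; 0, 0, 0],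
    Matrix.mulVecLin !![0, 0, 0; 2, 0, 0; -4, 2, 0],
    Matrix.mulVecLin !![0, -1, -1; -2, 0, -1; 4, -2, 0]]

theorem op6_zero (x : Fin 3 → ℂ) : op6 0 x = ![x 1 + x 2, x 2, 0] := by
  ext i
  fin_cases i <;> simp [op6, Matrix.mulVec, dotProduct, Fin.sum_univ_three]

theorem op6_one (x : Fin 3 → ℂ) : op6 1 x = ![0, 2 * x 0, -4 * x 0 + 2 * x 1] := by
  ext i
  fin_cases i <;> simp [op6, Matrix.mulVec, dotProduct, Fin.sum_univ_three]

theorem op6_two (x : Fin 3 → ℂ) :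
    op6 2 x = ![-x 1 - x 2, -2 * x 0 - x 2, 4 * x 0 - 2 * x 1] := by
  ext i
  fin_cases i <;> simp [op6, Matrix.mulVec, dotProduct, Fin.sum_univ_three, sub_eq_add_neg]

theorem shiftsLevel6_zero : ShiftsLevel (op6 0) ![0, 1, 2] := by
  rintro (_ | _ | i) x <;> simp [op6_zero, Fin.forall_fin_succ]
  grind

theorem shiftsLevel6_one : ShiftsLevel (op6 1) ![2, 1, 0] := by
  rintro (_ | _ | i) x <;> simp [op6_one, Fin.forall_fin_succ]
  grind

theorem isStarTriple6 : IsStarTriple op6 ![3, 3, 3] ![1, 1, 1] where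
  sum_eq_zero := by
    refine LinearMap.ext fun x => funext fun i => ?_
    fin_cases i <;> simp [op6_zero, op6_one, op6_two] <;> ring
  two_le k := by fin_cases k <;> simp
  pow_eq_zero k := by
    fin_cases k
    · exact shiftsLevel6_zero.pow_eq_zero (by decide)
    · exact shiftsLevel6_one.pow_eq_zero (by decide)
    · refine LinearMap.ext fun x => funext fun i => ?_
      fin_cases i <;> simp [pow_succ, op6_two] <;> ring
  finrank_ker_le k := by
    fin_cases k
    · refine finrank_ker_le_of_coordinates (op6 0) ![0] fun x hx h => ?_
      simp [op6_zero, funext_iff, Fin.forall_fin_succ] at hx h ⊢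
      grind
    · refine finrank_ker_le_of_coordinates (op6 1) ![2] fun x hx h => ?_
      simp [op6_one, funext_iff, Fin.forall_fin_succ] at hx h ⊢
      grind
    · refine finrank_ker_le_of_coordinates (op6 2) ![0] fun x hx h => ?_
      simp [op6_two, funext_iff, Fin.forall_fin_succ] at hx h ⊢
      grind
  mul_eq k := by fin_cases k <;> simp
  sum_eq := by simp
  eq_one := rfl
  cyclic := by
    refine ⟨![1, 0, 0], ?_, ?_⟩
    · simp [op6_zero]
    · intro h
      have := shiftsLevel6_zero.pow_apply_eq_zero_iff.1 h 2 le_rfl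
      simp [op6_one] at this
  scalar f hf := by
    have h0 := fun {j k} => shiftsLevel6_zero.apply_single_eq_zero (j := j) (k := k) (hf 0)
    have h1 := fun {j k} => shiftsLevel6_one.apply_single_eq_zero (j := j) (k := k) (hf 1)
    -- The operator is diagonal, and preserves the kernel of the third operator.
    have h2 := hf 2 1 ![1, 2, -2] (by simp [op6_two]; norm_num)
    rw [pow_one, op6_two, apply_eq_sum f _ 0, apply_eq_sum f _ 1, apply_eq_sum f _ 2] at h2
    simp [Fin.sum_univ_three] at h2
    have a01 := @h0 0 1 (by decide)
    have a02 := @h0 0 2 (by decide)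
    have a12 := @h0 1 2 (by decide)
    have a10 := @h1 1 0 (by decide)
    have a20 := @h1 2 0 (by decide)
    have a21 := @h1 2 1 (by decide)
    refine ⟨f (Pi.single 0 1) 0, fun x => ?_⟩
    ext k
    rw [apply_eq_sum, Fin.sum_univ_three]
    fin_cases k <;> simp <;> grind

theorem isStarGraph6 : IsStarGraph 7 ExtDynkin.E6.edges ![3, 3, 3]
    (fun k j => ([[2, 1, 0], [2, 3, 4], [2, 5, 6]].getD k []).getD j 0)
    (fun p => [0, 0, 0, 1, 1, 2, 2].getD p 0) (fun p => [2, 1, 0, 1, 2, 1, 2].getD p 0) where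
  lt := by decide
  center := by decide
  depth_eq := by decide
  arm_eq := by decide
  of_mem := by decide
  mem := by decide
  exists_eq := by decide
  neighbourSum_center g := by simp [neighbourSum, ExtDynkin.edges, add_assoc]
  neighbourSum_arm g k j h1 h2 := by
    fin_cases k <;> simp at h2 <;> interval_cases j <;>
      simp [neighbourSum, ExtDynkin.edges, add_comm]

/-- The operators for `E₇`: the strictly upper and strictly lower triangular parts of a matrix
with zero diagonal, and the negative of this matrix, whose square is zero and whose rank is two. -/
noncomputable def op7 : Fin 3 → Module.End ℂ (Fin 4 → ℂ) :=
  ![Matrix.mulVecLin !![0, 2, -1, 1; 0, 0, 1, 1; 0, 0, 0, 2; 0, 0, 0, 0],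
    Matrix.mulVecLin !![0, 0, 0, 0; -2, 0, 0, 0; -2, 2, 0, 0; 2, 2, -2, 0],
    Matrix.mulVecLin !![0, -2, 1, -1; 2, 0, -1, -1; 2, -2, 0, -2; -2, -2, 2, 0]]

theorem op7_zero (x : Fin 4 → ℂ) :
    op7 0 x = ![2 * x 1 - x 2 + x 3, x 2 + x 3, 2 * x 3, 0] := by
  ext i
  fin_cases i <;> simp [op7, Matrix.mulVec, dotProduct, Fin.sum_univ_four, sub_eq_add_neg]

theorem op7_one (x : Fin 4 → ℂ) :
    op7 1 x = ![0, -2 * x 0, -2 * x 0 + 2 * x 1, 2 * x 0 + 2 * x 1 - 2 * x 2] := by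
  ext i
  fin_cases i <;> simp [op7, Matrix.mulVec, dotProduct, Fin.sum_univ_four, sub_eq_add_neg]

theorem op7_two (x : Fin 4 → ℂ) :
    op7 2 x = ![-2 * x 1 + x 2 - x 3, 2 * x 0 - x 2 - x 3, 2 * x 0 - 2 * x 1 - 2 * x 3, -2 * x 0 - 2 * x 1 + 2 * x 2] := by
  ext i
  fin_cases i <;> simp [op7, Matrix.mulVec, dotProduct, Fin.sum_univ_four, sub_eq_add_neg]

theorem shiftsLevel7_zero : ShiftsLevel (op7 0) ![0, 1, 2, 3] := by
  rintro (_ | _ | _ | i) x <;> simp [op7_zero, Fin.forall_fin_succ] <;> grind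

theorem shiftsLevel7_one : ShiftsLevel (op7 1) ![3, 2, 1, 0] := by
  rintro (_ | _ | _ | i) x <;> simp [op7_one, Fin.forall_fin_succ] <;> grind

theorem isStarTriple7 : IsStarTriple op7 ![4, 4, 2] ![1, 1, 2] where
  sum_eq_zero := by
    refine LinearMap.ext fun x => funext fun i => ?_
    fin_cases i <;> simp [op7_zero, op7_one, op7_two] <;> ring
  two_le k := by fin_cases k <;> simp
  pow_eq_zero k := by
    fin_cases k
    · exact shiftsLevel7_zero.pow_eq_zero (by decide)
    · exact shiftsLevel7_one.pow_eq_zero (by decide)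
    · refine LinearMap.ext fun x => funext fun i => ?_
      fin_cases i <;> simp [pow_succ, op7_two] <;> ring
  finrank_ker_le k := by
    fin_cases k
    · refine finrank_ker_le_of_coordinates (op7 0) ![0] fun x hx h => ?_
      simp [op7_zero, funext_iff, Fin.forall_fin_succ] at hx h ⊢
      grind
    · refine finrank_ker_le_of_coordinates (op7 1) ![3] fun x hx h => ?_
      simp [op7_one, funext_iff, Fin.forall_fin_succ] at hx h ⊢
      grind
    · refine finrank_ker_le_of_coordinates (op7 2) ![0, 1] fun x hx h => ?_
      simp [op7_two, funext_iff, Fin.forall_fin_succ] at hx h ⊢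
      grind
  mul_eq k := by fin_cases k <;> simp
  sum_eq := by simp
  eq_one := rfl
  cyclic := by
    refine ⟨![1, 0, 0, 0], ?_, ?_⟩
    · simp [op7_zero]
    · intro h
      have := shiftsLevel7_zero.pow_apply_eq_zero_iff.1 h 3 le_rfl
      simp [op7_one] at this
  scalar f hf := by
    have h0 := fun {j k} => shiftsLevel7_zero.apply_single_eq_zero (j := j) (k := k) (hf 0)
    have h1 := fun {j k} => shiftsLevel7_one.apply_single_eq_zero (j := j) (k := k) (hf 1)
    -- The operator is diagonal, and preserves the kernel of the third operator.
    have hdiag : ∀ j k, j ≠ k → f (Pi.single j 1) k = 0 := by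
      intro j k hjk
      rcases lt_or_gt_of_ne hjk with h | h
      · exact h0 (by fin_cases j <;> fin_cases k <;> simp at h ⊢)
      · exact h1 (by fin_cases j <;> fin_cases k <;> simp at h ⊢)
    have hf' : ∀ x k, f x k = x k * f (Pi.single k 1) k := fun x k => by
      rw [apply_eq_sum, Finset.sum_eq_single k (fun j _ hj => by rw [hdiag j k hj, mul_zero])
        (fun h => absurd (Finset.mem_univ k) h)]
    have h2 := hf 2 1 ![1, 0, 1, 1] (by simp [op7_two]; norm_num)
    have h3 := hf 2 1 ![0, 1, 1, -1] (by simp [op7_two]; norm_num)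
    rw [pow_one, op7_two] at h2 h3
    simp [hf' ![1, 0, 1, 1], hf' ![0, 1, 1, -1]] at h2 h3
    refine ⟨f (Pi.single 0 1) 0, fun x => ?_⟩
    ext k
    rw [hf']
    fin_cases k <;> simp <;> grind

theorem isStarGraph7 : IsStarGraph 8 ExtDynkin.E7.edges ![4, 4, 2]
    (fun k j => ([[3, 2, 1, 0], [3, 4, 5, 6], [3, 7]].getD k []).getD j 0)
    (fun p => [0, 0, 0, 0, 1, 1, 1, 2].getD p 0) (fun p => [3, 2, 1, 0, 1, 2, 3, 1].getD p 0) where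
  lt := by decide
  center := by decide
  depth_eq := by decide
  arm_eq := by decide
  of_mem := by decide
  mem := by decide
  exists_eq := by decide
  neighbourSum_center g := by simp [neighbourSum, ExtDynkin.edges, add_assoc]
  neighbourSum_arm g k j h1 h2 := by
    fin_cases k <;> simp at h2 <;> interval_cases j <;>
      simp [neighbourSum, ExtDynkin.edges, add_comm]

/-- The operators for `E₈`: the strictly upper and strictly lower triangular parts of a matrix
with zero diagonal, and the negative of this matrix, whose square is zero and whose rank is three.
The diagonal blocks of size two have no entries below the diagonal, so that the strictly lower part
has two Jordan blocks of size three. -/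
noncomputable def op8 : Fin 3 → Module.End ℂ (Fin 6 → ℂ) :=
  ![Matrix.mulVecLin !![0, 1, 1, -1, -1, 0; 0, 0, -1, -1, -2, 1; 0, 0, 0, 1, 1, -1; 0, 0, 0, 0, -1, -1; 0, 0, 0, 0, 0, 1; 0, 0, 0, 0, 0, 0],
    Matrix.mulVecLin !![0, 0, 0, 0, 0, 0; 0, 0, 0, 0, 0, 0; -1, 0, 0, 0, 0, 0; -2, 1, 0, 0, 0, 0; 1, -1, -1, 0, 0, 0; -1, -1, -2, 1, 0, 0],
    Matrix.mulVecLin !![0, -1, -1, 1, 1, 0; 0, 0, 1, 1, 2, -1; 1, 0, 0, -1, -1, 1; 2, -1, 0, 0, 1, 1; -1, 1, 1, 0, 0, -1; 1, 1, 2, -1, 0, 0]]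

theorem op8_zero (x : Fin 6 → ℂ) :
    op8 0 x = ![x 1 + x 2 - x 3 - x 4, -x 2 - x 3 - 2 * x 4 + x 5, x 3 + x 4 - x 5, -x 4 - x 5, x 5, 0] := by
  ext i
  fin_cases i <;> simp [op8, Matrix.mulVec, dotProduct, Fin.sum_univ_six, sub_eq_add_neg]

theorem op8_one (x : Fin 6 → ℂ) :
    op8 1 x = ![0, 0, -x 0, -2 * x 0 + x 1, x 0 - x 1 - x 2, -x 0 - x 1 - 2 * x 2 + x 3] := by
  ext i
  fin_cases i <;> simp [op8, Matrix.mulVec, dotProduct, Fin.sum_univ_six, sub_eq_add_neg]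

theorem op8_two (x : Fin 6 → ℂ) :
    op8 2 x = ![-x 1 - x 2 + x 3 + x 4, x 2 + x 3 + 2 * x 4 - x 5, x 0 - x 3 - x 4 + x 5, 2 * x 0 - x 1 + x 4 + x 5, -x 0 + x 1 + x 2 - x 5, x 0 + x 1 + 2 * x 2 - x 3] := by
  ext i
  fin_cases i <;> simp [op8, Matrix.mulVec, dotProduct, Fin.sum_univ_six, sub_eq_add_neg]

theorem shiftsLevel8_zero : ShiftsLevel (op8 0) ![0, 1, 2, 3, 4, 5] := by
  rintro (_ | _ | _ | _ | _ | i) x <;> simp [op8_zero, Fin.forall_fin_succ] <;> grind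

theorem shiftsLevel8_one : ShiftsLevel (op8 1) ![2, 2, 1, 1, 0, 0] := by
  rintro (_ | _ | i) x <;> simp [op8_one, Fin.forall_fin_succ] <;> grind

theorem isStarTriple8 : IsStarTriple op8 ![6, 3, 2] ![1, 2, 3] where
  sum_eq_zero := by
    refine LinearMap.ext fun x => funext fun i => ?_
    fin_cases i <;> simp [op8_zero, op8_one, op8_two] <;> ring
  two_le k := by fin_cases k <;> simp
  pow_eq_zero k := by
    fin_cases k
    · exact shiftsLevel8_zero.pow_eq_zero (by decide)
    · exact shiftsLevel8_one.pow_eq_zero (by decide)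
    · refine LinearMap.ext fun x => funext fun i => ?_
      fin_cases i <;> simp [pow_succ, op8_two] <;> ring
  finrank_ker_le k := by
    fin_cases k
    · refine finrank_ker_le_of_coordinates (op8 0) ![0] fun x hx h => ?_
      simp [op8_zero, funext_iff, Fin.forall_fin_succ] at hx h ⊢
      grind
    · refine finrank_ker_le_of_coordinates (op8 1) ![4, 5] fun x hx h => ?_
      simp [op8_one, funext_iff, Fin.forall_fin_succ] at hx h ⊢
      grind
    · refine finrank_ker_le_of_coordinates (op8 2) ![2, 3, 4] fun x hx h => ?_
      simp [op8_two, funext_iff, Fin.forall_fin_succ] at hx h ⊢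
      grind
  mul_eq k := by fin_cases k <;> simp
  sum_eq := by simp
  eq_one := rfl
  cyclic := by
    refine ⟨![1, 0, 0, 0, 0, 0], ?_, ?_⟩
    · simp [op8_zero]
    · intro h
      have := shiftsLevel8_zero.pow_apply_eq_zero_iff.1 h 5 le_rfl
      simp [op8_one] at this
  scalar f hf := by
    have h0 := fun {j k} => shiftsLevel8_zero.apply_single_eq_zero (j := j) (k := k) (hf 0)
    have h1 := fun {j k} => shiftsLevel8_one.apply_single_eq_zero (j := j) (k := k) (hf 1)
    -- The operator is block diagonal with upper triangular blocks of size two.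
    have hf' : ∀ x, f x = ![x 0 * f (Pi.single 0 1) 0 + x 1 * f (Pi.single 1 1) 0,
        x 1 * f (Pi.single 1 1) 1, x 2 * f (Pi.single 2 1) 2 + x 3 * f (Pi.single 3 1) 2,
        x 3 * f (Pi.single 3 1) 3, x 4 * f (Pi.single 4 1) 4 + x 5 * f (Pi.single 5 1) 4,
        x 5 * f (Pi.single 5 1) 5] := by
      intro x
      ext k
      rw [apply_eq_sum, Fin.sum_univ_six]
      fin_cases k
      · simp [@h1 2 0 (by decide), @h1 3 0 (by decide), @h1 4 0 (by decide), @h1 5 0 (by decide)]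
      · simp [@h0 0 1 (by decide), @h1 2 1 (by decide), @h1 3 1 (by decide), @h1 4 1 (by decide),
          @h1 5 1 (by decide)]
      · simp [@h0 0 2 (by decide), @h0 1 2 (by decide), @h1 4 2 (by decide), @h1 5 2 (by decide)]
      · simp [@h0 0 3 (by decide), @h0 1 3 (by decide), @h0 2 3 (by decide), @h1 4 3 (by decide),
          @h1 5 3 (by decide)]
      · simp [@h0 0 4 (by decide), @h0 1 4 (by decide), @h0 2 4 (by decide), @h0 3 4 (by decide)]
      · simp [@h0 0 5 (by decide), @h0 1 5 (by decide), @h0 2 5 (by decide), @h0 3 5 (by decide),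
          @h0 4 5 (by decide)]
    -- It preserves the kernel of the third operator, which is spanned by three vectors.
    have h2 := hf 2 1 ![-1, -1, 1, 0, 0, 1] (by simp [op8_two]; norm_num)
    have h3 := hf 2 1 ![0, 1, 0, 1, 0, 1] (by simp [op8_two])
    have h4 := hf 2 1 ![-1, 1, 0, 0, 1, 2] (by simp [op8_two]; norm_num)
    rw [pow_one, hf', op8_two] at h2 h3 h4
    simp at h2 h3 h4
    refine ⟨f (Pi.single 0 1) 0, fun x => ?_⟩
    rw [hf']
    ext k
    fin_cases k <;> simp <;> grind

theorem isStarGraph8 : IsStarGraph 9 ExtDynkin.E8.edges ![6, 3, 2]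
    (fun k j => ([[2, 3, 4, 5, 6, 7], [2, 1, 0], [2, 8]].getD k []).getD j 0)
    (fun p => [1, 1, 0, 0, 0, 0, 0, 0, 2].getD p 0)
    (fun p => [2, 1, 0, 1, 2, 3, 4, 5, 1].getD p 0) where
  lt := by decide
  center := by decide
  depth_eq := by decide
  arm_eq := by decide
  of_mem := by decide
  mem := by decide
  exists_eq := by decide
  neighbourSum_center g := by
    simp [neighbourSum, ExtDynkin.edges, add_comm, add_assoc]
  neighbourSum_arm g k j h1 h2 := by
    fin_cases k <;> simp at h2 <;> interval_cases j <;>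
      simp [neighbourSum, ExtDynkin.edges, add_comm]

end TypeE

theorem mainTheorem5 {V : Type u} [Quiver.{v} V]
    (hQ : IsExtendedDynkin V) (hac : IsAcyclicQuiver V) :
    ∃ (X : QuiverRep V) (e : V → ℕ),
      Indecomposable X ∧ LiesInHomogeneousTube X ∧ IsSingularQuiverGrassmannian X e := by
  obtain ⟨T, σ, hσ⟩ := hQ
  cases T with
  | A n hn =>
    obtain rfl | hn2 := hn.eq_or_lt
    · exact exists_singular_of_kronecker hac σ hσ
    · have : Finite V := Finite.of_equiv _ σ.symm
      have : Nonempty V := ⟨σ.symm ⟨0, Nat.succ_pos n⟩⟩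
      obtain ⟨o, ho⟩ := hac.exists_sink
      exact exists_singular_of_system (isSubspaceSystem_cycle hn2) σ hσ (by simp) (Or.inl ho)
  | D n hn => exact TypeD.exists_singular hn σ hσ
  | E6 => exact exists_singular_of_star TypeE.isStarTriple6 TypeE.isStarGraph6 σ hσ
  | E7 => exact exists_singular_of_star TypeE.isStarTriple7 TypeE.isStarGraph7 σ hσ
  | E8 => exact exists_singular_of_star TypeE.isStarTriple8 TypeE.isStarGraph8 σ hσ
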